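/- Let $\omega,\mathcal B,\varepsilon>0$, $b\in\mathbb R$, $A(x)=b\,(-x_2,x_1)/|x|^2$ and $h(x,\xi)=\frac12|\xi-A(x)|^2+\frac{\omega^2}2|x|^2$ on $\mathbb R^2$. Let $$x^t(y,\eta)=\cos(\omega t)\,y+\tfrac{\sin(\omega t)}{\omega}(\eta-A(y)),\qquad \xi^t=-\omega\sin(\omega t)\,y+\cos(\omega t)(\eta-A(y))+A(x^t)$$ be the Hamiltonian trajectory with $(x^0,\xi^0)=(y,\eta)$, let $S(t,y,\eta)=\int_0^t(h_\xi(x^s,\xi^s)\cdot\xi^s-h(x^s,\xi^s))\,ds$ be the action, and let $$\varphi(t,x,y,\eta)=S+(x-x^t)\cdot\xi^t+\tfrac{i\mathcal B}2|x-x^t|^2,\qquad Z(t,y,\eta)=\xi^t_\eta-i\mathcal B\,x^t_\eta .$$ Powers $(\det Z)^{\pm1/2}$ are taken with the branch that is continuous in $t$ along the trajectory and equals $1$ at $t=0$. Let $\theta\in C^\infty(\mathbb R^2)$ be real valued with $\theta=1$ for $|x|>2$ and $\theta=0$ for $|x|<1$, and put $\theta_\varepsilon(x)=\theta(x/\varepsilon)$.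 Say that $(t,y,\eta)$ is good if $x^s(y,\eta)\ne0$ for all $s$ between $0$ and $t$. Amplitudes. Call $(u_{(k)}(t,y,\eta))_{k\ge0}$ admissible if $u_{(0)}=\theta_\varepsilon(x^t)\theta_\varepsilon(y)(\det Z)^{1/2}$ at good points, and every $u_{(k)}$ is $C^\infty$ on the set of good points and has there at most polynomial growth in $\eta$, locally uniformly in $(t,y)$. For an admissible family let $$U_N(t,x,y)=(2\pi\alpha)^{-2}\int_{\mathbb R^2}e^{i\varphi/\alpha}\sum_{k=0}^N\alpha^k u_{(k)}(t,y,\eta)\,d\eta .$$ The transport amplitudes are $u_{(0)}$ as above and $u_{(k)}=\theta_\varepsilon(x^t)\theta_\varepsilon(y)\,v_{(k)}$ for $k\ge1$, where $$\partial_t v_{(k)}=\tfrac12\operatorname{Tr}(Z^{-1}\partial_tZ)\,v_{(k)}-i\sum_{m=2}^{k+1}T_m u_{(k+1-m)},\qquad v_{(k)}|_{t=0}=0 .$$ Here $T_m$ is the differential operator in $\eta$ which is the coefficient of $\alpha^m$ when, in $\int e^{i\varphi/\alpha}(\varphi_t+h(x,\varphi_x))f(\eta)\,d\eta$, one expands $\varphi_t+h(x,\varphi_x)$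 in powers of $x-x^t$ and converts these into powers of $\alpha$ by $(x-x^t)_j\,e^{i\varphi/\alpha}=-i\alpha\sum_k(Z^{-1})_{kj}\,\partial_{\eta_k}e^{i\varphi/\alpha}$ and integration by parts. Let $\eta_*=\eta_*(t,x,y)=A(y)+\frac{\omega}{\sin(\omega t)}(x-\cos(\omega t)y)$, and let $K$ be a compact set of points $(t,x,y)\in\mathbb R\times\mathbb R^2\times\mathbb R^2$ such that $\sin(\omega t)\ne0$ and $(t,y,\eta_*)$ is good. Then: 1. The transport amplitudes are admissible. 2. For $(t,x,y)\in K$ the phase $\varphi(t,x,y,\cdot)$ is smooth near every $\eta$ for which $(t,y,\eta)$ is good, and among these $\eta$ its only critical point is $\eta_*$. 3. For $(t,x,y)\in K$, $$S(t,y,\eta_*)=\frac{\omega}{2\sin(\omega t)}\bigl(\cos(\omega t)(|x|^2+|y|^2)-2x\cdot y\bigr)+b(\operatorname{Arg}x-\operatorname{Arg}y+2\ell\pi),$$ where the integer $\ell$ is such that $\operatorname{Arg}x-\operatorname{Arg}y+2\ell\pi$ is the increment over $[0,t]$ of a continuous polar angle of $s\mapsto x^s(y,\eta_*)$. 4. For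 every admissible family and every $N\ge0$, the integral defining $U_N$ converges absolutely for $(t,x,y)\in K$ and $\alpha>0$, and, as $\alpha\to0^+$, uniformly on $K$, $$U_N(t,x,y)=\frac{\omega\,e^{iS(t,y,\eta_*)/\alpha}}{2\pi i\alpha\sin(\omega t)}\sum_{k=0}^N\alpha^kC_k(t,x,y)+O(\alpha^N),\qquad C_m=(\det Z(t,y,\eta_*))^{-1/2}\sum_{k=0}^mL_{m-k}u_{(k)},$$ $$L_jf=\sum_{\mu=0}^{2j}\frac{i^{-j}2^{-j-\mu}}{(j+\mu)!\,\mu!}\Bigl[\langle\varphi_{\eta\eta}^{-1}D_\eta,D_\eta\rangle^{j+\mu}(\varphi_{\ge3}^{\mu}f)\Bigr]_{\eta=\eta_*},\qquad D_\eta=-i\partial_\eta,$$ where $\varphi_{\eta\eta}$ is taken at $\eta_*$ and $\varphi_{\ge3}(\eta)=\varphi(\eta)-\varphi(\eta_*)-\frac12(\eta-\eta_*)\cdot\varphi_{\eta\eta}(\eta_*)(\eta-\eta_*)$. 5. For every admissible family and every $N\ge0$, uniformly on the part of $K$ where $\theta_\varepsilon(x)=\theta_\varepsilon(y)=1$, $$U_N(t,x,y)=\frac{\omega\,e^{iS(t,y,\eta_*)/\alpha}}{2\pi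 i\alpha\sin(\omega t)}\,(1+O(\alpha)).$$ -/

import Mathlib

open Set Filter Topology MeasureTheory


noncomputable section

namespace AharonovBohm

/-- The Euclidean plane `ℝ²`. -/
abbrev Plane : Type := EuclideanSpace ℝ (Fin 2)

/-! ### The classical Hamiltonian and its flow -/

/-- The Aharonov-Bohm vector potential `A(x) = b (-x₂, x₁) / |x|²` (used for `x ≠ 0` only). -/
def vecPot (b : ℝ) (x : Plane) : Plane :=
  !₂[-b * (x 1 / ‖x‖ ^ 2), b * (x 0 / ‖x‖ ^ 2)]

/-- The Hamiltonian `h(x, ξ) = |ξ - A(x)|² / 2 + ω² |x|² / 2`. -/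
def ham (ω b : ℝ) (x ξ : Plane) : ℝ :=
  ‖ξ - vecPot b x‖ ^ 2 / 2 + ω ^ 2 / 2 * ‖x‖ ^ 2

/-- The position `x^t(y, η)` of the Hamiltonian trajectory issued from `(y, η)`. -/
def position (ω b t : ℝ) (y η : Plane) : Plane :=
  Real.cos (ω * t) • y + (Real.sin (ω * t) / ω) • (η - vecPot b y)

/-- The momentum `ξ^t(y, η)` of the Hamiltonian trajectory issued from `(y, η)`. -/
def momentum (ω b t : ℝ) (y η : Plane) : Plane :=
  -(ω * Real.sin (ω * t)) • y + Real.cos (ω * t) • (η - vecPot b y)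
    + vecPot b (position ω b t y η)

/-- The trajectory issued from `(y, η)` avoids the origin between the times `0` and `t`. -/
def Avoids (ω b t : ℝ) (y η : Plane) : Prop :=
  ∀ s ∈ uIcc 0 t, position ω b s y η ≠ 0

/-! The next facts say that `(position, momentum)` solves the Hamilton-Jacobi system
`ẋ = h_ξ`, `ξ̇ = -h_x`, `x(0) = y`, `ξ(0) = η` as long as the trajectory avoids the origin. -/

theorem position_zero (ω b : ℝ) (y η : Plane) : position ω b 0 y η = y := by
  simp [position]

theorem momentum_zero (ω b : ℝ) (y η : Plane) : momentum ω b 0 y η = η := by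
  simp [momentum, position_zero]

theorem hasGradientAt_ham_momentum (ω b : ℝ) (x ξ : Plane) :
    HasGradientAt (fun ζ => ham ω b x ζ) (ξ - vecPot b x) ξ := by
  rw [hasGradientAt_iff_hasFDerivAt]
  have h : HasFDerivAt (fun ζ : Plane => ζ - vecPot b x) (ContinuousLinearMap.id ℝ Plane) ξ :=
    (hasFDerivAt_id ξ).sub_const _
  have h2 := ((h.norm_sq).mul_const (1 / 2)).add_const (ω ^ 2 / 2 * ‖x‖ ^ 2)
  have hf : (fun ζ => ham ω b x ζ) =
      fun ζ => ‖ζ - vecPot b x‖ ^ 2 * (1 / 2) + ω ^ 2 / 2 * ‖x‖ ^ 2 := by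
    funext ζ
    rw [ham, div_eq_mul_one_div]
  rw [hf]
  refine h2.congr_fderiv ?_
  ext v
  simp

theorem hasDerivAt_position (ω b t : ℝ) (hω : ω ≠ 0) (y η : Plane) :
    HasDerivAt (fun s => position ω b s y η)
      (gradient (fun ζ => ham ω b (position ω b t y η) ζ) (momentum ω b t y η)) t := by
  rw [(hasGradientAt_ham_momentum ω b _ _).gradient]
  have hl : HasDerivAt (fun s : ℝ => ω * s) ω t := by
    simpa using (hasDerivAt_id t).const_mul ω
  have h1 := (hl.cos.smul_const y).add ((hl.sin.div_const ω).smul_const (η - vecPot b y))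
  refine h1.congr_deriv ?_
  rw [mul_div_assoc, div_self hω]
  simp [momentum, mul_comm]

theorem hasDerivAt_momentum (ω b t : ℝ) (hω : ω ≠ 0) (y η : Plane)
    (h0 : position ω b t y η ≠ 0) :
    HasDerivAt (fun s => momentum ω b s y η)
      (-gradient (fun x => ham ω b x (momentum ω b t y η)) (position ω b t y η)) t := by
  have hdp : HasDerivAt (fun s => position ω b s y η)
      (momentum ω b t y η - vecPot b (position ω b t y η)) t := by
    have := hasDerivAt_position ω b t hω y η
    rwa [(hasGradientAt_ham_momentum ω b _ _).gradient] at this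
  set p := position ω b t y η with hp
  set ξ := momentum ω b t y η with hξ
  have hn : p 0 ^ 2 + p 1 ^ 2 ≠ 0 := by
    intro h
    apply h0
    ext i
    fin_cases i
    · simp; nlinarith [sq_nonneg (p 0), sq_nonneg (p 1)]
    · simp; nlinarith [sq_nonneg (p 0), sq_nonneg (p 1)]
  have hnorm : ∀ x : Plane, ‖x‖ ^ 2 = x 0 ^ 2 + x 1 ^ 2 := fun x => by
    simp [EuclideanSpace.real_norm_sq_eq, Fin.sum_univ_two]
  have hc : ∀ i : Fin 2, HasFDerivAt (fun x : Plane => x i) (EuclideanSpace.proj i : Plane →L[ℝ] ℝ) p :=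
    fun i => (EuclideanSpace.proj i : Plane →L[ℝ] ℝ).hasFDerivAt
  have hN : HasFDerivAt (fun x : Plane => x 0 ^ 2 + x 1 ^ 2) _ p := ((hc 0).pow 2).add ((hc 1).pow 2)
  have hG : HasGradientAt (fun x => ham ω b x ξ)
      !₂[-((ξ 0 + b * (p 1 / (p 0 ^ 2 + p 1 ^ 2))) * (2 * b * p 0 * p 1 / (p 0 ^ 2 + p 1 ^ 2) ^ 2)
          + (ξ 1 - b * (p 0 / (p 0 ^ 2 + p 1 ^ 2))) * (b * (p 1 ^ 2 - p 0 ^ 2) / (p 0 ^ 2 + p 1 ^ 2) ^ 2))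
          + ω ^ 2 * p 0,
        -((ξ 0 + b * (p 1 / (p 0 ^ 2 + p 1 ^ 2))) * (b * (p 1 ^ 2 - p 0 ^ 2) / (p 0 ^ 2 + p 1 ^ 2) ^ 2)
          - (ξ 1 - b * (p 0 / (p 0 ^ 2 + p 1 ^ 2))) * (2 * b * p 0 * p 1 / (p 0 ^ 2 + p 1 ^ 2) ^ 2))
          + ω ^ 2 * p 1] p := by
    have hfun : (fun x => ham ω b x ξ) = fun x : Plane =>
        ((ξ 0 + b * (x 1 * (x 0 ^ 2 + x 1 ^ 2)⁻¹)) ^ 2 + (ξ 1 - b * (x 0 * (x 0 ^ 2 + x 1 ^ 2)⁻¹)) ^ 2) * (1 / 2)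
          + ω ^ 2 / 2 * (x 0 ^ 2 + x 1 ^ 2) := by
      funext x
      rw [ham, hnorm, hnorm]
      simp only [vecPot, PiLp.sub_apply, hnorm]
      simp
      ring
    rw [hfun, hasGradientAt_iff_hasFDerivAt]
    have hi := (hasDerivAt_inv hn).comp_hasFDerivAt p hN
    have h1 := ((((hc 1).mul hi).const_mul b).const_add (ξ 0)).pow 2
    have h2 := ((((hc 0).mul hi).const_mul b).const_sub (ξ 1)).pow 2
    refine (((h1.add h2).mul_const (1 / 2)).add (hN.const_mul (ω ^ 2 / 2))).congr_fderiv ?_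
    ext v
    simp [PiLp.inner_apply, Fin.sum_univ_two]
    field_simp
    ring
  rw [hG.gradient]
  have hp0 : ∀ i : Fin 2, HasDerivAt (fun s => position ω b s y η i) (ξ i - vecPot b p i) t :=
    fun i => (EuclideanSpace.proj i : Plane →L[ℝ] ℝ).hasFDerivAt.comp_hasDerivAt t hdp
  have hl : HasDerivAt (fun s : ℝ => ω * s) ω t := by
    simpa using (hasDerivAt_id t).const_mul ω
  have hNt : HasDerivAt
      (fun s => position ω b s y η 0 ^ 2 + position ω b s y η 1 ^ 2) _ t :=
    ((hp0 0).pow 2).add ((hp0 1).pow 2)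
  have hA : ∀ s i, momentum ω b s y η i = -(ω * Real.sin (ω * s)) * y i
      + Real.cos (ω * s) * (η i - vecPot b y i) + vecPot b (position ω b s y η) i := by
    intro s i
    simp [momentum]
  have hP : ∀ i, p i = Real.cos (ω * t) * y i
      + Real.sin (ω * t) / ω * (η i - vecPot b y i) := by
    intro i
    simp [hp, position]
  have hlin : ∀ i, HasDerivAt (fun s => -(ω * Real.sin (ω * s)) * y i
      + Real.cos (ω * s) * (η i - vecPot b y i)) (-(ω ^ 2 * p i)) t := by
    intro i
    have := ((hl.sin.const_mul ω).neg.mul_const (y i)).add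
      (hl.cos.mul_const (η i - vecPot b y i))
    refine this.congr_deriv ?_
    rw [hP]
    field_simp
    ring
  have key : ∀ g : Plane, (∀ i, HasDerivAt (fun s => momentum ω b s y η i) (g i) t) →
      HasDerivAt (fun s => momentum ω b s y η) g t := by
    intro g hg
    have h := hasDerivAt_pi.2 hg
    exact (EuclideanSpace.equiv (Fin 2) ℝ).symm.toContinuousLinearMap.hasFDerivAt.comp_hasDerivAt t h
  have hv : ∀ x : Plane, vecPot b x 0 = -b * (x 1 * (x 0 ^ 2 + x 1 ^ 2)⁻¹) ∧
      vecPot b x 1 = b * (x 0 * (x 0 ^ 2 + x 1 ^ 2)⁻¹) := by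
    intro x
    simp [vecPot, hnorm, div_eq_mul_inv]
  have hit : HasDerivAt
      (fun s => (position ω b s y η 0 ^ 2 + position ω b s y η 1 ^ 2)⁻¹) _ t := hNt.inv hn
  have hv0 := (hv p).1
  have hv1 := (hv p).2
  apply key
  intro i
  fin_cases i
  · have hf : (fun s => momentum ω b s y η 0) = fun s =>
        (-(ω * Real.sin (ω * s)) * y 0 + Real.cos (ω * s) * (η 0 - vecPot b y 0))
          + -b * (position ω b s y η 1 *
            (position ω b s y η 0 ^ 2 + position ω b s y η 1 ^ 2)⁻¹) := by
      funext s
      rw [hA, (hv (position ω b s y η)).1]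
    have h1 := (hlin 0).add (((hp0 1).mul hit).const_mul (-b))
    change HasDerivAt (fun s => momentum ω b s y η 0) _ t
    rw [hf]
    refine h1.congr_deriv ?_
    simp [← hp, hv0, hv1]
    field_simp
    ring
  · have hf : (fun s => momentum ω b s y η 1) = fun s =>
        (-(ω * Real.sin (ω * s)) * y 1 + Real.cos (ω * s) * (η 1 - vecPot b y 1))
          + b * (position ω b s y η 0 *
            (position ω b s y η 0 ^ 2 + position ω b s y η 1 ^ 2)⁻¹) := by
      funext s
      rw [hA, (hv (position ω b s y η)).2]
    have h1 := (hlin 1).add (((hp0 0).mul hit).const_mul b)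
    change HasDerivAt (fun s => momentum ω b s y η 1) _ t
    rw [hf]
    refine h1.congr_deriv ?_
    simp [← hp, hv0, hv1]
    field_simp
    ring

/-! ### Action, phase, the matrix `Z` and the branch of its square root -/

/-- The action `S(t, y, η) = ∫₀ᵗ (h_ξ(x^s, ξ^s) · ξ^s - h(x^s, ξ^s)) ds`. -/
def action (ω b t : ℝ) (y η : Plane) : ℝ :=
  ∫ s in (0 : ℝ)..t,
    (inner ℝ (gradient (fun ζ => ham ω b (position ω b s y η) ζ) (momentum ω b s y η))
        (momentum ω b s y η)
      - ham ω b (position ω b s y η) (momentum ω b s y η))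

/-- The complex phase
`φ(t, x, y, η) = S(t, y, η) + (x - x^t) · ξ^t + i B |x - x^t|² / 2`. -/
def phase (ω b B t : ℝ) (x y η : Plane) : ℂ :=
  (action ω b t y η : ℂ)
    + ((inner ℝ (x - position ω b t y η) (momentum ω b t y η) : ℝ) : ℂ)
    + Complex.I * ((B * ‖x - position ω b t y η‖ ^ 2 / 2 : ℝ) : ℂ)

/-- The partial derivative `∂f/∂η_j` of a complex function on the plane. -/
def pd (j : Fin 2) (f : Plane → ℂ) (η : Plane) : ℂ :=
  fderiv ℝ f η (EuclideanSpace.single j 1)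

/-- The matrix `Z = ξ^t_η - i B x^t_η`. -/
def matZ (ω b B t : ℝ) (y η : Plane) : Matrix (Fin 2) (Fin 2) ℂ :=
  Matrix.of fun j k =>
    pd k (fun ζ => ((momentum ω b t y ζ j : ℝ) : ℂ)) η
      - Complex.I * (B : ℂ) * pd k (fun ζ => ((position ω b t y ζ j : ℝ) : ℂ)) η

/-- `r` is the branch along the trajectory, between the times `0` and `t`, of the square root of
`det Z` that is continuous in time and equals `1` at time `0`. -/
def IsSqrtDetZ (ω b B t : ℝ) (y η : Plane) (r : ℝ → ℂ) : Prop :=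
  ContinuousOn r (uIcc 0 t) ∧ r 0 = 1 ∧ ∀ s ∈ uIcc 0 t, r s ^ 2 = (matZ ω b B s y η).det

open Classical in
/-- `(det Z)^{1/2}`, for the branch that is continuous in time with value `1` at time `0`. The value
`0` is used on trajectories along which there is no such branch; this does not happen for a
trajectory that avoids the origin. -/
def sqrtDetZ (ω b B t : ℝ) (y η : Plane) : ℂ :=
  if h : ∃ r : ℝ → ℂ, IsSqrtDetZ ω b B t y η r then h.choose t else 0

/-! ### Amplitudes -/

/-- The product of cut-offs `θ_ε(x^t(y, η)) θ_ε(y)`, where `θ_ε(x) = θ(x / ε)`. -/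
def cutoff (θ : Plane → ℝ) (ε ω b t : ℝ) (y η : Plane) : ℝ :=
  θ (ε⁻¹ • position ω b t y η) * θ (ε⁻¹ • y)

/-- The leading amplitude `u_(0) = θ_ε(x^t) θ_ε(y) (det Z)^{1/2}`. -/
def leadingAmp (θ : Plane → ℝ) (ε ω b B t : ℝ) (y η : Plane) : ℂ :=
  (cutoff θ ε ω b t y η : ℂ) * sqrtDetZ ω b B t y η

/-- The admissible amplitudes: `u_(0)` is the leading amplitude, and each `u_(k)(t, y, η)` is
smooth on the open set of those `(t, y, η)` whose trajectory avoids the origin, with at most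
polynomial growth in `η` there, locally uniformly in `(t, y)`. (For `y ≠ 0` almost all `η` give a
trajectory which avoids the origin.) -/
structure IsAmplitude (θ : Plane → ℝ) (ε ω b B : ℝ) (u : ℕ → ℝ → Plane → Plane → ℂ) : Prop where
  zero : ∀ (t : ℝ) (y η : Plane), Avoids ω b t y η → u 0 t y η = leadingAmp θ ε ω b B t y η
  smooth : ∀ k : ℕ, ContDiffOn ℝ ((⊤ : ℕ∞) : WithTop ℕ∞)
    (fun p : ℝ × Plane × Plane => u k p.1 p.2.1 p.2.2)
    {p : ℝ × Plane × Plane | Avoids ω b p.1 p.2.1 p.2.2}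
  growth : ∀ (k : ℕ) (Q : Set (ℝ × Plane)), IsCompact Q →
    ∃ (C : ℝ) (M : ℕ), ∀ (t : ℝ) (y : Plane), (t, y) ∈ Q → ∀ η : Plane, Avoids ω b t y η →
      ‖u k t y η‖ ≤ C * (1 + ‖η‖) ^ M

/-! ### The transport equations

Applying `i α ∂_t - H` to `e^{iφ/α} u(t, y, η)` gives
`e^{iφ/α} (i α ∂_t - α B - (φ_t + h(x, φ_x))) u`, and `φ_t + h(x, φ_x)` vanishes to second order at
`x = x^t`. Its Taylor monomials in `z = x - x^t` are turned into powers of `α` by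
`z_j e^{iφ/α} = -i α ∑_k (Z⁻¹)_{kj} ∂_{η_k} e^{iφ/α}` and integration by parts in `η`. -/

/-- The Hamiltonian with complex momentum, `∑_j (ζ_j - A_j(x))² / 2 + ω² |x|² / 2`. -/
def hamC (ω b : ℝ) (x : Plane) (ζ : Fin 2 → ℂ) : ℂ :=
  (∑ j : Fin 2, (ζ j - ((vecPot b x j : ℝ) : ℂ)) ^ 2) / 2
    + ((ω ^ 2 / 2 * ‖x‖ ^ 2 : ℝ) : ℂ)

/-- `x ↦ h(x, φ_x(t, x, y, η)) = h(x, ξ^t + i B (x - x^t))`. -/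
def hamPhase (ω b B t : ℝ) (y η x : Plane) : ℂ :=
  hamC ω b x fun j => ((momentum ω b t y η j : ℝ) : ℂ)
    + Complex.I * (B : ℂ) * (((x - position ω b t y η) j : ℝ) : ℂ)

/-- The iterated partial derivative `∂_{J₁} ⋯ ∂_{Jₙ} f`. -/
def pdList (J : List (Fin 2)) (f : Plane → ℂ) : Plane → ℂ :=
  J.foldr pd f

/-- The coefficient of `α^m` of the amplitude which replaces `z_{J₁} ⋯ z_{Jₙ} f(η)` under
`∫ e^{iφ/α} ⋯ dη`, where `z = x - x^t`, when one substitutes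
`z_j e^{iφ/α} = -i α ∑_k (W_{kj}) ∂_{η_k} e^{iφ/α}`, `W = Z⁻¹`, and integrates by parts, using
`∂z_l/∂η_k = -c δ_{kl}`, `c = sin(ω t) / ω`. -/
def reduce (c : ℂ) (W : Plane → Matrix (Fin 2) (Fin 2) ℂ) :
    ℕ → List (Fin 2) → (Plane → ℂ) → Plane → ℂ
  | 0, [], f => f
  | 0, _ :: _, _ => fun _ => 0
  | _ + 1, [], _ => fun _ => 0
  | m + 1, j :: J, f => fun η =>
      Complex.I *
        (reduce c W m J (fun ζ => ∑ k : Fin 2, pd k (fun ζ' => W ζ' k j * f ζ') ζ) η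
          - c * ∑ l : Fin J.length,
              reduce c W m (J.eraseIdx l) (fun ζ => W ζ (J.get l) j * f ζ) η)

/-- The differential operator in `η` which is the coefficient of `α^m`, `m ≥ 1`, in the
amplitude replacing `(φ_t + h(x, φ_x)) f(η)` after integration by parts; only Taylor monomials of
degree `2 ≤ n ≤ 2 m` contribute to it. -/
def transportOp (ω b B : ℝ) (m : ℕ) (t : ℝ) (y : Plane) (f : Plane → ℂ) (η : Plane) : ℂ :=
  ∑ n ∈ Finset.Icc 2 (2 * m), ((n.factorial : ℕ) : ℂ)⁻¹ * ∑ J : Fin n → Fin 2,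
    reduce ((Real.sin (ω * t) / ω : ℝ) : ℂ) (fun ζ => (matZ ω b B t y ζ)⁻¹) m (List.ofFn J)
      (fun ζ => pdList (List.ofFn J) (hamPhase ω b B t y ζ) (position ω b t y ζ) * f ζ) η

/-- The amplitudes of the parametrix: `u_(0)` is the leading amplitude and
`u_(k) = θ_ε(x^t) θ_ε(y) v_(k)`, where `v_(k)` is the solution, vanishing at `t = 0`, of the
transport equation
`∂_t v_(k) - ½ Tr(Z⁻¹ ∂_t Z) v_(k) = -i ∑_{i < k} T_{i+2} u_(k-1-i)`, `T_m` being `transportOp m`.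
It is given by Duhamel's formula, `(det Z)^{1/2}` being the solution of the homogeneous equation
with value `1` at `t = 0`. -/
def transportAmp (θ : Plane → ℝ) (ε ω b B : ℝ) : ℕ → ℝ → Plane → Plane → ℂ
  | 0 => fun t y η => leadingAmp θ ε ω b B t y η
  | k + 1 => fun t y η =>
      (cutoff θ ε ω b t y η : ℂ) * (sqrtDetZ ω b B t y η *
        ∫ s in (0 : ℝ)..t, (sqrtDetZ ω b B s y η)⁻¹ *
          (-Complex.I * ∑ i : Fin (k + 1),
            transportOp ω b B (i + 2) s y (transportAmp θ ε ω b B (k - i) s y) η))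
  termination_by k => k
  decreasing_by omega

/-! ### The kernel, the critical point and the stationary phase coefficients -/

/-- The integrand `e^{iφ/α} ∑_{k ≤ N} α^k u_(k)(t, y, η)` of the kernel. -/
def kernelIntegrand (ω b B : ℝ) (u : ℕ → ℝ → Plane → Plane → ℂ) (N : ℕ) (α t : ℝ)
    (x y η : Plane) : ℂ :=
  Complex.exp (Complex.I * phase ω b B t x y η / (α : ℂ))
    * ∑ k ∈ Finset.range (N + 1), (α : ℂ) ^ k * u k t y η

/-- The kernel `U_N(t, x, y) = (2πα)⁻² ∫ e^{iφ/α} ∑_{k ≤ N} α^k u_(k)(t, y, η) dη`. -/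
def kernelU (ω b B : ℝ) (u : ℕ → ℝ → Plane → Plane → ℂ) (N : ℕ) (α t : ℝ) (x y : Plane) : ℂ :=
  (((2 * Real.pi * α) ^ 2 : ℝ) : ℂ)⁻¹ * ∫ η : Plane, kernelIntegrand ω b B u N α t x y η

/-- The critical point `η_* = A(y) + ω (x - cos(ω t) y) / sin(ω t)`. -/
def etaStar (ω b t : ℝ) (x y : Plane) : Plane :=
  vecPot b y + (ω / Real.sin (ω * t)) • (x - Real.cos (ω * t) • y)

/-- The region where `sin(ω t) ≠ 0` and the trajectory from `y` to `x` issued from `(y, η_*)` avoids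
the origin between the times `0` and `t` (in particular `y ≠ 0` and `x ≠ 0`). -/
def region (ω b : ℝ) : Set (ℝ × Plane × Plane) :=
  {p | Real.sin (ω * p.1) ≠ 0 ∧ Avoids ω b p.1 p.2.2 (etaStar ω b p.1 p.2.1 p.2.2)}

/-- The Hessian `φ_ηη(t, x, y, η_*)`. -/
def phaseHess (ω b B t : ℝ) (x y : Plane) : Matrix (Fin 2) (Fin 2) ℂ :=
  Matrix.of fun j k => pd j (pd k (phase ω b B t x y)) (etaStar ω b t x y)

/-- The remainder
`φ_{≥3}(η) = φ(η) - φ(η_*) - ½ (η - η_*) · φ_ηη(η_*) (η - η_*)`. -/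
def phaseGeThree (ω b B t : ℝ) (x y η : Plane) : ℂ :=
  phase ω b B t x y η - phase ω b B t x y (etaStar ω b t x y)
    - (∑ j : Fin 2, ∑ k : Fin 2, (((η - etaStar ω b t x y) j : ℝ) : ℂ)
        * phaseHess ω b B t x y j k * (((η - etaStar ω b t x y) k : ℝ) : ℂ)) / 2

/-- The operator `⟨M D, D⟩ = ∑_{jk} M_{jk} D_j D_k` with `D = -i ∂_η`. -/
def quadD (M : Matrix (Fin 2) (Fin 2) ℂ) (f : Plane → ℂ) : Plane → ℂ := fun η =>
  ∑ j : Fin 2, ∑ k : Fin 2,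
    M j k * (-Complex.I * pd j (fun ζ => -Complex.I * pd k f ζ) η)

/-- The stationary phase operators
`L_j f = ∑_{μ ≤ 2j} i^{-j} 2^{-j-μ} / ((j+μ)! μ!) [⟨φ_ηη⁻¹ D, D⟩^{j+μ} (φ_{≥3}^μ f)](η_*)`. -/
def statPhaseL (ω b B t : ℝ) (x y : Plane) (j : ℕ) (f : Plane → ℂ) : ℂ :=
  ∑ μ ∈ Finset.range (2 * j + 1),
    ((Complex.I ^ j)⁻¹ * ((2 : ℂ) ^ (j + μ))⁻¹
        / (((j + μ).factorial : ℕ) * ((μ.factorial : ℕ) : ℂ)))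
      * ((quadD (phaseHess ω b B t x y)⁻¹)^[j + μ]
          (fun η => phaseGeThree ω b B t x y η ^ μ * f η)) (etaStar ω b t x y)

/-- The coefficients `C_m = (det Z(t, y, η_*))^{-1/2} ∑_{k ≤ m} L_{m-k} u_(k)`. -/
def coeffC (ω b B : ℝ) (u : ℕ → ℝ → Plane → Plane → ℂ) (m : ℕ) (t : ℝ) (x y : Plane) : ℂ :=
  (sqrtDetZ ω b B t y (etaStar ω b t x y))⁻¹
    * ∑ k ∈ Finset.range (m + 1), statPhaseL ω b B t x y (m - k) (u k t y)

/-- The Mehler-type factor `ω e^{iS(t, y, η_*)/α} / (2πiα sin(ω t))`. -/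
def mehlerFactor (ω b α t : ℝ) (x y : Plane) : ℂ :=
  (ω : ℂ) * Complex.exp (Complex.I * (action ω b t y (etaStar ω b t x y) : ℂ) / (α : ℂ))
    / (2 * (Real.pi : ℂ) * Complex.I * (α : ℂ) * ((Real.sin (ω * t) : ℝ) : ℂ))

/-- The principal argument of a point of the plane. -/
def argPlane (x : Plane) : ℝ := Complex.arg ⟨x 0, x 1⟩

/-- `ϑ` is a continuous choice, between the times `0` and `t`, of the polar angle of the
trajectory issued from `(y, η)`. -/
def IsAngleLift (ω b t : ℝ) (y η : Plane) (ϑ : ℝ → ℝ) : Prop :=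
  ContinuousOn ϑ (uIcc 0 t) ∧ ∀ s ∈ uIcc 0 t,
    position ω b s y η = ‖position ω b s y η‖ • !₂[Real.cos (ϑ s), Real.sin (ϑ s)]

end AharonovBohm

end

open AharonovBohm

/-!
The flow of `h` is explicit, and the whole proof rests on its geometry. Since `A` is curl free, the
Lorentz force vanishes away from the origin and `x^t` moves as for the harmonic oscillator, with
velocity `ξ^t - A(x^t)`. Writing `σ = sin(ωt) / ω`, one finds `Z = (cos(ωt) - iBσ) I + σ DA(x^t)`,
where `DA(x)` is symmetric and traceless with eigenvalues `± b / |x|²`. The rotated eigenvalues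
`e^{iωt} λ_±` of `Z` never meet the negative half-line (`rotated_eigZ_mem_slitPlane`), so the branch
of `(det Z)^{1/2}` along trajectories is `e^{-iωt}` times the product of the principal square roots
of these two numbers (`sqrtDetZ_eq`). This gives both its smoothness and its exact value in the
Gaussian integral.

*Admissibility.* Families which grow polynomially in `η` together with all their `η`-derivatives,
locally uniformly in the other variables, form a class `Sym` that is stable under sums, products,
derivatives, reciprocals of polynomial growth (`Sym.inv`), square roots (`Sym.sqrt`) and integration
in time (`StarTime.sym_timeInt`). Where `y` and `x^t` stay away from the origin, the entries of
`Z⁻¹`, `(det Z)^{±1/2}` and the Taylor coefficients of `h(x, φ_x)` at `x^t` belong to it. The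
cut-offs vanish near the origin, so every transport amplitude belongs to it on the whole set of good
points; the induction step is Duhamel's formula (`sym_transportAmp`).

*Critical point and action.* The identity `S_η = σ ξ^t` (`pd_action`) gives `φ_η = Zᵀ (x - x^t)`
(`pd_phase`). As `Z` is invertible, critical points are the solutions of `x^t = x`, that is
`η = η_*`. The Lagrangian is `b` times the angular velocity of `x^t` plus the derivative of
`x^t · (ξ^t - A(x^t)) / 2` (`action_eq_angular`), and the integral of the angular velocity is the
increment of a continuous polar angle (`position_eq_polar`).

*Stationary phase.* The imaginary part of `φ` is exactly `B σ² |η - η_*|² / 2` (`phase_im`), so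
`φ_{≥3}` is real valued. Hence `e^{iφ/α} = e^{iS/α} e^{iφ_{≥3}/α} G` with a Gaussian `G` of modulus
`e^{-Bσ²|η - η_*|²/(2α)}` and a factor `e^{iφ_{≥3}/α}` of modulus one, and no contour deformation or
global control of the phase is needed. Near `η_*` one expands `e^{iφ_{≥3}/α}` in powers of its
exponent and each `φ_{≥3}^μ f` by Taylor's formula. Far from it the Gaussian absorbs the polynomial
growth of the amplitude. The Gaussian moments of Taylor polynomials are given by Wick's formula
(`integral_taylorHom_even`, `integral_taylorHom_odd`). As `φ_{≥3}` vanishes to third order, the terms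
with `2ν < 3μ` disappear and those left are the operators `L_j`; the error depends only on bounds
for finitely many derivatives (`StatPhaseBounds.norm_integral_sub_le`), which are uniform on a
compact set (`exists_statPhaseBounds`). The `η` whose trajectory meets the origin form a null set
(`ae_avoids`). Finally `∫ G` is computed in the eigenframe of `DA`, where it matches
`(det Z)^{-1/2}` with the correct branch (`integral_gaussW_phaseHess`). The amplitude `u_k` is
expanded up to the order `N - k` for the full expansion and up to the order `0` for the leading term.
-/

open AharonovBohm

set_option linter.unusedSectionVars false

namespace AharonovBohm

/-! ### Partial derivatives and families of symbols -/

/-- The `j`-th vector of the standard basis of the plane. -/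
noncomputable abbrev stdVec (j : Fin 2) : Plane := EuclideanSpace.single j 1

theorem pd_congr_of_eventuallyEq {f g : Plane → ℂ} {η : Plane} (h : f =ᶠ[𝓝 η] g) (j : Fin 2) :
    pd j f η = pd j g η := by
  simp only [pd, h.fderiv_eq]

theorem pd_congr_on {U : Set Plane} (hU : IsOpen U) {f g : Plane → ℂ} (h : EqOn f g U)
    (j : Fin 2) : EqOn (pd j f) (pd j g) U := fun _ hη =>
  pd_congr_of_eventuallyEq (h.eventuallyEq_of_mem (hU.mem_nhds hη)) j

theorem pd_const (j : Fin 2) (c : ℂ) (η : Plane) : pd j (fun _ => c) η = 0 := by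
  simp [pd]

theorem pd_add {f g : Plane → ℂ} {η : Plane} (hf : DifferentiableAt ℝ f η)
    (hg : DifferentiableAt ℝ g η) (j : Fin 2) :
    pd j (fun ζ => f ζ + g ζ) η = pd j f η + pd j g η := by
  simp only [pd]
  rw [fderiv_fun_add hf hg]
  simp

theorem pd_sub {f g : Plane → ℂ} {η : Plane} (hf : DifferentiableAt ℝ f η)
    (hg : DifferentiableAt ℝ g η) (j : Fin 2) :
    pd j (fun ζ => f ζ - g ζ) η = pd j f η - pd j g η := by
  simp only [pd]
  rw [fderiv_fun_sub hf hg]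
  simp

theorem pd_mul {f g : Plane → ℂ} {η : Plane} (hf : DifferentiableAt ℝ f η)
    (hg : DifferentiableAt ℝ g η) (j : Fin 2) :
    pd j (fun ζ => f ζ * g ζ) η = pd j f η * g η + f η * pd j g η := by
  simp only [pd]
  rw [fderiv_fun_mul hf hg]
  simp
  ring

theorem pd_const_mul {f : Plane → ℂ} {η : Plane} (hf : DifferentiableAt ℝ f η) (c : ℂ)
    (j : Fin 2) : pd j (fun ζ => c * f ζ) η = c * pd j f η := by
  rw [pd_mul (differentiableAt_const _) hf, pd_const, zero_mul, zero_add]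

theorem pd_sum {ι : Type*} (s : Finset ι) {f : ι → Plane → ℂ} {η : Plane}
    (hf : ∀ i ∈ s, DifferentiableAt ℝ (f i) η) (j : Fin 2) :
    pd j (fun ζ => ∑ i ∈ s, f i ζ) η = ∑ i ∈ s, pd j (f i) η := by
  simp only [pd]
  rw [fderiv_fun_sum hf]
  simp

/-- Partial derivatives of a smooth function commute. -/
theorem pd_comm {U : Set Plane} (hU : IsOpen U) {f : Plane → ℂ}
    (hf : ContDiffOn ℝ ((⊤ : ℕ∞) : WithTop ℕ∞) f U) {η : Plane} (hη : η ∈ U) (j k : Fin 2) :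
    pd j (pd k f) η = pd k (pd j f) η := by
  have hc : ContDiffAt ℝ ((⊤ : ℕ∞) : WithTop ℕ∞) f η := hf.contDiffAt (hU.mem_nhds hη)
  have hsym : IsSymmSndFDerivAt ℝ f η := by
    apply (hc.of_le (WithTop.coe_le_coe.2 (le_top : (2 : ℕ∞) ≤ ⊤))).isSymmSndFDerivAt
    simp
  have hd : DifferentiableAt ℝ (fderiv ℝ f) η :=
    (hc.fderiv_right (m := 1) (WithTop.coe_le_coe.2 (le_top : (2 : ℕ∞) ≤ ⊤))).differentiableAt (by simp)
  have key : ∀ a b : Fin 2, pd a (pd b f) η = fderiv ℝ (fderiv ℝ f) η (stdVec a) (stdVec b) := by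
    intro a b
    have : pd b f = fun ζ => fderiv ℝ f ζ (stdVec b) := rfl
    rw [this, pd, fderiv_clm_apply hd (differentiableAt_const _)]
    simp
  rw [key, key]
  exact hsym.eq _ _

section Param

variable {E : Type*} [NormedAddCommGroup E] [NormedSpace ℝ E]

/-- The slice over `e` of an open set of `E × ℝ²`. -/
def sliceAt (D : Set (E × Plane)) (e : E) : Set Plane := {η | (e, η) ∈ D}

theorem isOpen_sliceAt {D : Set (E × Plane)} (hD : IsOpen D) (e : E) : IsOpen (sliceAt D e) :=
  hD.preimage (by fun_prop : Continuous fun η : Plane => (e, η))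

/-- A family of functions on the plane is smooth on `D` if it is jointly smooth there. -/
abbrev SmoothFam (D : Set (E × Plane)) (f : E → Plane → ℂ) : Prop :=
  ContDiffOn ℝ ((⊤ : ℕ∞) : WithTop ℕ∞) (fun p : E × Plane => f p.1 p.2) D

theorem SmoothFam.slice {D : Set (E × Plane)} {f : E → Plane → ℂ} (hf : SmoothFam D f) (e : E) :
    ContDiffOn ℝ ((⊤ : ℕ∞) : WithTop ℕ∞) (f e) (sliceAt D e) :=
  ContDiffOn.comp (g := fun p : E × Plane => f p.1 p.2) (f := fun η : Plane => (e, η)) hf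
    (by fun_prop) (fun _ h => h)

theorem SmoothFam.differentiableAt {D : Set (E × Plane)} (hD : IsOpen D) {f : E → Plane → ℂ}
    (hf : SmoothFam D f) {e : E} {η : Plane} (h : (e, η) ∈ D) :
    DifferentiableAt ℝ (f e) η :=
  ((hf.slice e).contDiffAt ((isOpen_sliceAt hD e).mem_nhds h)).differentiableAt (by simp)

theorem pd_eq_fderiv_param {D : Set (E × Plane)} (hD : IsOpen D) {f : E → Plane → ℂ}
    (hf : SmoothFam D f) {e : E} {η : Plane} (h : (e, η) ∈ D) (j : Fin 2) :
    pd j (f e) η = fderiv ℝ (fun p : E × Plane => f p.1 p.2) (e, η) (0, stdVec j) := by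
  have hd : HasFDerivAt (fun p : E × Plane => f p.1 p.2)
      (fderiv ℝ (fun p : E × Plane => f p.1 p.2) (e, η)) (e, η) :=
    ((hf.contDiffAt (hD.mem_nhds h)).differentiableAt (by simp)).hasFDerivAt
  have h2 : HasFDerivAt (fun ζ : Plane => (e, ζ)) (ContinuousLinearMap.inr ℝ E Plane) η :=
    hasFDerivAt_prodMk_right e η
  have h3 := HasFDerivAt.comp η (g := fun p : E × Plane => f p.1 p.2) hd h2
  have h4 : fderiv ℝ (f e) η = _ := h3.fderiv
  rw [pd, h4]
  simp

theorem SmoothFam.pd {D : Set (E × Plane)} (hD : IsOpen D) {f : E → Plane → ℂ}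
    (hf : SmoothFam D f) (j : Fin 2) : SmoothFam D fun e => pd j (f e) := by
  have h1 : ContDiffOn ℝ ((⊤ : ℕ∞) : WithTop ℕ∞)
      (fun p : E × Plane => fderiv ℝ (fun p : E × Plane => f p.1 p.2) p (0, stdVec j)) D :=
    (hf.fderiv_of_isOpen hD (by simp)).clm_apply contDiffOn_const
  exact h1.congr fun p hp => pd_eq_fderiv_param hD hf hp j

theorem SmoothFam.congr' {D : Set (E × Plane)} {f g : E → Plane → ℂ}
    (hf : SmoothFam D f) (h : ∀ e η, (e, η) ∈ D → g e η = f e η) : SmoothFam D g :=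
  ContDiffOn.congr hf fun p hp => h p.1 p.2 hp

theorem pd_congr_fam {D : Set (E × Plane)} (hD : IsOpen D) {f g : E → Plane → ℂ}
    (h : ∀ e η, (e, η) ∈ D → g e η = f e η) (j : Fin 2) :
    ∀ e η, (e, η) ∈ D → pd j (g e) η = pd j (f e) η := fun e _ hη =>
  pd_congr_on (isOpen_sliceAt hD e) (fun ζ hζ => h e ζ hζ) j hη

/-- Polynomial growth in `η`, locally uniformly in the parameter, on the set `D`. -/
def PolyGrowth (D : Set (E × Plane)) (f : E → Plane → ℂ) : Prop :=
  ∀ Q : Set E, IsCompact Q → ∃ (C : ℝ) (M : ℕ), 0 ≤ C ∧ ∀ e ∈ Q, ∀ η, (e, η) ∈ D →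
    ‖f e η‖ ≤ C * (1 + ‖η‖) ^ M

theorem PolyGrowth.congr {D : Set (E × Plane)} {f g : E → Plane → ℂ} (hf : PolyGrowth D f)
    (h : ∀ e η, (e, η) ∈ D → g e η = f e η) : PolyGrowth D g := by
  intro Q hQ
  obtain ⟨C, M, hC, hb⟩ := hf Q hQ
  exact ⟨C, M, hC, fun e he η hη => by rw [h e η hη]; exact hb e he η hη⟩

theorem PolyGrowth.mono {D D' : Set (E × Plane)} {f : E → Plane → ℂ} (hf : PolyGrowth D f)
    (h : D' ⊆ D) : PolyGrowth D' f := by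
  intro Q hQ
  obtain ⟨C, M, hC, hb⟩ := hf Q hQ
  exact ⟨C, M, hC, fun e he η hη => hb e he η (h hη)⟩

theorem PolyGrowth.add {D : Set (E × Plane)} {f g : E → Plane → ℂ} (hf : PolyGrowth D f)
    (hg : PolyGrowth D g) : PolyGrowth D fun e η => f e η + g e η := by
  intro Q hQ
  obtain ⟨C, M, hC, hb⟩ := hf Q hQ
  obtain ⟨C', M', hC', hb'⟩ := hg Q hQ
  refine ⟨C + C', max M M', by positivity, fun e he η hη => ?_⟩
  have h1 : (1 : ℝ) ≤ 1 + ‖η‖ := by linarith [norm_nonneg η]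
  calc ‖f e η + g e η‖ ≤ ‖f e η‖ + ‖g e η‖ := norm_add_le _ _
    _ ≤ C * (1 + ‖η‖) ^ M + C' * (1 + ‖η‖) ^ M' := add_le_add (hb e he η hη) (hb' e he η hη)
    _ ≤ C * (1 + ‖η‖) ^ (max M M') + C' * (1 + ‖η‖) ^ (max M M') := by
        gcongr
        · exact le_max_left _ _
        · exact le_max_right _ _
    _ = _ := by ring

theorem PolyGrowth.mul {D : Set (E × Plane)} {f g : E → Plane → ℂ} (hf : PolyGrowth D f)
    (hg : PolyGrowth D g) : PolyGrowth D fun e η => f e η * g e η := by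
  intro Q hQ
  obtain ⟨C, M, hC, hb⟩ := hf Q hQ
  obtain ⟨C', M', hC', hb'⟩ := hg Q hQ
  refine ⟨C * C', M + M', by positivity, fun e he η hη => ?_⟩
  calc ‖f e η * g e η‖ = ‖f e η‖ * ‖g e η‖ := norm_mul _ _
    _ ≤ (C * (1 + ‖η‖) ^ M) * (C' * (1 + ‖η‖) ^ M') := by
        gcongr
        · exact hb e he η hη
        · exact hb' e he η hη
    _ = _ := by ring

/-- A function of the parameter alone which is bounded on compact sets has polynomial growth. -/
theorem PolyGrowth.of_continuous (D : Set (E × Plane)) {a : E → ℂ} (ha : Continuous a) :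
    PolyGrowth D fun e _ => a e := by
  intro Q hQ
  obtain ⟨C, hC⟩ := hQ.exists_bound_of_continuousOn ha.continuousOn
  refine ⟨|C|, 0, abs_nonneg _, fun e he η _ => ?_⟩
  simpa using (hC e he).trans (le_abs_self C)

/-- The derivatives in `η` of order at most `n` have polynomial growth on `D`. -/
def SymN (D : Set (E × Plane)) : ℕ → (E → Plane → ℂ) → Prop
  | 0, f => PolyGrowth D f
  | n + 1, f => PolyGrowth D f ∧ ∀ j, SymN D n fun e => pd j (f e)

/-- The class of families which are smooth on `D` and have, together with all their derivatives in
`η`, polynomial growth in `η`, locally uniformly in the parameter. -/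
structure Sym (D : Set (E × Plane)) (f : E → Plane → ℂ) : Prop where
  smooth : SmoothFam D f
  symN : ∀ n, SymN D n f

theorem SymN.pred {D : Set (E × Plane)} {n : ℕ} {f : E → Plane → ℂ} (h : SymN D (n + 1) f) :
    SymN D n f := by
  induction n generalizing f with
  | zero => exact h.1
  | succ n ih => exact ⟨h.1, fun j => ih (h.2 j)⟩

theorem SymN.congr {D : Set (E × Plane)} (hD : IsOpen D) {n : ℕ} {f g : E → Plane → ℂ}
    (hf : SymN D n f) (h : ∀ e η, (e, η) ∈ D → g e η = f e η) : SymN D n g := by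
  induction n generalizing f g with
  | zero => exact PolyGrowth.congr hf h
  | succ n ih => exact ⟨PolyGrowth.congr hf.1 h, fun j => ih (hf.2 j) (pd_congr_fam hD h j)⟩

theorem SymN.mono {D D' : Set (E × Plane)} (hDD : D' ⊆ D) {n : ℕ} {f : E → Plane → ℂ}
    (hf : SymN D n f) : SymN D' n f := by
  induction n generalizing f with
  | zero => exact PolyGrowth.mono hf hDD
  | succ n ih => exact ⟨hf.1.mono hDD, fun j => ih (hf.2 j)⟩

theorem SymN.add {D : Set (E × Plane)} (hD : IsOpen D) {n : ℕ} {f g : E → Plane → ℂ}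
    (hfs : SmoothFam D f) (hgs : SmoothFam D g) (hf : SymN D n f) (hg : SymN D n g) :
    SymN D n fun e η => f e η + g e η := by
  induction n generalizing f g with
  | zero => exact PolyGrowth.add hf hg
  | succ n ih =>
    refine ⟨hf.1.add hg.1, fun j => ?_⟩
    exact (ih (hfs.pd hD j) (hgs.pd hD j) (hf.2 j) (hg.2 j)).congr hD fun e η h =>
      pd_add (hfs.differentiableAt hD h) (hgs.differentiableAt hD h) j

theorem SymN.mul {D : Set (E × Plane)} (hD : IsOpen D) {n : ℕ} {f g : E → Plane → ℂ}
    (hfs : SmoothFam D f) (hgs : SmoothFam D g) (hf : SymN D n f) (hg : SymN D n g) :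
    SymN D n fun e η => f e η * g e η := by
  induction n generalizing f g with
  | zero => exact PolyGrowth.mul hf hg
  | succ n ih =>
    refine ⟨hf.1.mul hg.1, fun j => ?_⟩
    refine (SymN.add hD ((hfs.pd hD j).mul hgs) (hfs.mul (hgs.pd hD j))
      (ih (hfs.pd hD j) hgs (hf.2 j) hg.pred) (ih hfs (hgs.pd hD j) hf.pred (hg.2 j))).congr hD
      fun e η h => pd_mul (hfs.differentiableAt hD h) (hgs.differentiableAt hD h) j

theorem Sym.growth {D : Set (E × Plane)} {f : E → Plane → ℂ} (h : Sym D f) : PolyGrowth D f :=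
  h.symN 0

theorem Sym.congr {D : Set (E × Plane)} (hD : IsOpen D) {f g : E → Plane → ℂ}
    (hf : Sym D f) (h : ∀ e η, (e, η) ∈ D → g e η = f e η) : Sym D g :=
  ⟨hf.smooth.congr' h, fun n => (hf.symN n).congr hD h⟩

theorem Sym.mono {D D' : Set (E × Plane)} (hDD : D' ⊆ D) {f : E → Plane → ℂ}
    (hf : Sym D f) : Sym D' f :=
  ⟨ContDiffOn.mono hf.smooth hDD, fun n => (hf.symN n).mono hDD⟩

theorem Sym.pd {D : Set (E × Plane)} (hD : IsOpen D) {f : E → Plane → ℂ} (hf : Sym D f)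
    (j : Fin 2) : Sym D fun e => pd j (f e) :=
  ⟨hf.smooth.pd hD j, fun n => (hf.symN (n + 1)).2 j⟩

theorem Sym.add {D : Set (E × Plane)} (hD : IsOpen D) {f g : E → Plane → ℂ} (hf : Sym D f)
    (hg : Sym D g) : Sym D fun e η => f e η + g e η :=
  ⟨ContDiffOn.add hf.smooth hg.smooth,
    fun n => (hf.symN n).add hD hf.smooth hg.smooth (hg.symN n)⟩

theorem Sym.mul {D : Set (E × Plane)} (hD : IsOpen D) {f g : E → Plane → ℂ} (hf : Sym D f)
    (hg : Sym D g) : Sym D fun e η => f e η * g e η :=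
  ⟨ContDiffOn.mul hf.smooth hg.smooth,
    fun n => (hf.symN n).mul hD hf.smooth hg.smooth (hg.symN n)⟩

theorem Sym.of_growth_of_pd {D : Set (E × Plane)} {f : E → Plane → ℂ} (hs : SmoothFam D f)
    (hg : PolyGrowth D f) (h : ∀ j, Sym D fun e => AharonovBohm.pd j (f e)) : Sym D f :=
  ⟨hs, fun n => by
    cases n with
    | zero => exact hg
    | succ n => exact ⟨hg, fun j => (h j).symN n⟩⟩

theorem SymN.zero (D : Set (E × Plane)) (n : ℕ) : SymN D n fun _ _ => (0 : ℂ) := by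
  induction n with
  | zero => exact PolyGrowth.of_continuous D continuous_const
  | succ n ih =>
    refine ⟨PolyGrowth.of_continuous D continuous_const, fun j => ?_⟩
    have : (fun e : E => AharonovBohm.pd j (fun _ => (0 : ℂ))) = fun _ _ => (0 : ℂ) := by
      funext e η
      exact pd_const j 0 η
    rw [this]
    exact ih

/-- Smooth functions of the parameter alone belong to the class. -/
theorem Sym.of_param (D : Set (E × Plane)) {a : E → ℂ}
    (ha : ContDiff ℝ ((⊤ : ℕ∞) : WithTop ℕ∞) a) : Sym D fun e _ => a e := by
  refine Sym.of_growth_of_pd (ContDiff.contDiffOn (ha.comp contDiff_fst))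
    (PolyGrowth.of_continuous D ha.continuous) fun j => ?_
  have : (fun e : E => AharonovBohm.pd j (fun _ => a e)) = fun _ _ => (0 : ℂ) := by
    funext e η
    exact pd_const j _ η
  rw [this]
  exact ⟨contDiffOn_const, fun n => SymN.zero D n⟩

theorem Sym.const (D : Set (E × Plane)) (c : ℂ) : Sym D fun (_ : E) _ => c :=
  Sym.of_param D contDiff_const

theorem Sym.const_mul {D : Set (E × Plane)} (hD : IsOpen D) {f : E → Plane → ℂ} (hf : Sym D f)
    (c : ℂ) : Sym D fun e η => c * f e η :=
  (Sym.const D c).mul hD hf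

theorem Sym.neg {D : Set (E × Plane)} (hD : IsOpen D) {f : E → Plane → ℂ} (hf : Sym D f) :
    Sym D fun e η => -f e η :=
  (hf.const_mul hD (-1)).congr hD fun _ _ _ => by ring

theorem Sym.sub {D : Set (E × Plane)} (hD : IsOpen D) {f g : E → Plane → ℂ} (hf : Sym D f)
    (hg : Sym D g) : Sym D fun e η => f e η - g e η :=
  (hf.add hD (hg.neg hD)).congr hD fun _ _ _ => by ring

theorem Sym.sum {D : Set (E × Plane)} (hD : IsOpen D) {ι : Type*} (s : Finset ι)
    {f : ι → E → Plane → ℂ} (hf : ∀ i ∈ s, Sym D (f i)) : Sym D fun e η => ∑ i ∈ s, f i e η := by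
  classical
  induction s using Finset.induction_on with
  | empty => simpa using Sym.const D 0
  | insert i s hi ih =>
    refine ((hf i (Finset.mem_insert_self i s)).add hD
      (ih fun k hk => hf k (Finset.mem_insert_of_mem hk))).congr hD fun e η _ => ?_
    rw [Finset.sum_insert hi]

theorem Sym.pow {D : Set (E × Plane)} (hD : IsOpen D) {f : E → Plane → ℂ} (hf : Sym D f)
    (n : ℕ) : Sym D fun e η => f e η ^ n := by
  induction n with
  | zero => simpa using Sym.const D 1
  | succ n ih => exact (ih.mul hD hf).congr hD fun _ _ _ => pow_succ _ _

/-- The reciprocal of a member of the class belongs to the class as soon as it has polynomial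
growth: its derivatives are polynomials in itself and in the derivatives of the given function. -/
theorem Sym.inv {D : Set (E × Plane)} (hD : IsOpen D) {f : E → Plane → ℂ} (hf : Sym D f)
    (h0 : ∀ e η, (e, η) ∈ D → f e η ≠ 0) (hg : PolyGrowth D fun e η => (f e η)⁻¹) :
    Sym D fun e η => (f e η)⁻¹ := by
  have hs : SmoothFam D fun e η => (f e η)⁻¹ := ContDiffOn.inv hf.smooth fun p hp => h0 p.1 p.2 hp
  refine ⟨hs, fun n => ?_⟩
  induction n with
  | zero => exact hg
  | succ n ih =>
    refine ⟨hg, fun j => ?_⟩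
    have hm : SmoothFam D fun e η => (-1 : ℂ) * AharonovBohm.pd j (f e) η :=
      contDiffOn_const.mul (hf.smooth.pd hD j)
    refine (((((hf.pd hD j).const_mul hD (-1)).symN n).mul hD hm (hs.mul hs)
      (ih.mul hD hs hs ih))).congr hD fun e η h => ?_
    have hne := h0 e η h
    have hd := hf.smooth.differentiableAt hD h
    have hdi := hs.differentiableAt hD h
    have h1 : AharonovBohm.pd j (fun ζ => f e ζ * (f e ζ)⁻¹) η = 0 := by
      rw [← pd_const j 1 η]
      refine pd_congr_on (isOpen_sliceAt hD e) (fun ζ hζ => ?_) j h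
      exact mul_inv_cancel₀ (h0 e ζ hζ)
    rw [pd_mul hd hdi] at h1
    field_simp at h1 ⊢
    linear_combination h1

/-- Square roots: a smooth function whose square is in the class, and whose reciprocal has
polynomial growth, belongs to the class together with its reciprocal. -/
theorem Sym.sqrt {D : Set (E × Plane)} (hD : IsOpen D) {f r : E → Plane → ℂ} (hf : Sym D f)
    (hr : SmoothFam D r) (hsq : ∀ e η, (e, η) ∈ D → r e η ^ 2 = f e η)
    (h0 : ∀ e η, (e, η) ∈ D → f e η ≠ 0) (hg : PolyGrowth D fun e η => (f e η)⁻¹) :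
    Sym D r ∧ Sym D fun e η => (r e η)⁻¹ := by
  have hfi := hf.inv hD h0 hg
  have hrg : PolyGrowth D r := by
    intro Q hQ
    obtain ⟨C, M, hC, hb⟩ := hf.growth Q hQ
    refine ⟨1 + C, M, by positivity, fun e he η hη => ?_⟩
    have h1 : (1 : ℝ) ≤ (1 + ‖η‖) ^ M := one_le_pow₀ (by linarith [norm_nonneg η])
    have h2 := hb e he η hη
    rw [← hsq e η hη, norm_pow] at h2
    nlinarith [sq_nonneg (‖r e η‖ - 1), norm_nonneg (r e η)]
  have hr0 : ∀ e η, (e, η) ∈ D → r e η ≠ 0 := fun e η h h' => by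
    apply h0 e η h
    rw [← hsq e η h, h']
    simp
  have hS : Sym D r := by
    refine ⟨hr, fun n => ?_⟩
    induction n with
    | zero => exact hrg
    | succ n ih =>
      refine ⟨hrg, fun j => ?_⟩
      -- The relation `∂r = (1/2) (∂f) f⁻¹ r` bounds each derivative by those of lower order.
      have hA := ((hf.pd hD j).mul hD hfi).const_mul hD (1 / 2)
      refine ((hA.symN n).mul hD hA.smooth hr ih).congr hD fun e η h => ?_
      have h1 : AharonovBohm.pd j (fun ζ => r e ζ * r e ζ) η = AharonovBohm.pd j (f e) η := by
        refine pd_congr_on (isOpen_sliceAt hD e) (fun ζ hζ => ?_) j h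
        rw [← pow_two]
        exact hsq e ζ hζ
      have hd := hr.differentiableAt hD h
      rw [pd_mul hd hd] at h1
      have hne := hr0 e η h
      rw [← hsq e η h, ← h1]
      field_simp
      ring
  refine ⟨hS, (hS.mul hD hfi).congr hD fun e η h => ?_⟩
  rw [← hsq e η h]
  have := hr0 e η h
  field_simp

/-- Gluing: a family in the class on `D₁` which vanishes on the open set `D₂` is in the class on
every open subset of `D₁ ∪ D₂`. -/
theorem Sym.glue {D D₁ D₂ : Set (E × Plane)} (h₂ : IsOpen D₂)
    (hD₁ : IsOpen D₁) (hsub : D ⊆ D₁ ∪ D₂) {f : E → Plane → ℂ} (hf : Sym D₁ f)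
    (hz : ∀ e η, (e, η) ∈ D₂ → f e η = 0) : Sym D f := by
  have hz' : Sym D₂ f := (Sym.const D₂ 0).congr h₂ hz
  refine ⟨fun p hp => ?_, fun n => ?_⟩
  · rcases hsub hp with h | h
    · exact (hf.smooth.contDiffAt (hD₁.mem_nhds h)).contDiffWithinAt
    · exact (hz'.smooth.contDiffAt (h₂.mem_nhds h)).contDiffWithinAt
  · have hu : ∀ g : E → Plane → ℂ, PolyGrowth D₁ g → PolyGrowth D₂ g → PolyGrowth D g := by
      intro g h1 h2 Q hQ
      obtain ⟨C, M, hC, hb⟩ := h1 Q hQ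
      obtain ⟨C', M', hC', hb'⟩ := h2 Q hQ
      refine ⟨C + C', max M M', by positivity, fun e he η hη => ?_⟩
      have h1 : (1 : ℝ) ≤ 1 + ‖η‖ := by linarith [norm_nonneg η]
      rcases hsub hη with h | h
      · refine (hb e he η h).trans ?_
        gcongr
        · linarith
        · exact le_max_left _ _
      · refine (hb' e he η h).trans ?_
        gcongr
        · linarith
        · exact le_max_right _ _
    have hn : ∀ (n : ℕ) (g : E → Plane → ℂ), SymN D₁ n g → SymN D₂ n g → SymN D n g := by
      intro n
      induction n with
      | zero => exact hu
      | succ n ih => exact fun g h1 h2 => ⟨hu g h1.1 h2.1, fun j => ih _ (h1.2 j) (h2.2 j)⟩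
    exact hn n f (hf.symN n) (hz'.symN n)

/-- A family vanishing on an open set has vanishing derivatives there. -/
theorem pd_eq_zero_of_eqOn_zero {D : Set (E × Plane)} (hD : IsOpen D) {f : E → Plane → ℂ}
    (h : ∀ e η, (e, η) ∈ D → f e η = 0) (j : Fin 2) :
    ∀ e η, (e, η) ∈ D → pd j (f e) η = 0 := fun e η hη => by
  rw [pd_congr_fam hD (f := fun _ _ => 0) h j e η hη, pd_const]

end Param

/-! ### Smooth dependence of integrals on parameters -/

section ParamIntegral

variable {X G : Type} [NormedAddCommGroup X] [NormedSpace ℝ X] [ProperSpace X]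
  [NormedAddCommGroup G] [NormedSpace ℝ G] [CompleteSpace G]

/-- The parameters `x` over which the whole interval `[0, 1]` lies in `U`. -/
def tube (U : Set (X × ℝ)) : Set X := {x | ∀ τ ∈ Icc (0 : ℝ) 1, (x, τ) ∈ U}

theorem exists_closedBall_subset_tube {U : Set (X × ℝ)} (hU : IsOpen U) {x : X} (hx : x ∈ tube U) :
    ∃ r > 0, Metric.closedBall x r ×ˢ Icc (0 : ℝ) 1 ⊆ U := by
  obtain ⟨u, v, hu, -, hxu, hv, huv⟩ := generalized_tube_lemma (s := {x}) isCompact_singleton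
    (isCompact_Icc (a := (0 : ℝ)) (b := 1)) hU (by
      rintro ⟨a, τ⟩ ⟨ha, hτ⟩
      obtain rfl : a = x := ha
      exact hx τ hτ)
  obtain ⟨r, hr, hb⟩ := Metric.nhds_basis_closedBall.mem_iff.1 (hu.mem_nhds (hxu rfl))
  exact ⟨r, hr, fun p hp => huv ⟨hb hp.1, hv hp.2⟩⟩

theorem isOpen_tube {U : Set (X × ℝ)} (hU : IsOpen U) : IsOpen (tube U) := by
  rw [Metric.isOpen_iff]
  intro x hx
  obtain ⟨r, hr, hb⟩ := exists_closedBall_subset_tube hU hx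
  exact ⟨r, hr, fun z hz τ hτ => hb ⟨Metric.ball_subset_closedBall hz, hτ⟩⟩

theorem continuousOn_slice_tube {U : Set (X × ℝ)} {g : X × ℝ → G} (hg : ContinuousOn g U)
    {x : X} (hx : x ∈ tube U) : ContinuousOn (fun τ => g (x, τ)) (uIcc 0 1) := by
  rw [uIcc_of_le zero_le_one]
  exact hg.comp (by fun_prop) fun τ hτ => hx τ hτ

/-- Differentiation under the integral sign. -/
theorem hasFDerivAt_integral_tube {U : Set (X × ℝ)} (hU : IsOpen U) {g : X × ℝ → G}
    (hg : ContDiffOn ℝ 1 g U) {x : X} (hx : x ∈ tube U) :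
    HasFDerivAt (fun x => ∫ τ in (0 : ℝ)..1, g (x, τ))
      (∫ τ in (0 : ℝ)..1, (fderiv ℝ g (x, τ)).comp (ContinuousLinearMap.inl ℝ X ℝ)) x := by
  obtain ⟨r, hr, hb⟩ := exists_closedBall_subset_tube hU hx
  have hc : ContinuousOn (fun p => (fderiv ℝ g p).comp (ContinuousLinearMap.inl ℝ X ℝ)) U :=
    (hg.continuousOn_fderiv_of_isOpen hU le_rfl).clm_comp continuousOn_const
  obtain ⟨C, hC⟩ := ((isCompact_closedBall x r).prod (isCompact_Icc (a := (0 : ℝ)) (b := 1))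
    ).exists_bound_of_continuousOn (hc.mono hb)
  have htube : Metric.ball x r ⊆ tube U := fun z hz τ hτ =>
    hb ⟨Metric.ball_subset_closedBall hz, hτ⟩
  refine (intervalIntegral.hasFDerivAt_integral_of_dominated_of_fderiv_le (μ := volume)
    (F := fun x τ => g (x, τ))
    (F' := fun x τ => (fderiv ℝ g (x, τ)).comp (ContinuousLinearMap.inl ℝ X ℝ))
    (bound := fun _ => C) (s := Metric.ball x r) (a := 0) (b := 1) (x₀ := x)
    (Metric.ball_mem_nhds x hr) ?_ ?_ ?_ ?_ ?_ ?_)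
  · filter_upwards [Metric.ball_mem_nhds x hr] with z hz
    exact (continuousOn_slice_tube hg.continuousOn (htube hz)).mono uIoc_subset_uIcc
      |>.aestronglyMeasurable measurableSet_uIoc
  · exact (continuousOn_slice_tube hg.continuousOn hx).intervalIntegrable
  · exact (continuousOn_slice_tube hc hx).mono uIoc_subset_uIcc
      |>.aestronglyMeasurable measurableSet_uIoc
  · refine Eventually.of_forall fun τ hτ z hz => hC (z, τ) ⟨Metric.ball_subset_closedBall hz, ?_⟩
    rw [uIoc_of_le zero_le_one] at hτ
    exact Ioc_subset_Icc_self hτ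
  · exact intervalIntegrable_const
  · refine Eventually.of_forall fun τ hτ z hz => ?_
    rw [uIoc_of_le zero_le_one] at hτ
    have hm : (z, τ) ∈ U := htube hz τ (Ioc_subset_Icc_self hτ)
    have hd : HasFDerivAt g (fderiv ℝ g (z, τ)) (z, τ) :=
      ((hg.contDiffAt (hU.mem_nhds hm)).differentiableAt (by simp)).hasFDerivAt
    exact HasFDerivAt.comp z hd (hasFDerivAt_prodMk_left z τ)

end ParamIntegral

/-- The derivative of the integral is again the integral of a smooth function, but with values in a
space of linear maps: the induction runs over all target spaces at once. -/
theorem contDiffOn_integral_tube_nat {X : Type} [NormedAddCommGroup X] [NormedSpace ℝ X]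
    [ProperSpace X] {U : Set (X × ℝ)} (hU : IsOpen U) (n : ℕ) :
    ∀ {G : Type} [NormedAddCommGroup G] [NormedSpace ℝ G] [CompleteSpace G] {g : X × ℝ → G},
      ContDiffOn ℝ ((⊤ : ℕ∞) : WithTop ℕ∞) g U →
      ContDiffOn ℝ n (fun x => ∫ τ in (0 : ℝ)..1, g (x, τ)) (tube U) := by
  induction n with
  | zero =>
    intro G _ _ _ g hg
    refine contDiffOn_zero.2 fun x hx => ?_
    exact (hasFDerivAt_integral_tube hU (hg.of_le
      (WithTop.coe_le_coe.2 (le_top : (1 : ℕ∞) ≤ ⊤))) hx).continuousAt.continuousWithinAt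
  | succ n ih =>
    intro G _ _ _ g hg
    have hg1 : ContDiffOn ℝ 1 g U := hg.of_le (WithTop.coe_le_coe.2 (le_top : (1 : ℕ∞) ≤ ⊤))
    have h1 : ((n + 1 : ℕ) : WithTop ℕ∞) = (n : WithTop ℕ∞) + 1 := by simp
    rw [h1, contDiffOn_succ_iff_fderiv_of_isOpen (isOpen_tube hU)]
    refine ⟨fun x hx => (hasFDerivAt_integral_tube hU hg1 hx).differentiableAt
      |>.differentiableWithinAt, by simp, ?_⟩
    refine ContDiffOn.congr (ih (g := fun p => (fderiv ℝ g p).comp (ContinuousLinearMap.inl ℝ X ℝ))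
      ?_) fun x hx => (hasFDerivAt_integral_tube hU hg1 hx).fderiv
    exact (hg.fderiv_of_isOpen hU (by simp)).clm_comp contDiffOn_const

/-- The integral over `[0, 1]` of a smooth function depends smoothly on parameters. -/
theorem contDiffOn_integral_tube {X G : Type} [NormedAddCommGroup X] [NormedSpace ℝ X]
    [ProperSpace X] [NormedAddCommGroup G] [NormedSpace ℝ G] [CompleteSpace G]
    {U : Set (X × ℝ)} (hU : IsOpen U) {g : X × ℝ → G}
    (hg : ContDiffOn ℝ ((⊤ : ℕ∞) : WithTop ℕ∞) g U) :
    ContDiffOn ℝ ((⊤ : ℕ∞) : WithTop ℕ∞) (fun x => ∫ τ in (0 : ℝ)..1, g (x, τ)) (tube U) :=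
  contDiffOn_infty.2 fun n => contDiffOn_integral_tube_nat hU n hg

/-! ### Integration in time of families of symbols -/

/-- A set of points `(t, y, η)` is star-shaped in time if it contains the points `(τ t, y, η)`,
`0 ≤ τ ≤ 1`, with each of its points. -/
def StarTime (D : Set ((ℝ × Plane) × Plane)) : Prop :=
  ∀ p ∈ D, ∀ τ ∈ Icc (0 : ℝ) 1, ((τ * p.1.1, p.1.2), p.2) ∈ D

/-- The primitive in time `∫₀ᵗ f(s, y, η) ds`. -/
noncomputable def timeInt (f : ℝ × Plane → Plane → ℂ) (e : ℝ × Plane) (η : Plane) : ℂ :=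
  ∫ s in (0 : ℝ)..e.1, f (s, e.2) η

theorem timeInt_eq (f : ℝ × Plane → Plane → ℂ) (e : ℝ × Plane) (η : Plane) :
    timeInt f e η = ∫ τ in (0 : ℝ)..1, (e.1 : ℂ) * f (τ * e.1, e.2) η := by
  rw [timeInt, intervalIntegral.integral_const_mul]
  have h := intervalIntegral.smul_integral_comp_mul_right (a := 0) (b := 1)
    (fun s => f (s, e.2) η) e.1
  rw [zero_mul, one_mul] at h
  rw [← h, Complex.real_smul]

theorem StarTime.smooth_timeInt {D : Set ((ℝ × Plane) × Plane)} (hD : IsOpen D) (hs : StarTime D)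
    {f : ℝ × Plane → Plane → ℂ} (hf : SmoothFam D f) : SmoothFam D (timeInt f) := by
  let U : Set (((ℝ × Plane) × Plane) × ℝ) := {q | ((q.2 * q.1.1.1, q.1.1.2), q.1.2) ∈ D}
  have hU : IsOpen U := hD.preimage (by fun_prop)
  have hg : ContDiffOn ℝ ((⊤ : ℕ∞) : WithTop ℕ∞) (fun q : ((ℝ × Plane) × Plane) × ℝ =>
      (q.1.1.1 : ℂ) * f (q.2 * q.1.1.1, q.1.1.2) q.1.2) U := by
    refine ContDiffOn.mul ?_ ?_
    · exact (Complex.ofRealCLM.contDiff.comp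
        ((contDiff_fst.comp contDiff_fst).comp contDiff_fst)).contDiffOn
    · exact ContDiffOn.comp (g := fun p : (ℝ × Plane) × Plane => f p.1 p.2)
        (f := fun q : ((ℝ × Plane) × Plane) × ℝ => ((q.2 * q.1.1.1, q.1.1.2), q.1.2)) hf
        (by fun_prop) fun q hq => hq
  have h := contDiffOn_integral_tube hU hg
  refine (h.mono fun p hp τ hτ => hs p hp τ hτ).congr fun p _ => timeInt_eq f p.1 p.2

theorem StarTime.pd_timeInt {D : Set ((ℝ × Plane) × Plane)} (hD : IsOpen D) (hs : StarTime D)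
    {f : ℝ × Plane → Plane → ℂ} (hf : SmoothFam D f) (j : Fin 2) {e : ℝ × Plane} {η : Plane}
    (h : (e, η) ∈ D) :
    pd j (timeInt f e) η = timeInt (fun e => pd j (f e)) e η := by
  let U : Set (Plane × ℝ) := {q | ((q.2 * e.1, e.2), q.1) ∈ D}
  have hU : IsOpen U := hD.preimage (by fun_prop)
  have hg : ContDiffOn ℝ ((⊤ : ℕ∞) : WithTop ℕ∞) (fun q : Plane × ℝ =>
      (e.1 : ℂ) * f (q.2 * e.1, e.2) q.1) U :=
    contDiffOn_const.mul (ContDiffOn.comp (g := fun p : (ℝ × Plane) × Plane => f p.1 p.2)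
      (f := fun q : Plane × ℝ => ((q.2 * e.1, e.2), q.1)) hf (by fun_prop) fun q hq => hq)
  have hg1 := hg.of_le (WithTop.coe_le_coe.2 (le_top : (1 : ℕ∞) ≤ ⊤))
  have hη : η ∈ tube U := fun τ hτ => hs _ h τ hτ
  have hfun : timeInt f e = fun ζ => ∫ τ in (0 : ℝ)..1, (e.1 : ℂ) * f (τ * e.1, e.2) ζ :=
    funext fun ζ => timeInt_eq f e ζ
  have hint : IntervalIntegrable (fun τ => (fderiv ℝ (fun q : Plane × ℝ =>
      (e.1 : ℂ) * f (q.2 * e.1, e.2) q.1) (η, τ)).comp (ContinuousLinearMap.inl ℝ Plane ℝ))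
      volume 0 1 :=
    (continuousOn_slice_tube (g := fun p => (fderiv ℝ (fun q : Plane × ℝ =>
      (e.1 : ℂ) * f (q.2 * e.1, e.2) q.1) p).comp (ContinuousLinearMap.inl ℝ Plane ℝ))
      ((hg1.continuousOn_fderiv_of_isOpen hU le_rfl).clm_comp continuousOn_const)
      hη).intervalIntegrable
  rw [timeInt_eq, hfun, pd, (hasFDerivAt_integral_tube hU hg1 hη).fderiv,
    ContinuousLinearMap.intervalIntegral_apply hint]
  refine intervalIntegral.integral_congr fun τ hτ => ?_
  rw [uIcc_of_le zero_le_one] at hτ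
  have hm : (η, τ) ∈ U := hη τ hτ
  have hd : HasFDerivAt (fun q : Plane × ℝ => (e.1 : ℂ) * f (q.2 * e.1, e.2) q.1) _ (η, τ) :=
    ((hg1.contDiffAt (hU.mem_nhds hm)).differentiableAt (by simp)).hasFDerivAt
  have h2 := HasFDerivAt.comp (𝕜 := ℝ) η hd (hasFDerivAt_prodMk_left η τ)
  have h3 : pd j (fun ζ => (e.1 : ℂ) * f (τ * e.1, e.2) ζ) η = _ :=
    congrArg (fun L : Plane →L[ℝ] ℂ => L (stdVec j)) h2.fderiv
  rw [pd_const_mul (hf.differentiableAt hD hm)] at h3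
  exact h3.symm

theorem StarTime.polyGrowth_timeInt {D : Set ((ℝ × Plane) × Plane)} (hs : StarTime D)
    {f : ℝ × Plane → Plane → ℂ} (hf : PolyGrowth D f) : PolyGrowth D (timeInt f) := by
  intro Q hQ
  have hQ' : IsCompact ((fun q : (ℝ × Plane) × ℝ => (q.2 * q.1.1, q.1.2)) ''
      (Q ×ˢ Icc (0 : ℝ) 1)) := (hQ.prod isCompact_Icc).image (by fun_prop)
  obtain ⟨C, M, hC, hb⟩ := hf _ hQ'
  obtain ⟨T, hT⟩ := hQ.exists_bound_of_continuousOn (f := fun e : ℝ × Plane => e.1)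
    (by fun_prop)
  refine ⟨|T| * C, M, by positivity, fun e he η hη => ?_⟩
  rw [timeInt_eq]
  have hbound : ∀ τ ∈ uIoc (0 : ℝ) 1, ‖(e.1 : ℂ) * f (τ * e.1, e.2) η‖ ≤
      |T| * C * (1 + ‖η‖) ^ M := by
    intro τ hτ
    rw [uIoc_of_le zero_le_one] at hτ
    have hτ' := Ioc_subset_Icc_self hτ
    rw [norm_mul, mul_assoc]
    refine mul_le_mul ?_ (hb _ ⟨(e, τ), ⟨he, hτ'⟩, rfl⟩ η (hs _ hη τ hτ')) (norm_nonneg _)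
      (abs_nonneg _)
    rw [Complex.norm_real]
    exact (hT e he).trans (le_abs_self T)
  simpa using intervalIntegral.norm_integral_le_of_norm_le_const hbound

theorem StarTime.sym_timeInt {D : Set ((ℝ × Plane) × Plane)} (hD : IsOpen D) (hs : StarTime D)
    {f : ℝ × Plane → Plane → ℂ} (hf : Sym D f) : Sym D (timeInt f) := by
  refine ⟨hs.smooth_timeInt hD hf.smooth, fun n => ?_⟩
  have key : ∀ (n : ℕ) (f : ℝ × Plane → Plane → ℂ), SmoothFam D f → SymN D n f →
      SymN D n (timeInt f) := by
    intro n
    induction n with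
    | zero => exact fun f _ h => hs.polyGrowth_timeInt h
    | succ n ih =>
      intro f hsm h
      exact ⟨hs.polyGrowth_timeInt h.1, fun j => (ih _ (hsm.pd hD j) (h.2 j)).congr hD
        fun e η hη => hs.pd_timeInt hD hsm j hη⟩
  exact key n f hf.smooth (hf.symN n)

/-! ### The vector potential and the classical flow -/

theorem plane_norm_sq (x : Plane) : ‖x‖ ^ 2 = x 0 ^ 2 + x 1 ^ 2 := by
  simp [EuclideanSpace.real_norm_sq_eq, Fin.sum_univ_two]

theorem plane_sq_add_sq_ne_zero {x : Plane} (hx : x ≠ 0) : x 0 ^ 2 + x 1 ^ 2 ≠ 0 := by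
  rw [← plane_norm_sq]
  exact pow_ne_zero _ (norm_ne_zero_iff.2 hx)

theorem vecPot_zero_apply (b : ℝ) (x : Plane) :
    vecPot b x 0 = -b * (x 1 * (x 0 ^ 2 + x 1 ^ 2)⁻¹) := by
  simp [vecPot, plane_norm_sq, div_eq_mul_inv]

theorem vecPot_one_apply (b : ℝ) (x : Plane) :
    vecPot b x 1 = b * (x 0 * (x 0 ^ 2 + x 1 ^ 2)⁻¹) := by
  simp [vecPot, plane_norm_sq, div_eq_mul_inv]

/-- The `j`-th coordinate as a continuous linear form. -/
noncomputable abbrev coordL (j : Fin 2) : Plane →L[ℝ] ℝ := EuclideanSpace.proj j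

/-- The Jacobian matrix of the vector potential; it is symmetric and traceless. -/
noncomputable def jacA (b : ℝ) (x : Plane) : Matrix (Fin 2) (Fin 2) ℝ :=
  !![2 * b * x 0 * x 1 / (x 0 ^ 2 + x 1 ^ 2) ^ 2, b * (x 1 ^ 2 - x 0 ^ 2) / (x 0 ^ 2 + x 1 ^ 2) ^ 2;
    b * (x 1 ^ 2 - x 0 ^ 2) / (x 0 ^ 2 + x 1 ^ 2) ^ 2, -(2 * b * x 0 * x 1 / (x 0 ^ 2 + x 1 ^ 2) ^ 2)]

theorem jacA_one_one (b : ℝ) (x : Plane) : jacA b x 1 1 = -jacA b x 0 0 := rfl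

theorem jacA_one_zero (b : ℝ) (x : Plane) : jacA b x 1 0 = jacA b x 0 1 := rfl

/-- The eigenvalues of the Jacobian matrix of the vector potential are `± b / |x|²`. -/
theorem jacA_sq (b : ℝ) {x : Plane} (hx : x ≠ 0) :
    jacA b x 0 0 ^ 2 + jacA b x 0 1 ^ 2 = (b / ‖x‖ ^ 2) ^ 2 := by
  have h := plane_sq_add_sq_ne_zero hx
  rw [plane_norm_sq]
  simp only [jacA, Matrix.of_apply, Matrix.cons_val', Matrix.cons_val_zero, Matrix.cons_val_one,
    Matrix.cons_val_fin_one]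
  field_simp
  ring

theorem hasFDerivAt_vecPot_apply (b : ℝ) {x : Plane} (hx : x ≠ 0) (j : Fin 2) :
    HasFDerivAt (fun x => vecPot b x j) (∑ k, jacA b x j k • coordL k) x := by
  have hn := plane_sq_add_sq_ne_zero hx
  have hc : ∀ i : Fin 2, HasFDerivAt (fun x : Plane => x i) (coordL i) x :=
    fun i => (coordL i).hasFDerivAt
  have hN : HasFDerivAt (fun x : Plane => x 0 ^ 2 + x 1 ^ 2) _ x :=
    ((hc 0).pow 2).add ((hc 1).pow 2)
  have hi := (hasDerivAt_inv hn).comp_hasFDerivAt x hN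
  fin_cases j
  · have hf : (fun x => vecPot b x 0) = _ := funext fun x => vecPot_zero_apply b x
    change HasFDerivAt (fun x => vecPot b x 0) _ x
    rw [hf]
    refine (((hc 1).mul hi).const_mul (-b)).congr_fderiv ?_
    ext v
    simp [jacA, Fin.sum_univ_two]
    field_simp
    ring
  · have hf : (fun x => vecPot b x 1) = _ := funext fun x => vecPot_one_apply b x
    change HasFDerivAt (fun x => vecPot b x 1) _ x
    rw [hf]
    refine (((hc 0).mul hi).const_mul b).congr_fderiv ?_
    ext v
    simp [jacA, Fin.sum_univ_two]
    field_simp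
    ring

theorem contDiffAt_vecPot (b : ℝ) {n : WithTop ℕ∞} {x : Plane} (hx : x ≠ 0) :
    ContDiffAt ℝ n (vecPot b) x := by
  have hn : ‖x‖ ^ 2 ≠ 0 := pow_ne_zero _ (norm_ne_zero_iff.2 hx)
  have hN : ContDiffAt ℝ n (fun x : Plane => ‖x‖ ^ 2) x := (contDiff_norm_sq ℝ).contDiffAt
  have hc : ∀ i : Fin 2, ContDiffAt ℝ n (fun x : Plane => x i) x :=
    fun i => (coordL i).contDiff.contDiffAt
  rw [contDiffAt_euclidean]
  intro i
  fin_cases i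
  · exact contDiffAt_const.mul ((hc 1).div hN hn)
  · exact contDiffAt_const.mul ((hc 0).div hN hn)

theorem position_apply (ω b t : ℝ) (y η : Plane) (j : Fin 2) :
    position ω b t y η j = Real.cos (ω * t) * y j + Real.sin (ω * t) / ω * (η j - vecPot b y j) := by
  simp [position]

theorem hasFDerivAt_position (ω b t : ℝ) (y η : Plane) :
    HasFDerivAt (position ω b t y)
      ((Real.sin (ω * t) / ω) • ContinuousLinearMap.id ℝ Plane) η :=
  ((((hasFDerivAt_id η).sub_const (vecPot b y)).const_smul (Real.sin (ω * t) / ω)).const_add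
    (Real.cos (ω * t) • y))

theorem hasFDerivAt_position_apply (ω b t : ℝ) (y η : Plane) (j : Fin 2) :
    HasFDerivAt (fun η => position ω b t y η j) ((Real.sin (ω * t) / ω) • coordL j) η := by
  have := (coordL j).hasFDerivAt.comp η (hasFDerivAt_position ω b t y η)
  refine this.congr_fderiv ?_
  ext v
  simp

/-- The velocity `v^t = ξ^t - A(x^t)` of the trajectory. -/
noncomputable def velocity (ω b t : ℝ) (y η : Plane) : Plane :=
  -(ω * Real.sin (ω * t)) • y + Real.cos (ω * t) • (η - vecPot b y)

theorem velocity_apply (ω b t : ℝ) (y η : Plane) (j : Fin 2) :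
    velocity ω b t y η j =
      -(ω * Real.sin (ω * t)) * y j + Real.cos (ω * t) * (η j - vecPot b y j) := by
  simp [velocity]

theorem momentum_eq (ω b t : ℝ) (y η : Plane) :
    momentum ω b t y η = velocity ω b t y η + vecPot b (position ω b t y η) := rfl

theorem momentum_apply (ω b t : ℝ) (y η : Plane) (j : Fin 2) :
    momentum ω b t y η j = velocity ω b t y η j + vecPot b (position ω b t y η) j := rfl

theorem hasFDerivAt_velocity_apply (ω b t : ℝ) (y η : Plane) (j : Fin 2) :
    HasFDerivAt (fun η => velocity ω b t y η j) (Real.cos (ω * t) • coordL j) η := by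
  have h : (fun η => velocity ω b t y η j) = fun η : Plane =>
      -(ω * Real.sin (ω * t)) * y j + Real.cos (ω * t) * (η j - vecPot b y j) :=
    funext fun η => velocity_apply ω b t y η j
  rw [h]
  exact ((((coordL j).hasFDerivAt (x := η)).sub_const (vecPot b y j)).const_mul
    (Real.cos (ω * t))).const_add _

theorem hasFDerivAt_vecPot_position (ω b t : ℝ) (y η : Plane) (h : position ω b t y η ≠ 0)
    (j : Fin 2) :
    HasFDerivAt (fun η => vecPot b (position ω b t y η) j)
      ((Real.sin (ω * t) / ω) • ∑ k, jacA b (position ω b t y η) j k • coordL k) η := by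
  have := (hasFDerivAt_vecPot_apply b h j).comp η (hasFDerivAt_position ω b t y η)
  refine this.congr_fderiv ?_
  ext v
  simp [Fin.sum_univ_two]

theorem hasFDerivAt_momentum_apply (ω b t : ℝ) (y η : Plane) (h : position ω b t y η ≠ 0)
    (j : Fin 2) :
    HasFDerivAt (fun η => momentum ω b t y η j) (Real.cos (ω * t) • coordL j +
      (Real.sin (ω * t) / ω) • ∑ k, jacA b (position ω b t y η) j k • coordL k) η :=
  (hasFDerivAt_velocity_apply ω b t y η j).add (hasFDerivAt_vecPot_position ω b t y η h j)

theorem pd_ofReal_of_hasFDerivAt {f : Plane → ℝ} {f' : Plane →L[ℝ] ℝ} {η : Plane}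
    (h : HasFDerivAt f f' η) (j : Fin 2) :
    pd j (fun ζ => ((f ζ : ℝ) : ℂ)) η = ((f' (stdVec j) : ℝ) : ℂ) := by
  have := Complex.ofRealCLM.hasFDerivAt.comp η h
  have h2 : HasFDerivAt (fun ζ => ((f ζ : ℝ) : ℂ)) _ η := this
  rw [pd, h2.fderiv]
  rfl

theorem pd_position (ω b t : ℝ) (y η : Plane) (j k : Fin 2) :
    pd k (fun ζ => ((position ω b t y ζ j : ℝ) : ℂ)) η =
      if j = k then ((Real.sin (ω * t) / ω : ℝ) : ℂ) else 0 := by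
  rw [pd_ofReal_of_hasFDerivAt (hasFDerivAt_position_apply ω b t y η j)]
  by_cases h : j = k <;> simp [h]

/-- The scalar part `cos(ω t) - i B sin(ω t) / ω` of the matrix `Z`. -/
noncomputable def scalZ (ω B t : ℝ) : ℂ :=
  (Real.cos (ω * t) : ℂ) - Complex.I * B * ((Real.sin (ω * t) / ω : ℝ) : ℂ)

theorem matZ_apply (ω b B t : ℝ) (y η : Plane) (h : position ω b t y η ≠ 0) (j k : Fin 2) :
    matZ ω b B t y η j k = (if j = k then scalZ ω B t else 0) +
      ((Real.sin (ω * t) / ω : ℝ) : ℂ) * ((jacA b (position ω b t y η) j k : ℝ) : ℂ) := by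
  rw [matZ, Matrix.of_apply, pd_position,
    pd_ofReal_of_hasFDerivAt (hasFDerivAt_momentum_apply ω b t y η h j)]
  fin_cases j <;> fin_cases k <;> simp [scalZ, Fin.sum_univ_two] <;> ring

/-- The eigenvalues `cos(ω t) - i B sin(ω t) / ω ± (sin(ω t) / ω) b / |x|²` of `Z`, the sign being
encoded by `s = ± 1`. -/
noncomputable def eigZ (ω b B s t : ℝ) (x : Plane) : ℂ :=
  scalZ ω B t + ((Real.sin (ω * t) / ω * (s * (b / ‖x‖ ^ 2)) : ℝ) : ℂ)

theorem det_matZ (ω b B t : ℝ) (y η : Plane) (h : position ω b t y η ≠ 0) :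
    (matZ ω b B t y η).det =
      eigZ ω b B 1 t (position ω b t y η) * eigZ ω b B (-1) t (position ω b t y η) := by
  rw [Matrix.det_fin_two, matZ_apply _ _ _ _ _ _ h, matZ_apply _ _ _ _ _ _ h,
    matZ_apply _ _ _ _ _ _ h, matZ_apply _ _ _ _ _ _ h, jacA_one_one, jacA_one_zero]
  have h2 := congrArg (fun r : ℝ => (r : ℂ)) (jacA_sq b h)
  simp only [eigZ]
  push_cast at h2 ⊢
  simp
  linear_combination (-(Complex.sin (ω * t) / ω) ^ 2) * h2

theorem eigZ_re (ω b B s t : ℝ) (x : Plane) :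
    (eigZ ω b B s t x).re = Real.cos (ω * t) + Real.sin (ω * t) / ω * (s * (b / ‖x‖ ^ 2)) := by
  simp only [eigZ, scalZ, Complex.add_re, Complex.sub_re, Complex.ofReal_re, Complex.mul_re,
    Complex.mul_im, Complex.I_re, Complex.I_im, Complex.ofReal_im]
  ring

theorem eigZ_im (ω b B s t : ℝ) (x : Plane) :
    (eigZ ω b B s t x).im = -(B * (Real.sin (ω * t) / ω)) := by
  simp only [eigZ, scalZ, Complex.add_im, Complex.sub_im, Complex.ofReal_re, Complex.mul_re,
    Complex.mul_im, Complex.I_re, Complex.I_im, Complex.ofReal_im]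
  ring

/-- The rotated eigenvalue `e^{iωt} λ` stays off the negative half-line: if its imaginary part
`sin(ω t) (Re λ - (B / ω) cos(ω t))` vanishes, it equals `1` or `B / ω`. -/
theorem rotated_eigZ_mem_slitPlane {ω B : ℝ} (hω : 0 < ω) (hB : 0 < B) (b s t : ℝ) (x : Plane) :
    Complex.exp (((ω * t : ℝ) : ℂ) * Complex.I) * eigZ ω b B s t x ∈ Complex.slitPlane := by
  rw [Complex.mem_slitPlane_iff, or_iff_not_imp_right, not_not]
  intro him
  have hre := eigZ_re ω b B s t x
  rw [Complex.mul_im, Complex.exp_ofReal_mul_I_re, Complex.exp_ofReal_mul_I_im, eigZ_im] at him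
  rw [Complex.mul_re, Complex.exp_ofReal_mul_I_re, Complex.exp_ofReal_mul_I_im, eigZ_im]
  have hcs := Real.sin_sq_add_cos_sq (ω * t)
  generalize (eigZ ω b B s t x).re = r at *
  generalize Real.sin (ω * t) = S at *
  generalize Real.cos (ω * t) = c at *
  have h1 : S * (r - B / ω * c) = 0 := by
    rw [← him]
    ring
  rcases mul_eq_zero.1 h1 with h | h
  · subst h
    simp at hre hcs
    rw [hre]
    rcases hcs with h | h <;> simp [h]
  · have hr : r = B / ω * c := by linarith
    have : c * r - S * -(B * (S / ω)) = B / ω := by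
      rw [hr]
      field_simp
      linear_combination hcs
    rw [this]
    positivity

theorem eigZ_ne_zero {ω B : ℝ} (hω : 0 < ω) (hB : 0 < B) (b s t : ℝ) (x : Plane) :
    eigZ ω b B s t x ≠ 0 := by
  intro h
  have := rotated_eigZ_mem_slitPlane hω hB b s t x
  rw [h, mul_zero] at this
  exact Complex.zero_notMem_slitPlane this

theorem det_matZ_ne_zero {ω B : ℝ} (hω : 0 < ω) (hB : 0 < B) (b t : ℝ) (y η : Plane)
    (h : position ω b t y η ≠ 0) : (matZ ω b B t y η).det ≠ 0 := by
  rw [det_matZ _ _ _ _ _ _ h]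
  exact mul_ne_zero (eigZ_ne_zero hω hB _ _ _ _) (eigZ_ne_zero hω hB _ _ _ _)

/-- The branch of the square root of `det Z` along trajectories, in closed form:
`e^{-iωt} √(e^{iωt} λ₊) √(e^{iωt} λ₋)` with principal square roots. -/
noncomputable def rootZ (ω b B t : ℝ) (x : Plane) : ℂ :=
  Complex.exp (-(((ω * t : ℝ) : ℂ) * Complex.I)) *
    (Complex.exp (Complex.log (Complex.exp (((ω * t : ℝ) : ℂ) * Complex.I) * eigZ ω b B 1 t x) / 2) *
     Complex.exp (Complex.log (Complex.exp (((ω * t : ℝ) : ℂ) * Complex.I) * eigZ ω b B (-1) t x) / 2))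

theorem exp_half_log_sq {z : ℂ} (hz : z ≠ 0) : Complex.exp (Complex.log z / 2) ^ 2 = z := by
  rw [← Complex.exp_nat_mul]
  have : ((2 : ℕ) : ℂ) * (Complex.log z / 2) = Complex.log z := by
    push_cast
    ring
  rw [this, Complex.exp_log hz]

theorem rootZ_sq {ω B : ℝ} (hω : 0 < ω) (hB : 0 < B) (b t : ℝ) (x : Plane) :
    rootZ ω b B t x ^ 2 = eigZ ω b B 1 t x * eigZ ω b B (-1) t x := by
  have h1 : ∀ s, Complex.exp (((ω * t : ℝ) : ℂ) * Complex.I) * eigZ ω b B s t x ≠ 0 := fun s =>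
    mul_ne_zero (Complex.exp_ne_zero _) (eigZ_ne_zero hω hB _ _ _ _)
  rw [rootZ, mul_pow, mul_pow, exp_half_log_sq (h1 1), exp_half_log_sq (h1 (-1)), Complex.exp_neg]
  have := Complex.exp_ne_zero (((ω * t : ℝ) : ℂ) * Complex.I)
  field_simp

theorem rootZ_zero (ω b B : ℝ) (x : Plane) : rootZ ω b B 0 x = 1 := by
  simp [rootZ, eigZ, scalZ]

theorem contDiffAt_rootZ {ω B : ℝ} (hω : 0 < ω) (hB : 0 < B) (b : ℝ) {n : WithTop ℕ∞}
    {p : ℝ × Plane} (hp : p.2 ≠ 0) :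
    ContDiffAt ℝ n (fun p : ℝ × Plane => rootZ ω b B p.1 p.2) p := by
  have hof : ∀ {f : ℝ × Plane → ℝ}, ContDiffAt ℝ n f p → ContDiffAt ℝ n (fun q => (f q : ℂ)) p :=
    fun hf => Complex.ofRealCLM.contDiff.contDiffAt.comp p hf
  have hl : ContDiffAt ℝ n (fun q : ℝ × Plane => ω * q.1) p := contDiffAt_const.mul contDiffAt_fst
  have hsin : ContDiffAt ℝ n (fun q : ℝ × Plane => Real.sin (ω * q.1) / ω) p :=
    (Real.contDiff_sin.contDiffAt.comp p hl).div_const ω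
  have hcos : ContDiffAt ℝ n (fun q : ℝ × Plane => Real.cos (ω * q.1)) p :=
    Real.contDiff_cos.contDiffAt.comp p hl
  have hN : ContDiffAt ℝ n (fun q : ℝ × Plane => ‖q.2‖ ^ 2) p :=
    ((contDiff_norm_sq ℝ).comp contDiff_snd).contDiffAt
  have hn : ‖p.2‖ ^ 2 ≠ 0 := pow_ne_zero _ (norm_ne_zero_iff.2 hp)
  have heig : ∀ s : ℝ, ContDiffAt ℝ n (fun q : ℝ × Plane => eigZ ω b B s q.1 q.2) p := fun s =>
    ((hof hcos).sub (contDiffAt_const.mul (hof hsin))).add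
      (hof (hsin.mul (contDiffAt_const.mul (contDiffAt_const.div hN hn))))
  have hlI : ContDiffAt ℝ n (fun q : ℝ × Plane => ((ω * q.1 : ℝ) : ℂ) * Complex.I) p :=
    (hof hl).mul contDiffAt_const
  have hlog : ∀ s : ℝ, ContDiffAt ℝ n (fun q : ℝ × Plane =>
      Complex.exp (Complex.log (Complex.exp (((ω * q.1 : ℝ) : ℂ) * Complex.I)
        * eigZ ω b B s q.1 q.2) / 2)) p := fun s => by
    have h1 : ContDiffAt ℝ n Complex.log (Complex.exp (((ω * p.1 : ℝ) : ℂ) * Complex.I)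
        * eigZ ω b B s p.1 p.2) :=
      (Complex.contDiffAt_log (rotated_eigZ_mem_slitPlane hω hB b s p.1 p.2)).restrict_scalars ℝ
    exact ((h1.comp p (hlI.cexp.mul (heig s))).div_const 2).cexp
  exact hlI.neg.cexp.mul ((hlog 1).mul (hlog (-1)))

/-! ### The set of points whose trajectory avoids the origin -/

/-- The points `((t, y), η)` whose trajectory avoids the origin between the times `0` and `t`. -/
def goodSet (ω b : ℝ) : Set ((ℝ × Plane) × Plane) := {p | Avoids ω b p.1.1 p.1.2 p.2}

theorem avoids_iff (ω b t : ℝ) (y η : Plane) :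
    Avoids ω b t y η ↔ ∀ τ ∈ Icc (0 : ℝ) 1, position ω b (τ * t) y η ≠ 0 := by
  constructor
  · intro h τ hτ
    refine h _ ?_
    rcases le_total 0 t with ht | ht
    · rw [uIcc_of_le ht]
      exact ⟨mul_nonneg hτ.1 ht, mul_le_of_le_one_left ht hτ.2⟩
    · rw [uIcc_of_ge ht]
      exact ⟨by nlinarith [hτ.1, hτ.2], mul_nonpos_of_nonneg_of_nonpos hτ.1 ht⟩
  · intro h s hs
    by_cases ht : t = 0
    · subst ht
      simp at hs
      subst hs
      simpa using h 0 (by simp)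
    · have hm : s / t ∈ Icc (0 : ℝ) 1 := by
        rcases lt_or_gt_of_ne ht with h0 | h0
        · rw [uIcc_of_ge h0.le] at hs
          exact ⟨div_nonneg_of_nonpos hs.2 h0.le, by rw [div_le_one_of_neg h0]; exact hs.1⟩
        · rw [uIcc_of_le h0.le] at hs
          exact ⟨div_nonneg hs.1 h0.le, by rw [div_le_one h0]; exact hs.2⟩
      have := h _ hm
      rwa [div_mul_cancel₀ s ht] at this

theorem Avoids.left_ne_zero {ω b t : ℝ} {y η : Plane} (h : Avoids ω b t y η) : y ≠ 0 := by
  have := h 0 left_mem_uIcc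
  rwa [position_zero] at this

theorem Avoids.position_ne_zero {ω b t : ℝ} {y η : Plane} (h : Avoids ω b t y η) :
    position ω b t y η ≠ 0 := h t right_mem_uIcc

theorem Avoids.mono {ω b t s : ℝ} {y η : Plane} (h : Avoids ω b t y η) (hs : s ∈ uIcc 0 t) :
    Avoids ω b s y η := fun r hr =>
  h r (uIcc_subset_uIcc left_mem_uIcc hs hr)

theorem contDiffAt_position (ω b : ℝ) {n : WithTop ℕ∞} {p : (ℝ × Plane) × Plane}
    (hp : p.1.2 ≠ 0) :
    ContDiffAt ℝ n (fun p : (ℝ × Plane) × Plane => position ω b p.1.1 p.1.2 p.2) p := by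
  have hl : ContDiffAt ℝ n (fun q : (ℝ × Plane) × Plane => ω * q.1.1) p :=
    contDiffAt_const.mul (contDiff_fst.comp contDiff_fst).contDiffAt
  have hA : ContDiffAt ℝ n (fun q : (ℝ × Plane) × Plane => vecPot b q.1.2) p :=
    ContDiffAt.comp (g := vecPot b) (f := fun q : (ℝ × Plane) × Plane => q.1.2) p
      (contDiffAt_vecPot b hp) (contDiff_snd.comp contDiff_fst).contDiffAt
  exact ((Real.contDiff_cos.contDiffAt.comp p hl).smul (contDiff_snd.comp contDiff_fst).contDiffAt).add
    (((Real.contDiff_sin.contDiffAt.comp p hl).div_const ω).smul (contDiffAt_snd.sub hA))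

theorem contDiffAt_velocity (ω b : ℝ) {n : WithTop ℕ∞} {p : (ℝ × Plane) × Plane}
    (hp : p.1.2 ≠ 0) :
    ContDiffAt ℝ n (fun p : (ℝ × Plane) × Plane => velocity ω b p.1.1 p.1.2 p.2) p := by
  have hl : ContDiffAt ℝ n (fun q : (ℝ × Plane) × Plane => ω * q.1.1) p :=
    contDiffAt_const.mul (contDiff_fst.comp contDiff_fst).contDiffAt
  have hA : ContDiffAt ℝ n (fun q : (ℝ × Plane) × Plane => vecPot b q.1.2) p :=
    ContDiffAt.comp (g := vecPot b) (f := fun q : (ℝ × Plane) × Plane => q.1.2) p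
      (contDiffAt_vecPot b hp) (contDiff_snd.comp contDiff_fst).contDiffAt
  exact ((contDiffAt_const.mul (Real.contDiff_sin.contDiffAt.comp p hl)).neg.smul
      (contDiff_snd.comp contDiff_fst).contDiffAt).add
    ((Real.contDiff_cos.contDiffAt.comp p hl).smul (contDiffAt_snd.sub hA))

/-- After rescaling the time interval to `[0, 1]`, openness is a consequence of its compactness. -/
theorem isOpen_goodSet (ω b : ℝ) : IsOpen (goodSet ω b) := by
  let V : Set ((ℝ × Plane) × Plane) := {p | p.1.2 ≠ 0}
  have hV : IsOpen V := isOpen_compl_singleton.preimage (by fun_prop)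
  have hV0 : IsOpen (V ∩ (fun p : (ℝ × Plane) × Plane => position ω b p.1.1 p.1.2 p.2) ⁻¹' {0}ᶜ) :=
    ContinuousOn.isOpen_inter_preimage (fun p hp =>
      (contDiffAt_position (n := 0) ω b hp).continuousAt.continuousWithinAt) hV
      isOpen_compl_singleton
  let U : Set (((ℝ × Plane) × Plane) × ℝ) :=
    {q | ((q.2 * q.1.1.1, q.1.1.2), q.1.2) ∈
      V ∩ (fun p : (ℝ × Plane) × Plane => position ω b p.1.1 p.1.2 p.2) ⁻¹' {0}ᶜ}
  have hU : IsOpen U := hV0.preimage (by fun_prop)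
  have : goodSet ω b = tube U := by
    ext p
    constructor
    · intro hp τ hτ
      exact ⟨Avoids.left_ne_zero hp, (avoids_iff ω b _ _ _).1 hp τ hτ⟩
    · intro hp
      exact (avoids_iff ω b _ _ _).2 fun τ hτ => (hp τ hτ).2
  rw [this]
  exact isOpen_tube hU

theorem starTime_goodSet (ω b : ℝ) : StarTime (goodSet ω b) := by
  rintro ⟨⟨t, y⟩, η⟩ hp τ hτ
  change Avoids ω b (τ * t) y η
  rw [avoids_iff]
  intro s hs
  rw [← mul_assoc]
  exact (avoids_iff ω b t y η).1 hp _ ⟨mul_nonneg hs.1 hτ.1, mul_le_one₀ hs.2 hτ.1 hτ.2⟩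

/-- The branch of the square root of `det Z` chosen in the definition of `sqrtDetZ` is the one
given in closed form. -/
theorem sqrtDetZ_eq {ω B : ℝ} (hω : 0 < ω) (hB : 0 < B) (b t : ℝ) (y η : Plane)
    (h : Avoids ω b t y η) : sqrtDetZ ω b B t y η = rootZ ω b B t (position ω b t y η) := by
  have hpos : Continuous fun s => position ω b s y η := by
    unfold position
    fun_prop
  have hr : IsSqrtDetZ ω b B t y η fun s => rootZ ω b B s (position ω b s y η) := by
    refine ⟨fun s hs => ?_, ?_, fun s hs => ?_⟩
    · exact (ContinuousAt.comp (f := fun s => (s, position ω b s y η))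
        (g := fun p : ℝ × Plane => rootZ ω b B p.1 p.2)
        (contDiffAt_rootZ (n := 0) hω hB b (p := (s, position ω b s y η)) (h s hs)).continuousAt
        (by fun_prop)).continuousWithinAt
    · exact rootZ_zero ω b B _
    · rw [rootZ_sq hω hB, det_matZ _ _ _ _ _ _ (h s hs)]
  have hex : ∃ r : ℝ → ℂ, IsSqrtDetZ ω b B t y η r := ⟨_, hr⟩
  rw [sqrtDetZ, dif_pos hex]
  have hc := hex.choose_spec
  have hne : ∀ {s}, s ∈ uIcc 0 t → rootZ ω b B s (position ω b s y η) ≠ 0 := fun {s} hs h0 => by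
    have := hr.2.2 s hs
    simp only [h0] at this
    exact det_matZ_ne_zero hω hB b s y η (h s hs) (by rw [← this]; simp)
  -- Two continuous square roots of a nonvanishing function on an interval agree if they agree at `0`.
  refine IsPreconnected.eq_of_sq_eq (S := uIcc 0 t) isPreconnected_uIcc hc.1 hr.1 (fun s hs => ?_)
    hne left_mem_uIcc (hc.2.1.trans hr.2.1.symm) right_mem_uIcc
  simp only [Pi.pow_apply]
  rw [hc.2.2 s hs, hr.2.2 s hs]

/-! ### Symbols built from the classical flow -/

/-- The part of `goodSet` where both ends of the trajectory are at distance more than `ρ` from the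
origin. -/
def farSet (ω b ρ : ℝ) : Set ((ℝ × Plane) × Plane) :=
  goodSet ω b ∩ {p | ρ < ‖p.1.2‖ ∧ ρ < ‖position ω b p.1.1 p.1.2 p.2‖}

/-- The part of `goodSet` where one of the ends of the trajectory is at distance less than `ε` from
the origin. -/
def nearSet (ω b ε : ℝ) : Set ((ℝ × Plane) × Plane) :=
  goodSet ω b ∩ {p | ‖p.1.2‖ < ε ∨ ‖position ω b p.1.1 p.1.2 p.2‖ < ε}

theorem continuousOn_position_goodSet (ω b : ℝ) :
    ContinuousOn (fun p : (ℝ × Plane) × Plane => position ω b p.1.1 p.1.2 p.2) (goodSet ω b) :=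
  fun _ hp => (contDiffAt_position (n := 0) ω b (Avoids.left_ne_zero hp)).continuousAt
    |>.continuousWithinAt

theorem isOpen_farSet (ω b ρ : ℝ) : IsOpen (farSet ω b ρ) :=
  ContinuousOn.isOpen_inter_preimage (t := {q : ℝ × ℝ | ρ < q.1 ∧ ρ < q.2})
    (f := fun p : (ℝ × Plane) × Plane => (‖p.1.2‖, ‖position ω b p.1.1 p.1.2 p.2‖))
    (ContinuousOn.prodMk (by fun_prop) (continuousOn_position_goodSet ω b).norm)
    (isOpen_goodSet ω b)
    ((isOpen_lt continuous_const continuous_fst).inter (isOpen_lt continuous_const continuous_snd))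

theorem isOpen_nearSet (ω b ε : ℝ) : IsOpen (nearSet ω b ε) :=
  ContinuousOn.isOpen_inter_preimage (t := {q : ℝ × ℝ | q.1 < ε ∨ q.2 < ε})
    (f := fun p : (ℝ × Plane) × Plane => (‖p.1.2‖, ‖position ω b p.1.1 p.1.2 p.2‖))
    (ContinuousOn.prodMk (by fun_prop) (continuousOn_position_goodSet ω b).norm)
    (isOpen_goodSet ω b)
    ((isOpen_lt continuous_fst continuous_const).union (isOpen_lt continuous_snd continuous_const))

/-- The two open sets overlap, so a family which is a symbol on the first one and vanishes on the
second one is a symbol on the whole set of good points. -/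
theorem goodSet_subset_far_union_near {ω b ε : ℝ} (hε : 0 < ε) :
    goodSet ω b ⊆ farSet ω b (ε / 2) ∪ nearSet ω b ε := by
  intro p hp
  by_cases h : ‖p.1.2‖ < ε ∨ ‖position ω b p.1.1 p.1.2 p.2‖ < ε
  · exact Or.inr ⟨hp, h⟩
  · push Not at h
    exact Or.inl ⟨hp, by linarith [h.1], by linarith [h.2]⟩

theorem contDiff_ofReal_comp {E : Type*} [NormedAddCommGroup E] [NormedSpace ℝ E] {f : E → ℝ}
    {n : WithTop ℕ∞} (hf : ContDiff ℝ n f) : ContDiff ℝ n fun e => (f e : ℂ) :=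
  Complex.ofRealCLM.contDiff.comp hf

/-- A function of the parameter alone belongs to the class as soon as it is smooth and locally
bounded. -/
theorem Sym.of_param_on {E : Type*} [NormedAddCommGroup E] [NormedSpace ℝ E]
    {D : Set (E × Plane)} {a : E → ℂ} (hs : SmoothFam D fun e _ => a e)
    (hg : PolyGrowth D fun e _ => a e) : Sym D fun e _ => a e := by
  refine Sym.of_growth_of_pd hs hg fun j => ?_
  have : (fun e : E => AharonovBohm.pd j (fun _ => a e)) = fun _ _ => (0 : ℂ) := by
    funext e η
    exact pd_const j _ η
  rw [this]
  exact Sym.const D 0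

theorem contDiff_sin_div {ω : ℝ} {n : WithTop ℕ∞} :
    ContDiff ℝ n fun e : ℝ × Plane => Real.sin (ω * e.1) / ω :=
  (Real.contDiff_sin.comp (contDiff_const.mul contDiff_fst)).div_const ω

theorem contDiff_cos_time {ω : ℝ} {n : WithTop ℕ∞} :
    ContDiff ℝ n fun e : ℝ × Plane => Real.cos (ω * e.1) :=
  Real.contDiff_cos.comp (contDiff_const.mul contDiff_fst)

theorem contDiff_coord_snd (j : Fin 2) {n : WithTop ℕ∞} :
    ContDiff ℝ n fun e : ℝ × Plane => e.2 j :=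
  (coordL j).contDiff.comp contDiff_snd

theorem sym_eta {E : Type*} [NormedAddCommGroup E] [NormedSpace ℝ E] (D : Set (E × Plane))
    (j : Fin 2) : Sym D fun (_ : E) η => ((η j : ℝ) : ℂ) := by
  refine Sym.of_growth_of_pd ?_ ?_ fun k => ?_
  · exact (contDiff_ofReal_comp ((coordL j).contDiff.comp contDiff_snd)).contDiffOn
  · intro Q _
    refine ⟨1, 1, zero_le_one, fun e _ η _ => ?_⟩
    rw [Complex.norm_real, pow_one, one_mul]
    have := PiLp.norm_apply_le η j
    linarith
  · have : (fun _ : E => AharonovBohm.pd k (fun η => ((η j : ℝ) : ℂ))) =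
        fun _ _ => ((coordL j (stdVec k) : ℝ) : ℂ) := by
      funext e η
      exact pd_ofReal_of_hasFDerivAt (coordL j).hasFDerivAt k
    rw [this]
    exact Sym.const D _

theorem vecPot_apply_abs_le (b : ℝ) (x : Plane) (j : Fin 2) :
    |vecPot b x j| ≤ |b| * ‖x‖⁻¹ := by
  by_cases hx : ‖x‖ = 0
  · fin_cases j <;> simp [vecPot, hx]
  · have h : ∀ k : Fin 2, |x k / ‖x‖ ^ 2| ≤ ‖x‖⁻¹ := fun k => by
      have hk : |x k| ≤ ‖x‖ := PiLp.norm_apply_le x k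
      rw [abs_div, abs_of_nonneg (sq_nonneg ‖x‖), div_le_iff₀ (by positivity)]
      have : ‖x‖⁻¹ * ‖x‖ ^ 2 = ‖x‖ := by field_simp
      rwa [this]
    fin_cases j
    · change |-b * (x 1 / ‖x‖ ^ 2)| ≤ _
      rw [abs_mul, abs_neg]
      exact mul_le_mul_of_nonneg_left (h 1) (abs_nonneg b)
    · change |b * (x 0 / ‖x‖ ^ 2)| ≤ _
      rw [abs_mul]
      exact mul_le_mul_of_nonneg_left (h 0) (abs_nonneg b)

section Flow

variable {ω b ρ : ℝ}

theorem sym_vecPot_left (hρ : 0 < ρ) (j : Fin 2) :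
    Sym (farSet ω b ρ) fun e _ => ((vecPot b e.2 j : ℝ) : ℂ) := by
  refine Sym.of_param_on (fun p hp => ?_) ?_
  · have h1 : ContDiffAt ℝ ((⊤ : ℕ∞) : WithTop ℕ∞) (fun q : (ℝ × Plane) × Plane => vecPot b q.1.2) p :=
      ContDiffAt.comp (g := vecPot b) (f := fun q : (ℝ × Plane) × Plane => q.1.2) p
        (contDiffAt_vecPot b (Avoids.left_ne_zero hp.1)) (contDiff_snd.comp contDiff_fst).contDiffAt
    have h2 : ContDiffAt ℝ ((⊤ : ℕ∞) : WithTop ℕ∞)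
        (fun q : (ℝ × Plane) × Plane => vecPot b q.1.2 j) p := contDiffAt_euclidean.1 h1 j
    exact (Complex.ofRealCLM.contDiff.contDiffAt.comp p h2).contDiffWithinAt
  · intro Q _
    refine ⟨|b| * ρ⁻¹, 0, by positivity, fun e _ η hη => ?_⟩
    rw [Complex.norm_real, pow_zero, mul_one]
    refine (vecPot_apply_abs_le b e.2 j).trans ?_
    have := hη.2.1
    gcongr

theorem sym_position (hρ : 0 < ρ) (j : Fin 2) :
    Sym (farSet ω b ρ) fun e η => ((position ω b e.1 e.2 η j : ℝ) : ℂ) := by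
  have hD := isOpen_farSet ω b ρ
  refine (((Sym.of_param _ (contDiff_ofReal_comp (contDiff_cos_time (ω := ω)))).mul hD
    (Sym.of_param _ (contDiff_ofReal_comp (contDiff_coord_snd j)))).add hD
    ((Sym.of_param _ (contDiff_ofReal_comp (contDiff_sin_div (ω := ω)))).mul hD
    ((sym_eta _ j).sub hD (sym_vecPot_left hρ j)))).congr hD fun e η _ => ?_
  rw [position_apply]
  push_cast
  ring

theorem sym_velocity (hρ : 0 < ρ) (j : Fin 2) :
    Sym (farSet ω b ρ) fun e η => ((velocity ω b e.1 e.2 η j : ℝ) : ℂ) := by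
  have hD := isOpen_farSet ω b ρ
  have hs : ContDiff ℝ ((⊤ : ℕ∞) : WithTop ℕ∞)
      fun e : ℝ × Plane => -(ω * Real.sin (ω * e.1)) :=
    (contDiff_const.mul (Real.contDiff_sin.comp (contDiff_const.mul contDiff_fst))).neg
  refine (((Sym.of_param _ (contDiff_ofReal_comp hs)).mul hD
    (Sym.of_param _ (contDiff_ofReal_comp (contDiff_coord_snd j)))).add hD
    ((Sym.of_param _ (contDiff_ofReal_comp (contDiff_cos_time (ω := ω)))).mul hD
    ((sym_eta _ j).sub hD (sym_vecPot_left hρ j)))).congr hD fun e η _ => ?_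
  rw [velocity_apply]
  push_cast
  ring

end Flow

/-- The algebra of functions on the punctured plane generated by the coordinates and `|x|⁻²`. -/
inductive RatFn : (Plane → ℂ) → Prop
  | const (c : ℂ) : RatFn fun _ => c
  | coord (j : Fin 2) : RatFn fun x => ((x j : ℝ) : ℂ)
  | invSq : RatFn fun x => (((x 0 : ℝ) : ℂ) ^ 2 + ((x 1 : ℝ) : ℂ) ^ 2)⁻¹
  | add {f g : Plane → ℂ} : RatFn f → RatFn g → RatFn fun x => f x + g x
  | mul {f g : Plane → ℂ} : RatFn f → RatFn g → RatFn fun x => f x * g x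

theorem complex_sq_add_sq_ne_zero {x : Plane} (hx : x ≠ 0) :
    ((x 0 : ℝ) : ℂ) ^ 2 + ((x 1 : ℝ) : ℂ) ^ 2 ≠ 0 := by
  have h : ((x 0 ^ 2 + x 1 ^ 2 : ℝ) : ℂ) ≠ 0 := Complex.ofReal_ne_zero.2 (plane_sq_add_sq_ne_zero hx)
  push_cast at h
  exact h

theorem contDiff_coord_complex (j : Fin 2) {n : WithTop ℕ∞} :
    ContDiff ℝ n fun x : Plane => ((x j : ℝ) : ℂ) :=
  contDiff_ofReal_comp (coordL j).contDiff

theorem RatFn.contDiffAt {f : Plane → ℂ} (hf : RatFn f) {x : Plane} (hx : x ≠ 0)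
    {n : WithTop ℕ∞} : ContDiffAt ℝ n f x := by
  induction hf with
  | const c => exact contDiffAt_const
  | coord j => exact (contDiff_coord_complex j).contDiffAt
  | invSq =>
    exact ContDiffAt.inv (((contDiff_coord_complex 0).pow 2).add
      ((contDiff_coord_complex 1).pow 2)).contDiffAt (complex_sq_add_sq_ne_zero hx)
  | add _ _ h1 h2 => exact h1.add h2
  | mul _ _ h1 h2 => exact h1.mul h2

theorem RatFn.differentiableAt {f : Plane → ℂ} (hf : RatFn f) {x : Plane} (hx : x ≠ 0) :
    DifferentiableAt ℝ f x := (hf.contDiffAt hx (n := 1)).differentiableAt (by simp)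

theorem pd_coord (j k : Fin 2) (x : Plane) :
    pd k (fun x : Plane => ((x j : ℝ) : ℂ)) x = if j = k then 1 else 0 := by
  have h := pd_ofReal_of_hasFDerivAt (f := fun x : Plane => x j) ((coordL j).hasFDerivAt (x := x)) k
  rw [h]
  by_cases h : j = k <;> simp [h]

/-- The algebra is stable under differentiation away from the origin. -/
theorem RatFn.exists_pd {f : Plane → ℂ} (hf : RatFn f) (k : Fin 2) :
    ∃ g, RatFn g ∧ ∀ x : Plane, x ≠ 0 → pd k f x = g x := by
  induction hf with
  | const c => exact ⟨_, RatFn.const 0, fun x _ => pd_const k c x⟩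
  | coord j => exact ⟨_, RatFn.const (if j = k then 1 else 0), fun x _ => pd_coord j k x⟩
  | invSq =>
    refine ⟨_, (RatFn.const (-2)).mul ((RatFn.coord k).mul (RatFn.invSq.mul RatFn.invSq)),
      fun x hx => ?_⟩
    have h0 := complex_sq_add_sq_ne_zero hx
    have hd : ∀ j : Fin 2, DifferentiableAt ℝ (fun x : Plane => ((x j : ℝ) : ℂ)) x :=
      fun j => (RatFn.coord j).differentiableAt hx
    have h1 : pd k (fun x : Plane => (((x 0 : ℝ) : ℂ) * ((x 0 : ℝ) : ℂ) +
        ((x 1 : ℝ) : ℂ) * ((x 1 : ℝ) : ℂ)) *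
        (((x 0 : ℝ) : ℂ) ^ 2 + ((x 1 : ℝ) : ℂ) ^ 2)⁻¹) x = 0 := by
      rw [← pd_const k 1 x]
      refine pd_congr_on (U := {0}ᶜ) isOpen_compl_singleton (fun z hz => ?_) k hx
      rw [← pow_two, ← pow_two]
      exact mul_inv_cancel₀ (complex_sq_add_sq_ne_zero hz)
    rw [pd_mul (((hd 0).fun_mul (hd 0)).fun_add ((hd 1).fun_mul (hd 1))) (RatFn.invSq.differentiableAt hx),
      pd_add ((hd 0).fun_mul (hd 0)) ((hd 1).fun_mul (hd 1)), pd_mul (hd 0) (hd 0), pd_mul (hd 1) (hd 1),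
      pd_coord, pd_coord, ← pow_two, ← pow_two] at h1
    apply mul_left_cancel₀ h0
    rw [eq_neg_of_add_eq_zero_right h1]
    fin_cases k <;> simp <;> field_simp <;> ring
  | @add f g h1 h2 ih1 ih2 =>
    obtain ⟨f', hf', e1⟩ := ih1
    obtain ⟨g', hg', e2⟩ := ih2
    refine ⟨_, hf'.add hg', fun x hx => ?_⟩
    rw [pd_add (h1.differentiableAt hx) (h2.differentiableAt hx), e1 x hx, e2 x hx]
  | @mul f g h1 h2 ih1 ih2 =>
    obtain ⟨f', hf', e1⟩ := ih1
    obtain ⟨g', hg', e2⟩ := ih2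
    refine ⟨_, (hf'.mul h2).add (h1.mul hg'), fun x hx => ?_⟩
    rw [pd_mul (h1.differentiableAt hx) (h2.differentiableAt hx), e1 x hx, e2 x hx]

theorem RatFn.vecPot_apply (b : ℝ) (j : Fin 2) : RatFn fun x => ((vecPot b x j : ℝ) : ℂ) := by
  fin_cases j
  · have h := (RatFn.const (-b : ℂ)).mul ((RatFn.coord 1).mul RatFn.invSq)
    change RatFn fun x => ((vecPot b x 0 : ℝ) : ℂ)
    convert h using 2 with x
    rw [vecPot_zero_apply]
    push_cast
    rfl
  · have h := (RatFn.const (b : ℂ)).mul ((RatFn.coord 0).mul RatFn.invSq)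
    change RatFn fun x => ((vecPot b x 1 : ℝ) : ℂ)
    convert h using 2 with x
    rw [vecPot_one_apply]
    push_cast
    rfl

/-- The partial derivatives of all orders of a linear combination of functions in the algebra,
with functions in the algebra that do not depend on the coefficients. -/
theorem RatFn.exists_pdList {m : ℕ} {r : Fin m → Plane → ℂ} (hr : ∀ i, RatFn (r i))
    (J : List (Fin 2)) : ∃ r' : Fin m → Plane → ℂ, (∀ i, RatFn (r' i)) ∧
      ∀ (c : Fin m → ℂ) (F : Plane → ℂ), (∀ x, x ≠ 0 → F x = ∑ i, c i * r i x) →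
        ∀ x, x ≠ 0 → pdList J F x = ∑ i, c i * r' i x := by
  induction J with
  | nil => exact ⟨r, hr, fun c F hF => hF⟩
  | cons j J ih =>
    obtain ⟨r', hr', h⟩ := ih
    choose r'' hr'' h' using fun i => (hr' i).exists_pd j
    refine ⟨r'', hr'', fun c F hF x hx => ?_⟩
    have h1 : pdList (j :: J) F x = pd j (fun x => ∑ i, c i * r' i x) x :=
      pd_congr_on (U := {0}ᶜ) isOpen_compl_singleton (fun z hz => h c F hF z hz) j hx
    rw [h1, pd_sum _ fun i _ => ((hr' i).differentiableAt hx).const_mul (c i)]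
    refine Finset.sum_congr rfl fun i _ => ?_
    rw [pd_const_mul ((hr' i).differentiableAt hx), h' i x hx]

section Flow

variable {ω b ρ : ℝ}

theorem inv_normSq_position_le (hρ : 0 < ρ) {e : ℝ × Plane} {η : Plane}
    (h : (e, η) ∈ farSet ω b ρ) : (‖position ω b e.1 e.2 η‖ ^ 2)⁻¹ ≤ (ρ ^ 2)⁻¹ := by
  have := h.2.2.le
  gcongr

/-- Functions in the algebra are symbols along the flow, away from the origin. -/
theorem RatFn.sym_comp_position (hρ : 0 < ρ) {f : Plane → ℂ} (hf : RatFn f) :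
    Sym (farSet ω b ρ) fun e η => f (position ω b e.1 e.2 η) := by
  have hD := isOpen_farSet ω b ρ
  induction hf with
  | const c => exact Sym.const _ c
  | coord j => exact sym_position hρ j
  | invSq =>
    refine (((sym_position hρ 0).pow hD 2).add hD ((sym_position hρ 1).pow hD 2)).inv hD
      (fun e η h => complex_sq_add_sq_ne_zero h.1.position_ne_zero) ?_
    intro Q _
    refine ⟨(ρ ^ 2)⁻¹, 0, by positivity, fun e _ η h => ?_⟩
    have h2 := inv_normSq_position_le hρ h
    have h3 : ((position ω b e.1 e.2 η 0 : ℝ) : ℂ) ^ 2 + ((position ω b e.1 e.2 η 1 : ℝ) : ℂ) ^ 2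
        = ((‖position ω b e.1 e.2 η‖ ^ 2 : ℝ) : ℂ) := by
      rw [plane_norm_sq]
      push_cast
      ring
    beta_reduce
    rw [h3, norm_inv, Complex.norm_real, pow_zero, mul_one, Real.norm_eq_abs,
      abs_of_nonneg (sq_nonneg _)]
    exact h2
  | add _ _ h1 h2 => exact h1.add hD h2
  | mul _ _ h1 h2 => exact h1.mul hD h2

theorem RatFn.jacA_apply (b : ℝ) (j k : Fin 2) : RatFn fun x => ((jacA b x j k : ℝ) : ℂ) := by
  have h1 : RatFn fun x => ((jacA b x 0 0 : ℝ) : ℂ) := by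
    have h := (RatFn.const (2 * b : ℂ)).mul (((RatFn.coord 0).mul (RatFn.coord 1)).mul
      (RatFn.invSq.mul RatFn.invSq))
    convert h using 2 with x
    simp [jacA]
    field_simp
  have h2 : RatFn fun x => ((jacA b x 0 1 : ℝ) : ℂ) := by
    have h := (RatFn.const (b : ℂ)).mul ((((RatFn.coord 1).mul (RatFn.coord 1)).add
      ((RatFn.const (-1)).mul ((RatFn.coord 0).mul (RatFn.coord 0)))).mul
      (RatFn.invSq.mul RatFn.invSq))
    convert h using 2 with x
    simp [jacA]
    field_simp
    ring
  fin_cases j <;> fin_cases k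
  · exact h1
  · exact h2
  · exact h2
  · convert (RatFn.const (-1)).mul h1 using 2 with x
    simp [jacA_one_one]

variable {B : ℝ}

theorem contDiff_scalZ {n : WithTop ℕ∞} : ContDiff ℝ n fun e : ℝ × Plane => scalZ ω B e.1 :=
  (contDiff_ofReal_comp contDiff_cos_time).sub
    (contDiff_const.mul (contDiff_ofReal_comp contDiff_sin_div))

theorem sym_matZ (hρ : 0 < ρ) (j k : Fin 2) :
    Sym (farSet ω b ρ) fun e η => matZ ω b B e.1 e.2 η j k := by
  have hD := isOpen_farSet ω b ρ
  have h1 : ContDiff ℝ ((⊤ : ℕ∞) : WithTop ℕ∞)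
      fun e : ℝ × Plane => if j = k then scalZ ω B e.1 else 0 := by
    by_cases h : j = k
    · simpa [h] using contDiff_scalZ
    · simpa [h] using contDiff_const
  exact ((Sym.of_param _ h1).add hD ((Sym.of_param _ (contDiff_ofReal_comp contDiff_sin_div)).mul hD
    ((RatFn.jacA_apply b j k).sym_comp_position hρ))).congr hD fun e η h =>
      matZ_apply ω b B e.1 e.2 η h.1.position_ne_zero j k

theorem sym_eigZ (hρ : 0 < ρ) (s : ℝ) :
    Sym (farSet ω b ρ) fun e η => eigZ ω b B s e.1 (position ω b e.1 e.2 η) := by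
  have hD := isOpen_farSet ω b ρ
  refine ((Sym.of_param _ (contDiff_scalZ (ω := ω) (B := B))).add hD
    ((Sym.of_param _ (contDiff_ofReal_comp (contDiff_sin_div (ω := ω)))).mul hD
      ((RatFn.invSq.sym_comp_position hρ).const_mul hD (s * b)))).congr hD
    fun e η _ => ?_
  rw [eigZ, plane_norm_sq]
  push_cast
  ring

/-- A lower bound for the eigenvalues of `Z`: the imaginary part controls `sin(ω t)`, then the real
part controls `cos(ω t)`, and these do not vanish together. -/
theorem norm_inv_eigZ_le (hω : 0 < ω) (hB : 0 < B) (s t : ℝ) (hs : |s| = 1) (x : Plane) :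
    ‖(eigZ ω b B s t x)⁻¹‖ ≤ 1 + |b| * (‖x‖ ^ 2)⁻¹ / B + ω / B := by
  set z := eigZ ω b B s t x with hz
  have hz0 : 0 < ‖z‖ := norm_pos_iff.2 (eigZ_ne_zero hω hB b s t x)
  have hre : |z.re| ≤ ‖z‖ := Complex.abs_re_le_norm z
  have him : |z.im| ≤ ‖z‖ := Complex.abs_im_le_norm z
  have him' : |Real.sin (ω * t) / ω| ≤ ‖z‖ / B := by
    rw [le_div_iff₀ hB]
    rw [hz, eigZ_im, abs_neg, abs_mul, abs_of_pos hB, ← hz] at him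
    linarith
  have hβ : |s * (b / ‖x‖ ^ 2)| = |b| * (‖x‖ ^ 2)⁻¹ := by
    rw [abs_mul, hs, one_mul, abs_div, abs_of_nonneg (sq_nonneg ‖x‖), div_eq_mul_inv]
  have hcos : |Real.cos (ω * t)| ≤ ‖z‖ + ‖z‖ / B * (|b| * (‖x‖ ^ 2)⁻¹) := by
    have h1 : Real.cos (ω * t) = z.re - Real.sin (ω * t) / ω * (s * (b / ‖x‖ ^ 2)) := by
      rw [hz, eigZ_re]
      ring
    rw [h1]
    refine (abs_sub _ _).trans (add_le_add hre ?_)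
    rw [abs_mul, hβ]
    gcongr
  have hsin : |Real.sin (ω * t)| ≤ ω * (‖z‖ / B) := by
    rw [abs_div, abs_of_pos hω, div_le_iff₀ hω] at him'
    linarith
  have h1 : 1 ≤ |Real.cos (ω * t)| + |Real.sin (ω * t)| := by
    have h2 := Real.sin_sq_add_cos_sq (ω * t)
    rw [← sq_abs (Real.sin _), ← sq_abs (Real.cos _)] at h2
    nlinarith [abs_nonneg (Real.sin (ω * t)), abs_nonneg (Real.cos (ω * t))]
  rw [norm_inv, inv_le_iff_one_le_mul₀ hz0]
  refine (h1.trans (add_le_add hcos hsin)).trans (le_of_eq ?_)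
  ring

theorem polyGrowth_inv_eigZ (hω : 0 < ω) (hB : 0 < B) (hρ : 0 < ρ) (s : ℝ) (hs : |s| = 1) :
    PolyGrowth (farSet ω b ρ) fun e η => (eigZ ω b B s e.1 (position ω b e.1 e.2 η))⁻¹ := by
  intro Q _
  refine ⟨1 + |b| * (ρ ^ 2)⁻¹ / B + ω / B, 0, by positivity, fun e _ η h => ?_⟩
  rw [pow_zero, mul_one]
  refine (norm_inv_eigZ_le hω hB s e.1 hs _).trans ?_
  have := inv_normSq_position_le hρ h
  gcongr

theorem sym_det_matZ (hρ : 0 < ρ) :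
    Sym (farSet ω b ρ) fun e η => (matZ ω b B e.1 e.2 η).det := by
  have hD := isOpen_farSet ω b ρ
  exact ((sym_eigZ hρ 1).mul hD (sym_eigZ hρ (-1))).congr hD fun e η h =>
    det_matZ ω b B e.1 e.2 η h.1.position_ne_zero

theorem polyGrowth_inv_det_matZ (hω : 0 < ω) (hB : 0 < B) (hρ : 0 < ρ) :
    PolyGrowth (farSet ω b ρ) fun e η => (matZ ω b B e.1 e.2 η).det⁻¹ :=
  ((polyGrowth_inv_eigZ hω hB hρ 1 (by simp)).mul
    (polyGrowth_inv_eigZ hω hB hρ (-1) (by simp))).congr fun e η h => by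
      rw [det_matZ ω b B e.1 e.2 η h.1.position_ne_zero, mul_inv]

theorem sym_inv_matZ (hω : 0 < ω) (hB : 0 < B) (hρ : 0 < ρ) (j k : Fin 2) :
    Sym (farSet ω b ρ) fun e η => (matZ ω b B e.1 e.2 η)⁻¹ j k := by
  have hD := isOpen_farSet ω b ρ
  have hdet := (sym_det_matZ (ω := ω) (b := b) (B := B) hρ).inv hD
    (fun e η h => det_matZ_ne_zero hω hB b e.1 e.2 η h.1.position_ne_zero)
    (polyGrowth_inv_det_matZ hω hB hρ)
  have hadj : Sym (farSet ω b ρ) fun e η => (matZ ω b B e.1 e.2 η).adjugate j k := by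
    simp only [Matrix.adjugate_fin_two]
    fin_cases j <;> fin_cases k
    · exact sym_matZ hρ 1 1
    · exact (sym_matZ hρ 0 1).neg hD
    · exact (sym_matZ hρ 1 0).neg hD
    · exact sym_matZ hρ 0 0
  refine (hdet.mul hD hadj).congr hD fun e η h => ?_
  rw [Matrix.inv_def, Ring.inverse_eq_inv']
  rfl

theorem smoothFam_sqrtDetZ (hω : 0 < ω) (hB : 0 < B) :
    SmoothFam (goodSet ω b) fun e η => sqrtDetZ ω b B e.1 e.2 η := by
  refine SmoothFam.congr' (f := fun e η => rootZ ω b B e.1 (position ω b e.1 e.2 η))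
    (fun p hp => ?_) fun e η h => sqrtDetZ_eq hω hB b e.1 e.2 η h
  exact (ContDiffAt.comp (g := fun p : ℝ × Plane => rootZ ω b B p.1 p.2)
    (f := fun p : (ℝ × Plane) × Plane => (p.1.1, position ω b p.1.1 p.1.2 p.2)) p
    (contDiffAt_rootZ hω hB b (Avoids.position_ne_zero hp))
    ((contDiff_fst.comp contDiff_fst).contDiffAt.prodMk
      (contDiffAt_position ω b (Avoids.left_ne_zero hp)))).contDiffWithinAt

theorem sqrtDetZ_sq (hω : 0 < ω) (hB : 0 < B) {t : ℝ} {y η : Plane} (h : Avoids ω b t y η) :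
    sqrtDetZ ω b B t y η ^ 2 = (matZ ω b B t y η).det := by
  rw [sqrtDetZ_eq hω hB b t y η h, rootZ_sq hω hB, det_matZ _ _ _ _ _ _ h.position_ne_zero]

theorem sqrtDetZ_ne_zero (hω : 0 < ω) (hB : 0 < B) {t : ℝ} {y η : Plane} (h : Avoids ω b t y η) :
    sqrtDetZ ω b B t y η ≠ 0 := fun h0 => by
  have := sqrtDetZ_sq hω hB h
  rw [h0] at this
  exact det_matZ_ne_zero hω hB b t y η h.position_ne_zero (by rw [← this]; simp)

theorem sym_sqrtDetZ (hω : 0 < ω) (hB : 0 < B) (hρ : 0 < ρ) :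
    Sym (farSet ω b ρ) (fun e η => sqrtDetZ ω b B e.1 e.2 η) ∧
      Sym (farSet ω b ρ) fun e η => (sqrtDetZ ω b B e.1 e.2 η)⁻¹ :=
  Sym.sqrt (isOpen_farSet ω b ρ) (sym_det_matZ hρ)
    (ContDiffOn.mono (smoothFam_sqrtDetZ hω hB) inter_subset_left)
    (fun _ _ h => sqrtDetZ_sq hω hB h.1)
    (fun e η h => det_matZ_ne_zero hω hB b e.1 e.2 η h.1.position_ne_zero)
    (polyGrowth_inv_det_matZ hω hB hρ)

end Flow

/-! ### The cut-offs -/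

section Cutoff

/-- A smooth function that is constant outside a ball is bounded. -/
theorem exists_bound_of_const_outside {ψ : Plane → ℂ} (hψ : Continuous ψ) {c : ℂ} {R : ℝ}
    (hc : ∀ x : Plane, R < ‖x‖ → ψ x = c) : ∃ C, 0 ≤ C ∧ ∀ x, ‖ψ x‖ ≤ C := by
  obtain ⟨C, hC⟩ := (isCompact_closedBall (0 : Plane) R).exists_bound_of_continuousOn hψ.continuousOn
  refine ⟨|C| + ‖c‖, by positivity, fun x => ?_⟩
  by_cases hx : R < ‖x‖
  · rw [hc x hx]
    linarith [abs_nonneg C]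
  · have := hC x (by simpa using not_lt.1 hx)
    linarith [le_abs_self C, norm_nonneg c]

theorem pd_comp_scaled_position (ω b κ : ℝ) {ψ : Plane → ℂ} (hψ : Differentiable ℝ ψ)
    (t : ℝ) (y η : Plane) (j : Fin 2) :
    pd j (fun ζ => ψ (κ • position ω b t y ζ)) η =
      ((κ * (Real.sin (ω * t) / ω) : ℝ) : ℂ) * pd j ψ (κ • position ω b t y η) := by
  have h1 := (hasFDerivAt_position ω b t y η).const_smul κ
  have h2 := HasFDerivAt.comp η (g := ψ) (hψ (κ • position ω b t y η)).hasFDerivAt h1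
  have h3 : fderiv ℝ (fun ζ => ψ (κ • position ω b t y ζ)) η = _ := h2.fderiv
  rw [pd, h3, pd]
  simp [mul_assoc]

theorem sym_comp_scaled_position (ω b κ : ℝ) {ψ : Plane → ℂ}
    (hψ : ContDiff ℝ ((⊤ : ℕ∞) : WithTop ℕ∞) ψ) {c : ℂ} {R : ℝ}
    (hc : ∀ x : Plane, R < ‖x‖ → ψ x = c) :
    Sym (goodSet ω b) fun e η => ψ (κ • position ω b e.1 e.2 η) := by
  have hD := isOpen_goodSet ω b
  have hs : ∀ φ : Plane → ℂ, ContDiff ℝ ((⊤ : ℕ∞) : WithTop ℕ∞) φ →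
      SmoothFam (goodSet ω b) fun e η => φ (κ • position ω b e.1 e.2 η) := fun φ hφ p hp =>
    (ContDiffAt.comp (g := φ) (f := fun p : (ℝ × Plane) × Plane => κ • position ω b p.1.1 p.1.2 p.2)
      p hφ.contDiffAt ((contDiffAt_position ω b
        (Avoids.left_ne_zero hp)).const_smul κ)).contDiffWithinAt
  have hg : ∀ (φ : Plane → ℂ) (c : ℂ), ContDiff ℝ ((⊤ : ℕ∞) : WithTop ℕ∞) φ →
      (∀ x : Plane, R < ‖x‖ → φ x = c) →
      PolyGrowth (goodSet ω b) fun e η => φ (κ • position ω b e.1 e.2 η) := fun φ c hφ hc Q _ => by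
    obtain ⟨C, hC, hb⟩ := exists_bound_of_const_outside hφ.continuous hc
    exact ⟨C, 0, hC, fun e _ η _ => by simpa using hb _⟩
  refine ⟨hs ψ hψ, fun n => ?_⟩
  induction n generalizing ψ c with
  | zero => exact hg ψ c hψ hc
  | succ n ih =>
    refine ⟨hg ψ c hψ hc, fun j => ?_⟩
    have hψ' : ContDiff ℝ ((⊤ : ℕ∞) : WithTop ℕ∞) (pd j ψ) :=
      (hψ.fderiv_right (m := ((⊤ : ℕ∞) : WithTop ℕ∞)) (by simp)).clm_apply contDiff_const
    have hc' : ∀ x : Plane, R < ‖x‖ → pd j ψ x = 0 := fun x hx => by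
      rw [← pd_const j c x]
      exact pd_congr_on (isOpen_lt continuous_const continuous_norm) (fun z hz => hc z hz) j hx
    have hτ : Sym (goodSet ω b) fun (e : ℝ × Plane) _ => ((κ * (Real.sin (ω * e.1) / ω) : ℝ) : ℂ) :=
      Sym.of_param _ (contDiff_ofReal_comp (contDiff_const.mul contDiff_sin_div))
    exact (SymN.mul hD hτ.smooth (hs _ hψ') (hτ.symN n) (ih hψ' hc')).congr hD fun e η _ =>
      pd_comp_scaled_position ω b κ (hψ.differentiable (by simp)) e.1 e.2 η j

variable {θ : Plane → ℝ} {ε : ℝ}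

theorem sym_cutoff (ω b : ℝ) (hθ : ContDiff ℝ ((⊤ : ℕ∞) : WithTop ℕ∞) θ)
    (hθ_one : ∀ x : Plane, 2 < ‖x‖ → θ x = 1) :
    Sym (goodSet ω b) fun e η => (cutoff θ ε ω b e.1 e.2 η : ℂ) := by
  have hD := isOpen_goodSet ω b
  have h1 := sym_comp_scaled_position ω b ε⁻¹ (ψ := fun x => (θ x : ℂ)) (c := 1) (R := 2)
    (contDiff_ofReal_comp hθ) (fun x hx => by rw [hθ_one x hx]; simp)
  have h2 : Sym (goodSet ω b) fun (e : ℝ × Plane) _ => ((θ (ε⁻¹ • e.2) : ℝ) : ℂ) :=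
    Sym.of_param _ (contDiff_ofReal_comp (hθ.comp (contDiff_snd.const_smul ε⁻¹)))
  exact (h1.mul hD h2).congr hD fun e η _ => by simp [cutoff]

theorem cutoff_eq_zero_of_mem_nearSet {ω b : ℝ} (hε : 0 < ε)
    (hθ_zero : ∀ x : Plane, ‖x‖ < 1 → θ x = 0) {e : ℝ × Plane} {η : Plane}
    (h : (e, η) ∈ nearSet ω b ε) : cutoff θ ε ω b e.1 e.2 η = 0 := by
  have key : ∀ x : Plane, ‖x‖ < ε → θ (ε⁻¹ • x) = 0 := fun x hx => hθ_zero _ (by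
    rw [norm_smul, norm_inv, Real.norm_eq_abs, abs_of_pos hε, inv_mul_lt_iff₀ hε, mul_one]
    exact hx)
  rcases h.2 with h | h
  · rw [cutoff, key _ h, mul_zero]
  · rw [cutoff, key _ h, zero_mul]

end Cutoff

/-! ### The transport operators -/

section Transport

variable {ω b B ρ : ℝ}

/-- The Taylor coefficients at `x = x^t` of `h(x, φ_x)` are symbols: `h(x, φ_x)` is a combination,
with coefficients depending on `ξ^t - i B x^t`, of functions of `x` in the algebra generated by the
coordinates and `|x|⁻²`. -/
theorem sym_pdList_hamPhase (hρ : 0 < ρ) (J : List (Fin 2)) :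
    Sym (farSet ω b ρ) fun e η =>
      pdList J (hamPhase ω b B e.1 e.2 η) (position ω b e.1 e.2 η) := by
  have hD := isOpen_farSet ω b ρ
  let a : Fin 2 → Plane → ℂ := fun j x =>
    Complex.I * (B : ℂ) * ((x j : ℝ) : ℂ) + (-1) * ((vecPot b x j : ℝ) : ℂ)
  have ha : ∀ j, RatFn (a j) := fun j => ((RatFn.const _).mul (RatFn.coord j)).add
    ((RatFn.const _).mul (RatFn.vecPot_apply b j))
  let G : Plane → ℂ := fun x => (1 / 2) * (a 0 x * a 0 x + a 1 x * a 1 x) +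
    (ω ^ 2 / 2 : ℂ) * (((x 0 : ℝ) : ℂ) * ((x 0 : ℝ) : ℂ) + ((x 1 : ℝ) : ℂ) * ((x 1 : ℝ) : ℂ))
  have hG : RatFn G := ((RatFn.const _).mul (((ha 0).mul (ha 0)).add ((ha 1).mul (ha 1)))).add
    ((RatFn.const _).mul (((RatFn.coord 0).mul (RatFn.coord 0)).add
      ((RatFn.coord 1).mul (RatFn.coord 1))))
  -- With `g = ξ^t - iBx^t` and `φ_x = g + iBx`, `h(x, φ_x) = g·g / 2 + g·a(x) + G(x)`.
  let r : Fin 4 → Plane → ℂ := ![fun _ => 1, a 0, a 1, G]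
  have hr : ∀ i, RatFn (r i) := by
    intro i
    fin_cases i
    · exact RatFn.const 1
    · exact ha 0
    · exact ha 1
    · exact hG
  obtain ⟨r', hr', h⟩ := RatFn.exists_pdList hr J
  let g : Fin 2 → ℝ × Plane → Plane → ℂ := fun j e η =>
    ((momentum ω b e.1 e.2 η j : ℝ) : ℂ) - Complex.I * B * ((position ω b e.1 e.2 η j : ℝ) : ℂ)
  have hg : ∀ j, Sym (farSet ω b ρ) (g j) := fun j =>
    (((sym_velocity hρ j).add hD ((RatFn.vecPot_apply b j).sym_comp_position hρ)).congr hD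
      (fun e η _ => by rw [momentum_apply]; push_cast; rfl)).sub hD
      ((sym_position hρ j).const_mul hD _)
  let c : ℝ × Plane → Plane → Fin 4 → ℂ := fun e η =>
    ![(1 / 2) * (g 0 e η * g 0 e η + g 1 e η * g 1 e η), g 0 e η, g 1 e η, 1]
  have hc : ∀ i, Sym (farSet ω b ρ) fun e η => c e η i := by
    intro i
    fin_cases i
    · exact (((hg 0).mul hD (hg 0)).add hD ((hg 1).mul hD (hg 1))).const_mul hD _
    · exact hg 0
    · exact hg 1
    · exact Sym.const _ 1
  have hS := Sym.sum hD Finset.univ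
    (f := fun i e η => c e η i * r' i (position ω b e.1 e.2 η)) fun i _ =>
    (hc i).mul hD ((hr' i).sym_comp_position hρ)
  refine hS.congr hD fun e η hη => ?_
  refine h (c e η) _ (fun x _ => ?_) _ hη.1.position_ne_zero
  have hn : ((‖x‖ : ℝ) : ℂ) ^ 2 = ((x 0 : ℝ) : ℂ) ^ 2 + ((x 1 : ℝ) : ℂ) ^ 2 := by
    exact_mod_cast congrArg (fun r : ℝ => (r : ℂ)) (plane_norm_sq x)
  simp only [hamPhase, hamC, Fin.sum_univ_two, Fin.sum_univ_four, c, r, g, G, a,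
    Matrix.cons_val_zero, Matrix.cons_val_one, Matrix.cons_val, PiLp.sub_apply]
  push_cast
  rw [hn]
  ring

theorem sym_reduce {D : Set ((ℝ × Plane) × Plane)} (hD : IsOpen D) {c : ℝ × Plane → ℂ}
    (hc : ContDiff ℝ ((⊤ : ℕ∞) : WithTop ℕ∞) c)
    {W : ℝ × Plane → Plane → Matrix (Fin 2) (Fin 2) ℂ}
    (hW : ∀ j k, Sym D fun e η => W e η j k) (m : ℕ) :
    ∀ (J : List (Fin 2)) {f : ℝ × Plane → Plane → ℂ}, Sym D f →
      Sym D fun e => reduce (c e) (W e) m J (f e) := by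
  induction m with
  | zero =>
    intro J f hf
    cases J with
    | nil => simpa only [reduce] using hf
    | cons j J => simpa only [reduce] using Sym.const D 0
  | succ m ih =>
    intro J f hf
    cases J with
    | nil => simpa only [reduce] using Sym.const D 0
    | cons j J =>
      simp only [reduce]
      have h1 := ih J (f := fun e ζ => ∑ k : Fin 2, pd k (fun ζ' => W e ζ' k j * f e ζ') ζ)
        (Sym.sum hD Finset.univ (f := fun k e ζ => pd k (fun ζ' => W e ζ' k j * f e ζ') ζ)
          fun k _ => ((hW k j).mul hD hf).pd hD k)
      have h2 := Sym.sum hD Finset.univ (f := fun (l : Fin J.length) e η =>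
          reduce (c e) (W e) m (J.eraseIdx l) (fun ζ => W e ζ (J.get l) j * f e ζ) η)
        fun l _ => ih (J.eraseIdx l) (f := fun e ζ => W e ζ (J.get l) j * f e ζ)
          ((hW _ j).mul hD hf)
      exact (h1.sub hD ((Sym.of_param D hc).mul hD h2)).const_mul hD _

theorem reduce_eq_zero {D : Set ((ℝ × Plane) × Plane)} (hD : IsOpen D) (c : ℝ × Plane → ℂ)
    (W : ℝ × Plane → Plane → Matrix (Fin 2) (Fin 2) ℂ) (m : ℕ) :
    ∀ (J : List (Fin 2)) {f : ℝ × Plane → Plane → ℂ}, (∀ e η, (e, η) ∈ D → f e η = 0) →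
      ∀ e η, (e, η) ∈ D → reduce (c e) (W e) m J (f e) η = 0 := by
  induction m with
  | zero =>
    intro J f hf e η h
    cases J with
    | nil => simpa only [reduce] using hf e η h
    | cons j J => simp only [reduce]
  | succ m ih =>
    intro J f hf e η h
    cases J with
    | nil => simp only [reduce]
    | cons j J =>
      simp only [reduce]
      have h1 := ih J (f := fun e ζ => ∑ k : Fin 2, pd k (fun ζ' => W e ζ' k j * f e ζ') ζ)
        (fun e η hη => Finset.sum_eq_zero fun k _ =>
          pd_eq_zero_of_eqOn_zero hD (f := fun e ζ' => W e ζ' k j * f e ζ')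
            (fun e ζ hζ => by rw [hf e ζ hζ, mul_zero]) k e η hη) e η h
      have h2 : ∀ l : Fin J.length, reduce (c e) (W e) m (J.eraseIdx l)
          (fun ζ => W e ζ (J.get l) j * f e ζ) η = 0 := fun l =>
        ih (J.eraseIdx l) (f := fun e ζ => W e ζ (J.get l) j * f e ζ)
          (fun e ζ hζ => by rw [hf e ζ hζ, mul_zero]) e η h
      rw [h1, Finset.sum_eq_zero fun l _ => h2 l]
      simp

theorem sym_transportOp (hω : 0 < ω) (hB : 0 < B) (hρ : 0 < ρ) (m : ℕ)
    {f : ℝ × Plane → Plane → ℂ} (hf : Sym (farSet ω b ρ) f) :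
    Sym (farSet ω b ρ) fun e η => transportOp ω b B m e.1 e.2 (f e) η := by
  have hD := isOpen_farSet ω b ρ
  unfold transportOp
  refine Sym.sum hD _ fun n _ => Sym.const_mul hD (Sym.sum hD _ fun J _ => ?_) _
  exact sym_reduce hD (c := fun e => ((Real.sin (ω * e.1) / ω : ℝ) : ℂ))
    (contDiff_ofReal_comp contDiff_sin_div) (W := fun e ζ => (matZ ω b B e.1 e.2 ζ)⁻¹)
    (sym_inv_matZ hω hB hρ) m (List.ofFn J) ((sym_pdList_hamPhase hρ (List.ofFn J)).mul hD hf)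

theorem transportOp_eq_zero {D : Set ((ℝ × Plane) × Plane)} (hD : IsOpen D) (m : ℕ)
    {f : ℝ × Plane → Plane → ℂ} (hf : ∀ e η, (e, η) ∈ D → f e η = 0) :
    ∀ e η, (e, η) ∈ D → transportOp ω b B m e.1 e.2 (f e) η = 0 := fun e η h => by
  rw [transportOp]
  refine Finset.sum_eq_zero fun n _ => ?_
  rw [Finset.sum_eq_zero, mul_zero]
  intro J _
  exact reduce_eq_zero hD (fun e => ((Real.sin (ω * e.1) / ω : ℝ) : ℂ))
    (fun e ζ => (matZ ω b B e.1 e.2 ζ)⁻¹) m (List.ofFn J)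
    (f := fun e ζ => pdList (List.ofFn J) (hamPhase ω b B e.1 e.2 ζ) (position ω b e.1 e.2 ζ)
      * f e ζ) (fun e ζ hζ => by rw [hf e ζ hζ, mul_zero]) e η h

theorem transportAmp_zero (θ : Plane → ℝ) (ε ω b B t : ℝ) (y η : Plane) :
    transportAmp θ ε ω b B 0 t y η =
      (cutoff θ ε ω b t y η : ℂ) * sqrtDetZ ω b B t y η := by
  rw [transportAmp]
  rfl

theorem transportAmp_succ (θ : Plane → ℝ) (ε ω b B : ℝ) (k : ℕ) (e : ℝ × Plane) (η : Plane) :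
    transportAmp θ ε ω b B (k + 1) e.1 e.2 η =
      (cutoff θ ε ω b e.1 e.2 η : ℂ) * (sqrtDetZ ω b B e.1 e.2 η *
        timeInt (fun e η => (sqrtDetZ ω b B e.1 e.2 η)⁻¹ *
          (-Complex.I * ∑ i : Fin (k + 1),
            transportOp ω b B (i + 2) e.1 e.2 (transportAmp θ ε ω b B (k - i) e.1 e.2) η)) e η) := by
  rw [transportAmp]
  rfl

/-- The transport amplitudes are symbols which vanish near the origin. The induction step is
Duhamel's formula: the source vanishes where `x^s` is close to the origin, so it is a symbol on the
whole set of good points, and this set is star-shaped in time. -/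
theorem sym_transportAmp {θ : Plane → ℝ} {ε : ℝ} (hω : 0 < ω) (hB : 0 < B) (hε : 0 < ε)
    (hθ : ContDiff ℝ ((⊤ : ℕ∞) : WithTop ℕ∞) θ)
    (hθ_one : ∀ x : Plane, 2 < ‖x‖ → θ x = 1) (hθ_zero : ∀ x : Plane, ‖x‖ < 1 → θ x = 0) (k : ℕ) :
    Sym (goodSet ω b) (fun e η => transportAmp θ ε ω b B k e.1 e.2 η) ∧
      ∀ e η, (e, η) ∈ nearSet ω b ε → transportAmp θ ε ω b B k e.1 e.2 η = 0 := by
  have hD := isOpen_farSet ω b (ε / 2)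
  have hD₂ := isOpen_nearSet ω b ε
  have hε2 : 0 < ε / 2 := by positivity
  have hsub := goodSet_subset_far_union_near (ω := ω) (b := b) hε
  have hfar : farSet ω b (ε / 2) ⊆ goodSet ω b := inter_subset_left
  have hcut := (sym_cutoff (ε := ε) ω b hθ hθ_one).mono hfar
  have hsq := sym_sqrtDetZ (b := b) hω hB hε2
  induction k using Nat.strong_induction_on with
  | _ k ih =>
    cases k with
    | zero =>
      have hz : ∀ e η, (e, η) ∈ nearSet ω b ε → transportAmp θ ε ω b B 0 e.1 e.2 η = 0 := by
        intro e η h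
        rw [transportAmp_zero, cutoff_eq_zero_of_mem_nearSet hε hθ_zero h]
        simp
      refine ⟨Sym.glue hD₂ hD hsub ((hcut.mul hD hsq.1).congr hD fun e η _ => ?_) hz, hz⟩
      rw [transportAmp_zero]
    | succ k =>
      have hz : ∀ e η, (e, η) ∈ nearSet ω b ε →
          transportAmp θ ε ω b B (k + 1) e.1 e.2 η = 0 := by
        intro e η h
        rw [transportAmp_succ, cutoff_eq_zero_of_mem_nearSet hε hθ_zero h]
        simp
      let src : ℝ × Plane → Plane → ℂ := fun e η => (sqrtDetZ ω b B e.1 e.2 η)⁻¹ *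
        (-Complex.I * ∑ i : Fin (k + 1),
          transportOp ω b B (i + 2) e.1 e.2 (transportAmp θ ε ω b B (k - i) e.1 e.2) η)
      have hsrc_far : Sym (farSet ω b (ε / 2)) src :=
        hsq.2.mul hD (Sym.const_mul hD (Sym.sum hD Finset.univ
          (f := fun (i : Fin (k + 1)) e η => transportOp ω b B (i + 2) e.1 e.2
            (transportAmp θ ε ω b B (k - i) e.1 e.2) η) fun i _ => sym_transportOp hω hB hε2 (i + 2)
          ((ih (k - i) (by omega)).1.mono hfar)) _)
      have hsrc_zero : ∀ e η, (e, η) ∈ nearSet ω b ε → src e η = 0 := by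
        intro e η h
        simp only [src]
        rw [Finset.sum_eq_zero, mul_zero, mul_zero]
        intro i _
        exact transportOp_eq_zero hD₂ (i + 2)
          (f := fun e => transportAmp θ ε ω b B (k - i) e.1 e.2)
          (ih (k - i) (by omega)).2 e η h
      -- The integral from `0` to `t` runs through points which need not be far from the origin, so
      -- the source has to be a symbol on all of `goodSet`.
      have hsrc : Sym (goodSet ω b) src := Sym.glue hD₂ hD hsub hsrc_far hsrc_zero
      have hint := ((starTime_goodSet ω b).sym_timeInt (isOpen_goodSet ω b) hsrc).mono hfar
      refine ⟨Sym.glue hD₂ hD hsub ((hcut.mul hD (hsq.1.mul hD hint)).congr hD fun e η _ => ?_) hz,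
        hz⟩
      rw [transportAmp_succ]

theorem isAmplitude_transportAmp {θ : Plane → ℝ} {ε : ℝ} (hω : 0 < ω) (hB : 0 < B) (hε : 0 < ε)
    (hθ : ContDiff ℝ ((⊤ : ℕ∞) : WithTop ℕ∞) θ)
    (hθ_one : ∀ x : Plane, 2 < ‖x‖ → θ x = 1) (hθ_zero : ∀ x : Plane, ‖x‖ < 1 → θ x = 0) :
    IsAmplitude θ ε ω b B (transportAmp θ ε ω b B) where
  zero t y η _ := by rw [transportAmp]
  smooth k :=
    ContDiffOn.comp (g := fun p : (ℝ × Plane) × Plane => transportAmp θ ε ω b B k p.1.1 p.1.2 p.2)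
      (f := fun p : ℝ × Plane × Plane => ((p.1, p.2.1), p.2.2))
      (sym_transportAmp hω hB hε hθ hθ_one hθ_zero k).1.smooth (by fun_prop) fun _ hp => hp
  growth k Q hQ := by
    obtain ⟨C, M, -, h⟩ := (sym_transportAmp (b := b) hω hB hε hθ hθ_one hθ_zero k).1.growth Q hQ
    exact ⟨C, M, fun t y hty η hη => h (t, y) hty η hη⟩

end Transport

/-! ### The action and the phase -/

section Phase

variable {ω b B : ℝ}

theorem hasDerivAt_mul_const_time (ω t : ℝ) : HasDerivAt (fun s : ℝ => ω * s) ω t := by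
  simpa using (hasDerivAt_id t).const_mul ω

theorem hasDerivAt_position_time (hω : ω ≠ 0) (b t : ℝ) (y η : Plane) :
    HasDerivAt (fun s => position ω b s y η) (velocity ω b t y η) t := by
  have := hasDerivAt_position ω b t hω y η
  rw [(hasGradientAt_ham_momentum ω b _ _).gradient, momentum_eq, add_sub_cancel_right] at this
  exact this

theorem hasDerivAt_position_time_apply (hω : ω ≠ 0) (b t : ℝ) (y η : Plane) (j : Fin 2) :
    HasDerivAt (fun s => position ω b s y η j) (velocity ω b t y η j) t :=
  (coordL j).hasFDerivAt.comp_hasDerivAt t (hasDerivAt_position_time hω b t y η)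

theorem hasDerivAt_velocity_time_apply (hω : ω ≠ 0) (b t : ℝ) (y η : Plane) (j : Fin 2) :
    HasDerivAt (fun s => velocity ω b s y η j) (-(ω ^ 2 * position ω b t y η j)) t := by
  have hl := hasDerivAt_mul_const_time ω t
  have h := ((hl.sin.const_mul ω).neg.mul_const (y j)).add
    (hl.cos.mul_const (η j - vecPot b y j))
  have e : (fun s => velocity ω b s y η j) = _ := funext fun s => velocity_apply ω b s y η j
  rw [e]
  refine h.congr_deriv ?_
  rw [position_apply]
  field_simp
  ring

theorem hasDerivAt_vecPot_position_time (hω : ω ≠ 0) (b t : ℝ) (y η : Plane)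
    (h : position ω b t y η ≠ 0) (j : Fin 2) :
    HasDerivAt (fun s => vecPot b (position ω b s y η) j)
      (∑ k, jacA b (position ω b t y η) j k * velocity ω b t y η k) t := by
  have := (hasFDerivAt_vecPot_apply b h j).comp_hasDerivAt t (hasDerivAt_position_time hω b t y η)
  refine this.congr_deriv ?_
  simp [Fin.sum_univ_two]

/-- The Lagrangian `v · A(x) + |v|² / 2 - ω² |x|² / 2` along the trajectory. -/
noncomputable def lagrangian (ω b t : ℝ) (y η : Plane) : ℝ :=
  (∑ j, velocity ω b t y η j * vecPot b (position ω b t y η) j) +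
    (∑ j, velocity ω b t y η j ^ 2) / 2 - ω ^ 2 / 2 * ∑ j, position ω b t y η j ^ 2

theorem action_eq_integral_lagrangian (ω b t : ℝ) (y η : Plane) :
    action ω b t y η = ∫ s in (0 : ℝ)..t, lagrangian ω b s y η := by
  rw [action]
  congr 1
  funext s
  rw [(hasGradientAt_ham_momentum ω b _ _).gradient, ham, momentum_eq, add_sub_cancel_right,
    plane_norm_sq, plane_norm_sq, lagrangian]
  simp only [PiLp.inner_apply, Fin.sum_univ_two, PiLp.add_apply, RCLike.inner_apply, conj_trivial]
  ring

theorem action_eq_timeInt (ω b t : ℝ) (y η : Plane) :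
    (action ω b t y η : ℂ) = timeInt (fun e η => (lagrangian ω b e.1 e.2 η : ℂ)) (t, y) η := by
  rw [action_eq_integral_lagrangian, timeInt]
  exact intervalIntegral.integral_ofReal.symm

theorem contDiffAt_vecPot_position {p : (ℝ × Plane) × Plane} (hp : p ∈ goodSet ω b)
    {n : WithTop ℕ∞} :
    ContDiffAt ℝ n (fun p : (ℝ × Plane) × Plane => vecPot b (position ω b p.1.1 p.1.2 p.2)) p :=
  ContDiffAt.comp (g := vecPot b)
    (f := fun p : (ℝ × Plane) × Plane => position ω b p.1.1 p.1.2 p.2) p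
    (contDiffAt_vecPot b (Avoids.position_ne_zero hp))
    (contDiffAt_position ω b (Avoids.left_ne_zero hp))

theorem smoothFam_lagrangian (ω b : ℝ) :
    SmoothFam (goodSet ω b) fun e η => (lagrangian ω b e.1 e.2 η : ℂ) := by
  intro p hp
  have hy : p.1.2 ≠ 0 := Avoids.left_ne_zero hp
  have hx := contDiffAt_euclidean.1 (contDiffAt_position (n := ((⊤ : ℕ∞) : WithTop ℕ∞)) ω b hy)
  have hv := contDiffAt_euclidean.1 (contDiffAt_velocity (n := ((⊤ : ℕ∞) : WithTop ℕ∞)) ω b hy)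
  have hA := contDiffAt_euclidean.1
    (contDiffAt_vecPot_position (n := ((⊤ : ℕ∞) : WithTop ℕ∞)) hp)
  have h : ContDiffAt ℝ ((⊤ : ℕ∞) : WithTop ℕ∞)
      (fun p : (ℝ × Plane) × Plane => lagrangian ω b p.1.1 p.1.2 p.2) p := by
    unfold lagrangian
    exact ((ContDiffAt.sum fun j _ => (hv j).mul (hA j)).add
      ((ContDiffAt.sum fun j _ => (hv j).pow 2).div_const 2)).sub
      (contDiffAt_const.mul (ContDiffAt.sum fun j _ => (hx j).pow 2))
  exact (Complex.ofRealCLM.contDiff.contDiffAt.comp p h).contDiffWithinAt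

/-- The key identity behind `S_η = (sin(ω t) / ω) ξ^t`: the `η_k`-derivative of the Lagrangian is
the time derivative of `(sin(ω t) / ω) ξ^t_k`, because `A` is curl free. -/
theorem hasDerivAt_sin_mul_momentum (hω : ω ≠ 0) (b t : ℝ) (y η : Plane)
    (h : position ω b t y η ≠ 0) (k : Fin 2) :
    HasDerivAt (fun s => ((Real.sin (ω * s) / ω * momentum ω b s y η k : ℝ) : ℂ))
      (pd k (fun ζ => (lagrangian ω b t y ζ : ℂ)) η) t := by
  have hl := hasDerivAt_mul_const_time ω t
  have h1 : HasDerivAt (fun s => Real.sin (ω * s) / ω * momentum ω b s y η k) _ t :=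
    (hl.sin.div_const ω).mul ((hasDerivAt_velocity_time_apply hω b t y η k).add
      (hasDerivAt_vecPot_position_time hω b t y η h k))
  have hx := hasFDerivAt_position_apply ω b t y η
  have hv := hasFDerivAt_velocity_apply ω b t y η
  have hA := hasFDerivAt_vecPot_position ω b t y η h
  have e : (fun ζ => lagrangian ω b t y ζ) = fun ζ =>
      (∑ j, velocity ω b t y ζ j * vecPot b (position ω b t y ζ) j) +
      (∑ j, velocity ω b t y ζ j ^ 2) * (1 / 2) - ω ^ 2 / 2 * ∑ j, position ω b t y ζ j ^ 2 := by
    funext ζ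
    rw [lagrangian]
    ring
  have ha : HasFDerivAt
      (fun ζ => ∑ j, velocity ω b t y ζ j * vecPot b (position ω b t y ζ) j) _ η :=
    HasFDerivAt.fun_sum fun j _ => (hv j).mul (hA j)
  have hb : HasFDerivAt (fun ζ => ∑ j, velocity ω b t y ζ j ^ 2) _ η :=
    HasFDerivAt.fun_sum fun j _ => HasFDerivAt.pow (𝕜 := ℝ) (hv j) 2
  have hc : HasFDerivAt (fun ζ => ∑ j, position ω b t y ζ j ^ 2) _ η :=
    HasFDerivAt.fun_sum fun j _ => HasFDerivAt.pow (𝕜 := ℝ) (hx j) 2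
  have h2 : HasFDerivAt (fun ζ => lagrangian ω b t y ζ) _ η :=
    ((ha.add (hb.mul_const (1 / 2 : ℝ))).sub (hc.const_mul (ω ^ 2 / 2))).congr_of_eventuallyEq
      (Eventually.of_forall fun ζ => congrFun e ζ)
  rw [pd_ofReal_of_hasFDerivAt h2]
  refine h1.ofReal_comp.congr_deriv ?_
  congr 1
  fin_cases k
  · simp [Fin.sum_univ_two, jacA_one_zero, momentum_apply]
    field_simp
    ring
  · simp [Fin.sum_univ_two, jacA_one_zero, momentum_apply]
    field_simp
    ring

/-- The gradient of the action is `S_η = (sin(ω t) / ω) ξ^t`. -/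
theorem pd_action (hω : ω ≠ 0) {t : ℝ} {y η : Plane} (h : Avoids ω b t y η) (k : Fin 2) :
    pd k (fun ζ => (action ω b t y ζ : ℂ)) η =
      ((Real.sin (ω * t) / ω * momentum ω b t y η k : ℝ) : ℂ) := by
  have hfun : (fun ζ => (action ω b t y ζ : ℂ)) =
      timeInt (fun e η => (lagrangian ω b e.1 e.2 η : ℂ)) (t, y) :=
    funext fun ζ => action_eq_timeInt ω b t y ζ
  have hL := smoothFam_lagrangian ω b
  rw [hfun, (starTime_goodSet ω b).pd_timeInt (isOpen_goodSet ω b) hL k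
    (show ((t, y), η) ∈ goodSet ω b from h), timeInt]
  have hcont : ContinuousOn (fun s => pd k (fun ζ => (lagrangian ω b s y ζ : ℂ)) η) (uIcc 0 t) :=
    ContinuousOn.comp (g := fun p : (ℝ × Plane) × Plane =>
        pd k (fun ζ => (lagrangian ω b p.1.1 p.1.2 ζ : ℂ)) p.2)
      (f := fun s : ℝ => ((s, y), η)) (hL.pd (isOpen_goodSet ω b) k).continuousOn (by fun_prop)
      fun s hs => h.mono hs
  rw [intervalIntegral.integral_eq_sub_of_hasDerivAt
    (fun s hs => hasDerivAt_sin_mul_momentum hω b s y η (h s hs) k) hcont.intervalIntegrable]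
  simp

theorem phase_eq (ω b B t : ℝ) (x y η : Plane) :
    phase ω b B t x y η = (action ω b t y η : ℂ) +
      (∑ j, (((x j : ℝ) : ℂ) - ((position ω b t y η j : ℝ) : ℂ)) * ((momentum ω b t y η j : ℝ) : ℂ))
      + Complex.I * (B / 2) *
        ∑ j, (((x j : ℝ) : ℂ) - ((position ω b t y η j : ℝ) : ℂ)) ^ 2 := by
  rw [phase, plane_norm_sq]
  simp only [PiLp.inner_apply, Fin.sum_univ_two, PiLp.sub_apply, RCLike.inner_apply, conj_trivial]
  push_cast
  ring

/-- The points `((t, x, y), η)` such that `(t, y, η)` is good. -/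
def goodSet₃ (ω b : ℝ) : Set ((ℝ × Plane × Plane) × Plane) :=
  {p | Avoids ω b p.1.1 p.1.2.2 p.2}

theorem goodSet₃_eq (ω b : ℝ) : goodSet₃ ω b =
    (fun p : (ℝ × Plane × Plane) × Plane => ((p.1.1, p.1.2.2), p.2)) ⁻¹' goodSet ω b := rfl

theorem isOpen_goodSet₃ (ω b : ℝ) : IsOpen (goodSet₃ ω b) := by
  rw [goodSet₃_eq]
  exact (isOpen_goodSet ω b).preimage (by fun_prop)

/-- Families of functions of `(t, y, η)` as families of functions of `(t, x, y, η)`. -/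
theorem SmoothFam.to_three {f : ℝ × Plane → Plane → ℂ} (hf : SmoothFam (goodSet ω b) f) :
    SmoothFam (goodSet₃ ω b) fun e η => f (e.1, e.2.2) η :=
  ContDiffOn.comp (g := fun p : (ℝ × Plane) × Plane => f p.1 p.2)
    (f := fun p : (ℝ × Plane × Plane) × Plane => ((p.1.1, p.1.2.2), p.2)) hf (by fun_prop)
    fun _ hp => hp

theorem smoothFam_position (ω b : ℝ) (j : Fin 2) :
    SmoothFam (goodSet ω b) fun e η => ((position ω b e.1 e.2 η j : ℝ) : ℂ) := fun p hp =>
  (Complex.ofRealCLM.contDiff.contDiffAt.comp p (contDiffAt_euclidean.1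
    (contDiffAt_position ω b (Avoids.left_ne_zero hp)) j)).contDiffWithinAt

theorem smoothFam_momentum (ω b : ℝ) (j : Fin 2) :
    SmoothFam (goodSet ω b) fun e η => ((momentum ω b e.1 e.2 η j : ℝ) : ℂ) := fun p hp =>
  (Complex.ofRealCLM.contDiff.contDiffAt.comp p (contDiffAt_euclidean.1
    ((contDiffAt_velocity ω b (Avoids.left_ne_zero hp)).add
      (contDiffAt_vecPot_position hp)) j)).contDiffWithinAt

theorem smoothFam_action (ω b : ℝ) :
    SmoothFam (goodSet ω b) fun e η => (action ω b e.1 e.2 η : ℂ) :=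
  ((starTime_goodSet ω b).smooth_timeInt (isOpen_goodSet ω b) (smoothFam_lagrangian ω b)).congr'
    fun e η _ => action_eq_timeInt ω b e.1 e.2 η

theorem smoothFam_phase (ω b B : ℝ) :
    SmoothFam (goodSet₃ ω b) fun e η => phase ω b B e.1 e.2.1 e.2.2 η := by
  have hx : ∀ j : Fin 2, ContDiffOn ℝ ((⊤ : ℕ∞) : WithTop ℕ∞)
      (fun p : (ℝ × Plane × Plane) × Plane => ((p.1.2.1 j : ℝ) : ℂ)) (goodSet₃ ω b) := fun j =>
    (contDiff_ofReal_comp ((coordL j).contDiff.comp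
      (contDiff_fst.comp (contDiff_snd.comp contDiff_fst)))).contDiffOn
  have hX := fun j => (smoothFam_position ω b j).to_three
  have hM := fun j => (smoothFam_momentum ω b j).to_three
  refine SmoothFam.congr' ?_ fun e η _ => phase_eq ω b B e.1 e.2.1 e.2.2 η
  exact ((smoothFam_action ω b).to_three.add
    (ContDiffOn.sum fun j _ => ((hx j).sub (hX j)).mul (hM j))).add
    (contDiffOn_const.mul (ContDiffOn.sum fun j _ => ((hx j).sub (hX j)).pow 2))

theorem contDiffAt_phase (ω b B t : ℝ) (x : Plane) {y η : Plane} (h : Avoids ω b t y η) :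
    ContDiffAt ℝ ((⊤ : ℕ∞) : WithTop ℕ∞) (phase ω b B t x y) η :=
  ((smoothFam_phase ω b B).slice (t, x, y)).contDiffAt
    ((isOpen_sliceAt (isOpen_goodSet₃ ω b) (t, x, y)).mem_nhds h)

/-- The gradient of the phase is `Zᵀ (x - x^t)`. -/
theorem pd_phase (hω : ω ≠ 0) {t : ℝ} (x : Plane) {y η : Plane} (h : Avoids ω b t y η)
    (k : Fin 2) :
    pd k (phase ω b B t x y) η =
      ∑ j, (((x j : ℝ) : ℂ) - ((position ω b t y η j : ℝ) : ℂ)) * matZ ω b B t y η j k := by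
  have hm : ((t, y), η) ∈ goodSet ω b := h
  have hD := isOpen_goodSet ω b
  have hS := (smoothFam_action ω b).differentiableAt hD hm
  have hX := fun j => (smoothFam_position ω b j).differentiableAt hD hm
  have hM := fun j => (smoothFam_momentum ω b j).differentiableAt hD hm
  have hw : ∀ j : Fin 2, DifferentiableAt ℝ
      (fun ζ => ((x j : ℝ) : ℂ) - ((position ω b t y ζ j : ℝ) : ℂ)) η := fun j =>
    (differentiableAt_const _).fun_sub (hX j)
  have hpw : ∀ j : Fin 2, pd k (fun ζ => ((x j : ℝ) : ℂ) - ((position ω b t y ζ j : ℝ) : ℂ)) η =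
      -pd k (fun ζ => ((position ω b t y ζ j : ℝ) : ℂ)) η := fun j => by
    rw [pd_sub (differentiableAt_const _) (hX j), pd_const, zero_sub]
  have hfun : phase ω b B t x y = fun ζ => (action ω b t y ζ : ℂ) +
      (∑ j, (((x j : ℝ) : ℂ) - ((position ω b t y ζ j : ℝ) : ℂ)) * ((momentum ω b t y ζ j : ℝ) : ℂ))
      + Complex.I * (B / 2) *
        ∑ j, (((x j : ℝ) : ℂ) - ((position ω b t y ζ j : ℝ) : ℂ)) *
          (((x j : ℝ) : ℂ) - ((position ω b t y ζ j : ℝ) : ℂ)) := by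
    funext ζ
    rw [phase_eq]
    simp only [pow_two]
  have h1 : DifferentiableAt ℝ (fun ζ => ∑ j, (((x j : ℝ) : ℂ) - ((position ω b t y ζ j : ℝ) : ℂ))
      * ((momentum ω b t y ζ j : ℝ) : ℂ)) η :=
    DifferentiableAt.fun_sum fun j _ => (hw j).fun_mul (hM j)
  have h2 : DifferentiableAt ℝ (fun ζ => ∑ j, (((x j : ℝ) : ℂ) - ((position ω b t y ζ j : ℝ) : ℂ)) *
      (((x j : ℝ) : ℂ) - ((position ω b t y ζ j : ℝ) : ℂ))) η :=
    DifferentiableAt.fun_sum fun j _ => (hw j).fun_mul (hw j)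
  rw [hfun, pd_add (hS.fun_add h1) (h2.const_mul _), pd_add hS h1, pd_const_mul h2,
    pd_sum _ fun j _ => (hw j).fun_mul (hM j), pd_sum _ fun j _ => (hw j).fun_mul (hw j),
    pd_action hω h]
  simp only [pd_mul (hw _) (hM _), pd_mul (hw _) (hw _), hpw, matZ, Matrix.of_apply, pd_position,
    Fin.sum_univ_two]
  fin_cases k
  · simp
    ring
  · simp
    ring

theorem fderiv_eq_zero_iff_pd {f : Plane → ℂ} {η : Plane} :
    fderiv ℝ f η = 0 ↔ ∀ k, pd k f η = 0 := by
  constructor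
  · intro h k
    rw [pd, h]
    rfl
  · intro h
    apply ContinuousLinearMap.coe_injective
    refine (EuclideanSpace.basisFun (Fin 2) ℝ).toBasis.ext fun k => ?_
    simpa [pd] using h k

theorem position_etaStar (hω : ω ≠ 0) {t : ℝ} (ht : Real.sin (ω * t) ≠ 0) (b : ℝ) (x y : Plane) :
    position ω b t y (etaStar ω b t x y) = x := by
  rw [position, etaStar, add_sub_cancel_left, smul_smul]
  have : Real.sin (ω * t) / ω * (ω / Real.sin (ω * t)) = 1 := by field_simp
  rw [this, one_smul]
  abel

/-- `x - x^t = -(sin(ω t) / ω) (η - η_*)`. -/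
theorem sub_position_apply (hω : ω ≠ 0) {t : ℝ} (ht : Real.sin (ω * t) ≠ 0) (b : ℝ)
    (x y η : Plane) (j : Fin 2) :
    x j - position ω b t y η j = -(Real.sin (ω * t) / ω) * (η j - etaStar ω b t x y j) := by
  conv_lhs => rw [← position_etaStar hω ht b x y]
  rw [position_apply, position_apply]
  ring

/-- Since `φ_η = Zᵀ (x - x^t)` with `Z` invertible, critical points are the solutions of `x^t = x`. -/
theorem fderiv_phase_eq_zero_iff (hω : 0 < ω) (hB : 0 < B) {t : ℝ} (ht : Real.sin (ω * t) ≠ 0)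
    (x : Plane) {y η : Plane} (h : Avoids ω b t y η) :
    fderiv ℝ (phase ω b B t x y) η = 0 ↔ η = etaStar ω b t x y := by
  rw [fderiv_eq_zero_iff_pd]
  have hσ : Real.sin (ω * t) / ω ≠ 0 := div_ne_zero ht hω.ne'
  constructor
  · intro h0
    have hv : Matrix.vecMul (fun j => ((x j : ℝ) : ℂ) - ((position ω b t y η j : ℝ) : ℂ))
        (matZ ω b B t y η) = 0 := by
      funext k
      rw [Pi.zero_apply, ← h0 k, pd_phase hω.ne' x h]
      rfl
    have hw := Matrix.eq_zero_of_vecMul_eq_zero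
      (det_matZ_ne_zero hω hB b t y η h.position_ne_zero) hv
    ext j
    have hj := congrFun hw j
    rw [Pi.zero_apply, ← Complex.ofReal_sub, Complex.ofReal_eq_zero] at hj
    have hj2 : x j - position ω b t y η j = 0 := hj
    rw [sub_position_apply hω.ne' ht] at hj2
    rcases mul_eq_zero.1 hj2 with h3 | h3
    · exact absurd (neg_eq_zero.1 h3) hσ
    · linarith
  · rintro rfl k
    rw [pd_phase hω.ne' x h, position_etaStar hω.ne' ht]
    simp

theorem phase_etaStar (hω : ω ≠ 0) {t : ℝ} (ht : Real.sin (ω * t) ≠ 0) (b B : ℝ) (x y : Plane) :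
    phase ω b B t x y (etaStar ω b t x y) = (action ω b t y (etaStar ω b t x y) : ℂ) := by
  rw [phase, position_etaStar hω ht]
  simp

/-- The imaginary part of the phase is exactly quadratic, because `x^t` is affine in `η`. -/
theorem phase_im (hω : ω ≠ 0) {t : ℝ} (ht : Real.sin (ω * t) ≠ 0) (b B : ℝ) (x y η : Plane) :
    (phase ω b B t x y η).im =
      B * (Real.sin (ω * t) / ω) ^ 2 / 2 * ‖η - etaStar ω b t x y‖ ^ 2 := by
  rw [phase, plane_norm_sq, plane_norm_sq]
  simp only [PiLp.sub_apply, sub_position_apply hω ht b x y η, Complex.add_im, Complex.mul_im,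
    Complex.ofReal_im, Complex.ofReal_re, Complex.I_re, Complex.I_im]
  ring

/-- The Hessian of the phase at the critical point is `-(sin(ω t) / ω) Z`. -/
theorem phaseHess_apply (hω : ω ≠ 0) {t : ℝ} (ht : Real.sin (ω * t) ≠ 0) {x y : Plane}
    (h : Avoids ω b t y (etaStar ω b t x y)) (j k : Fin 2) :
    phaseHess ω b B t x y j k = -((Real.sin (ω * t) / ω : ℝ) : ℂ) *
      matZ ω b B t y (etaStar ω b t x y) j k := by
  rw [phaseHess, Matrix.of_apply]
  set a := etaStar ω b t x y with ha
  have hD := isOpen_goodSet ω b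
  have hm : ((t, y), a) ∈ goodSet ω b := h
  have hX := fun i => (smoothFam_position ω b i).differentiableAt hD hm
  have hZd : ∀ i, DifferentiableAt ℝ (fun ζ => matZ ω b B t y ζ i k) a := fun i => by
    have h1 := ((smoothFam_momentum ω b i).pd hD k).differentiableAt hD hm
    have h2 := ((smoothFam_position ω b i).pd hD k).differentiableAt hD hm
    exact h1.fun_sub (h2.const_mul _)
  have hw : ∀ i : Fin 2, DifferentiableAt ℝ
      (fun ζ => ((x i : ℝ) : ℂ) - ((position ω b t y ζ i : ℝ) : ℂ)) a := fun i =>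
    (differentiableAt_const _).fun_sub (hX i)
  have h1 : pd j (pd k (phase ω b B t x y)) a = pd j (fun ζ => ∑ i,
      (((x i : ℝ) : ℂ) - ((position ω b t y ζ i : ℝ) : ℂ)) * matZ ω b B t y ζ i k) a :=
    pd_congr_on (isOpen_sliceAt hD (t, y)) (fun ζ hζ => pd_phase hω x hζ k) j h
  have hpos : position ω b t y a = x := position_etaStar hω ht b x y
  rw [h1, pd_sum _ fun i _ => (hw i).fun_mul (hZd i)]
  simp only [pd_mul (hw _) (hZd _), pd_sub (differentiableAt_const _) (hX _), pd_const, pd_position,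
    hpos, sub_self, zero_mul, add_zero, zero_sub, Fin.sum_univ_two]
  fin_cases j <;> simp

theorem matZ_im {t : ℝ} {y η : Plane} (h : position ω b t y η ≠ 0) (j k : Fin 2) :
    (matZ ω b B t y η j k).im = if j = k then -(B * (Real.sin (ω * t) / ω)) else 0 := by
  rw [matZ_apply _ _ _ _ _ _ h, scalZ]
  split_ifs
  · simp only [Complex.add_im, Complex.sub_im, Complex.ofReal_re, Complex.mul_re,
      Complex.mul_im, Complex.I_re, Complex.I_im, Complex.ofReal_im]
    ring
  · simp only [Complex.add_im, Complex.ofReal_re, Complex.mul_im, Complex.ofReal_im,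
      Complex.zero_im]
    ring

/-- The remainder `φ_{≥3}` is real valued: the imaginary part of the phase is quadratic in
`η - η_*`. -/
theorem phaseGeThree_im (hω : ω ≠ 0) {t : ℝ} (ht : Real.sin (ω * t) ≠ 0) {x y : Plane}
    (h : Avoids ω b t y (etaStar ω b t x y)) (η : Plane) :
    (phaseGeThree ω b B t x y η).im = 0 := by
  have hp : position ω b t y (etaStar ω b t x y) ≠ 0 := h.position_ne_zero
  have hZ := fun j k => matZ_im (B := B) hp j k
  rw [phaseGeThree, phase_etaStar hω ht, Complex.sub_im, Complex.sub_im, phase_im hω ht,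
    plane_norm_sq]
  have h2 : ∀ z : ℂ, (z / 2).im = z.im / 2 := fun z => by
    rw [show (2 : ℂ) = ((2 : ℝ) : ℂ) by simp, Complex.div_ofReal_im]
  simp only [h2, Fin.sum_univ_two, phaseHess_apply hω ht h, Complex.add_im, Complex.mul_im,
    Complex.mul_re, Complex.ofReal_im, Complex.ofReal_re, Complex.neg_im, Complex.neg_re, hZ]
  simp
  ring

/-! ### The action at the critical point -/

/-- The part of the Lagrangian that does not depend on the vector potential is an exact derivative. -/
theorem hasDerivAt_position_dot_velocity (hω : ω ≠ 0) (b t : ℝ) (y η : Plane) :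
    HasDerivAt (fun s => (∑ j, position ω b s y η j * velocity ω b s y η j) / 2)
      ((∑ j, velocity ω b t y η j ^ 2) / 2 - ω ^ 2 / 2 * ∑ j, position ω b t y η j ^ 2) t := by
  have h := (HasDerivAt.fun_sum (u := Finset.univ) fun (j : Fin 2) _ =>
    (hasDerivAt_position_time_apply hω b t y η j).mul
      (hasDerivAt_velocity_time_apply hω b t y η j)).div_const 2
  refine h.congr_deriv ?_
  simp only [Fin.sum_univ_two]
  ring

/-- The angular velocity `(x₁ v₂ - x₂ v₁) / |x|²` of the trajectory. -/
noncomputable def angularVelocity (ω b t : ℝ) (y η : Plane) : ℝ :=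
  (position ω b t y η 0 * velocity ω b t y η 1 - position ω b t y η 1 * velocity ω b t y η 0) /
    ‖position ω b t y η‖ ^ 2

theorem lagrangian_eq (ω b t : ℝ) (y η : Plane) :
    lagrangian ω b t y η = b * angularVelocity ω b t y η +
      ((∑ j, velocity ω b t y η j ^ 2) / 2 - ω ^ 2 / 2 * ∑ j, position ω b t y η j ^ 2) := by
  rw [lagrangian, angularVelocity]
  simp only [Fin.sum_univ_two, vecPot_zero_apply, vecPot_one_apply, plane_norm_sq]
  ring

/-- The logarithmic radial velocity `x · v / |x|²` of the trajectory. -/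
noncomputable def radialVelocity (ω b t : ℝ) (y η : Plane) : ℝ :=
  (position ω b t y η 0 * velocity ω b t y η 0 + position ω b t y η 1 * velocity ω b t y η 1) /
    ‖position ω b t y η‖ ^ 2

theorem continuous_position_time (ω b : ℝ) (y η : Plane) :
    Continuous fun s => position ω b s y η := by
  unfold position
  fun_prop

theorem continuous_velocity_time (ω b : ℝ) (y η : Plane) :
    Continuous fun s => velocity ω b s y η := by
  unfold velocity
  fun_prop

theorem continuousAt_angularVelocity {r : ℝ} {y η : Plane} (h : position ω b r y η ≠ 0) :
    ContinuousAt (fun r => angularVelocity ω b r y η) r := by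
  have hpc := continuous_position_time ω b y η
  have hvc := continuous_velocity_time ω b y η
  exact ContinuousAt.div (by fun_prop) (by fun_prop) (pow_ne_zero 2 (norm_ne_zero_iff.2 h))

theorem continuousAt_radialVelocity {r : ℝ} {y η : Plane} (h : position ω b r y η ≠ 0) :
    ContinuousAt (fun r => radialVelocity ω b r y η) r := by
  have hpc := continuous_position_time ω b y η
  have hvc := continuous_velocity_time ω b y η
  exact ContinuousAt.div (by fun_prop) (by fun_prop) (pow_ne_zero 2 (norm_ne_zero_iff.2 h))

theorem hasDerivAt_integral_of_avoids {t : ℝ} {y η : Plane} (h : Avoids ω b t y η) {f : ℝ → ℝ}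
    (hf : ∀ r, position ω b r y η ≠ 0 → ContinuousAt f r) {r : ℝ} (hr : r ∈ uIcc 0 t) :
    HasDerivAt (fun s => ∫ r in (0 : ℝ)..s, f r) (f r) r := by
  have hopen : IsOpen {r | position ω b r y η ≠ 0} :=
    isOpen_compl_singleton.preimage (continuous_position_time ω b y η)
  refine intervalIntegral.integral_hasDerivAt_right ?_ ?_ (hf r (h r hr))
  · exact ContinuousOn.intervalIntegrable fun q hq =>
      (hf q (h.mono hr q hq)).continuousWithinAt
  · exact ContinuousOn.stronglyMeasurableAtFilter hopen
      (fun q hq => (hf q hq).continuousWithinAt) r (h r hr)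

/-- A trajectory avoiding the origin in polar coordinates: its polar angle is the integral of the
angular velocity. -/
theorem position_eq_polar (hω : ω ≠ 0) {t : ℝ} {y η : Plane} (h : Avoids ω b t y η) {s : ℝ}
    (hs : s ∈ uIcc 0 t) :
    position ω b s y η = ‖position ω b s y η‖ •
      !₂[Real.cos (argPlane y + ∫ r in (0 : ℝ)..s, angularVelocity ω b r y η),
        Real.sin (argPlane y + ∫ r in (0 : ℝ)..s, angularVelocity ω b r y η)] := by
  have hA : ∀ r ∈ uIcc 0 t, _ := fun r hr =>
    hasDerivAt_integral_of_avoids h (fun _ h => continuousAt_angularVelocity h) hr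
  have hR : ∀ r ∈ uIcc 0 t, _ := fun r hr =>
    hasDerivAt_integral_of_avoids h (fun _ h => continuousAt_radialVelocity h) hr
  let z : ℝ → ℂ := fun s => (position ω b s y η 0 : ℂ) + (position ω b s y η 1 : ℂ) * Complex.I
  let w : ℝ → ℂ := fun s => ((∫ r in (0 : ℝ)..s, radialVelocity ω b r y η : ℝ) : ℂ) +
    ((∫ r in (0 : ℝ)..s, angularVelocity ω b r y η : ℝ) : ℂ) * Complex.I
  have hz : ∀ r, HasDerivAt z ((velocity ω b r y η 0 : ℂ) + (velocity ω b r y η 1 : ℂ) * Complex.I) r :=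
    fun r => (hasDerivAt_position_time_apply hω b r y η 0).ofReal_comp.add
      ((hasDerivAt_position_time_apply hω b r y η 1).ofReal_comp.mul_const Complex.I)
  have hw : ∀ r ∈ uIcc 0 t, HasDerivAt w ((radialVelocity ω b r y η : ℂ) +
      (angularVelocity ω b r y η : ℂ) * Complex.I) r := fun r hr =>
    (hR r hr).ofReal_comp.add ((hA r hr).ofReal_comp.mul_const Complex.I)
  -- `z e^{-w}` is constant since `w' = z' / z`.
  have hconst : ∀ r ∈ uIcc 0 t, HasDerivAt (fun s => z s * Complex.exp (-w s)) 0 r := fun r hr => by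
    refine ((hz r).mul (hw r hr).neg.cexp).congr_deriv ?_
    have hn : ((position ω b r y η 0 : ℝ) : ℂ) ^ 2 + ((position ω b r y η 1 : ℝ) : ℂ) ^ 2 ≠ 0 :=
      complex_sq_add_sq_ne_zero (h r hr)
    have hI := Complex.I_sq
    simp only [z, radialVelocity, angularVelocity, plane_norm_sq]
    push_cast
    field_simp
    linear_combination Complex.exp ((-w) r) *
      ((position ω b r y η 1 : ℂ) ^ 2 * (velocity ω b r y η 0 : ℂ)
        - (position ω b r y η 0 : ℂ) * (position ω b r y η 1 : ℂ) * (velocity ω b r y η 1 : ℂ)) * hI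
  have hzs : z s * Complex.exp (-w s) = z 0 * Complex.exp (-w 0) := by
    have := (convex_uIcc (0 : ℝ) t).norm_image_sub_le_of_norm_hasDerivWithin_le (C := 0)
      (f := fun s => z s * Complex.exp (-w s)) (f' := fun _ => 0)
      (fun r hr => (hconst r hr).hasDerivWithinAt) (by simp) left_mem_uIcc hs
    rw [zero_mul] at this
    exact sub_eq_zero.1 (norm_le_zero_iff.1 this)
  have hw0 : w 0 = 0 := by simp [w]
  have hz0 : z 0 = (‖y‖ : ℂ) * Complex.exp ((argPlane y : ℂ) * Complex.I) := by
    have h1 := Complex.norm_mul_exp_arg_mul_I (⟨y 0, y 1⟩ : ℂ)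
    have h2 : ‖(⟨y 0, y 1⟩ : ℂ)‖ = ‖y‖ := by
      rw [Complex.norm_def, Complex.normSq_mk, EuclideanSpace.norm_eq]
      simp [Fin.sum_univ_two, pow_two]
    rw [h2] at h1
    rw [argPlane, h1]
    simp only [z, position_zero]
    exact (Complex.mk_eq_add_mul_I _ _).symm
  have hzs' : z s = (‖y‖ * Real.exp (∫ r in (0 : ℝ)..s, radialVelocity ω b r y η) : ℝ) *
      Complex.exp (((argPlane y + ∫ r in (0 : ℝ)..s, angularVelocity ω b r y η : ℝ) : ℂ)
        * Complex.I) := by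
    have h1 : z s = z 0 * Complex.exp (w s) := by
      rw [hw0, neg_zero, Complex.exp_zero, mul_one, Complex.exp_neg] at hzs
      rw [← hzs]
      field_simp
    rw [h1, hz0]
    simp only [w]
    rw [Complex.exp_add]
    push_cast
    rw [add_mul, Complex.exp_add]
    ring
  set ρ := ‖y‖ * Real.exp (∫ r in (0 : ℝ)..s, radialVelocity ω b r y η) with hρ
  set φ := argPlane y + ∫ r in (0 : ℝ)..s, angularVelocity ω b r y η with hφ
  have hρ0 : 0 ≤ ρ := by positivity
  clear_value ρ
  have hre : position ω b s y η 0 = ρ * Real.cos φ := by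
    have := congrArg Complex.re hzs'
    simpa [z, Complex.exp_ofReal_mul_I_re, Complex.exp_ofReal_mul_I_im] using this
  have him : position ω b s y η 1 = ρ * Real.sin φ := by
    have := congrArg Complex.im hzs'
    simpa [z, Complex.exp_ofReal_mul_I_re, Complex.exp_ofReal_mul_I_im] using this
  have hn : ‖position ω b s y η‖ = ρ := by
    rw [← Real.sqrt_sq (norm_nonneg _), plane_norm_sq, hre, him, mul_pow, mul_pow, ← mul_add,
      Real.cos_sq_add_sin_sq, mul_one, Real.sqrt_sq hρ0]
  rw [hn]
  ext j
  fin_cases j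
  · simpa using hre
  · simpa using him

/-- The angle swept by the trajectory is determined by its ends up to a multiple of `2π`. -/
theorem exists_int_arg_sub_arg (hω : ω ≠ 0) {t : ℝ} {y η : Plane} (h : Avoids ω b t y η) :
    ∃ l : ℤ, ∫ r in (0 : ℝ)..t, angularVelocity ω b r y η =
      argPlane (position ω b t y η) - argPlane y + 2 * l * Real.pi := by
  have hpol := position_eq_polar hω h (right_mem_uIcc : t ∈ uIcc 0 t)
  set x := position ω b t y η with hx
  set φ := argPlane y + ∫ r in (0 : ℝ)..t, angularVelocity ω b r y η with hφ
  have hn : ‖x‖ ≠ 0 := norm_ne_zero_iff.2 h.position_ne_zero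
  have h0 : x 0 = ‖x‖ * Real.cos φ := by simpa using congrArg (fun z : Plane => z 0) hpol
  have h1 : x 1 = ‖x‖ * Real.sin φ := by simpa using congrArg (fun z : Plane => z 1) hpol
  have h2 : ‖(⟨x 0, x 1⟩ : ℂ)‖ = ‖x‖ := by
    rw [Complex.norm_def, Complex.normSq_mk, EuclideanSpace.norm_eq]
    simp [Fin.sum_univ_two, pow_two]
  have hz : (⟨x 0, x 1⟩ : ℂ) ≠ 0 := by
    rw [← norm_ne_zero_iff, h2]
    exact hn
  have hc : Real.cos φ = Real.cos (argPlane x) := by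
    rw [argPlane, Complex.cos_arg hz, h2, h0]
    field_simp
  have hs : Real.sin φ = Real.sin (argPlane x) := by
    rw [argPlane, Complex.sin_arg, h2, h1]
    field_simp
  obtain ⟨l, hl⟩ := Real.Angle.angle_eq_iff_two_pi_dvd_sub.1 (Real.Angle.cos_sin_inj hc hs)
  exact ⟨l, by linarith⟩

/-- The action is `b` times the angle swept by the trajectory plus a boundary term. -/
theorem action_eq_angular (hω : ω ≠ 0) {t : ℝ} {y η : Plane} (h : Avoids ω b t y η) :
    action ω b t y η = b * (∫ r in (0 : ℝ)..t, angularVelocity ω b r y η) +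
      ((∑ j, position ω b t y η j * velocity ω b t y η j) / 2 -
        (∑ j, y j * (η j - vecPot b y j)) / 2) := by
  have hpc := continuous_position_time ω b y η
  have hvc := continuous_velocity_time ω b y η
  have hint : IntervalIntegrable (fun s => (∑ j, velocity ω b s y η j ^ 2) / 2 -
      ω ^ 2 / 2 * ∑ j, position ω b s y η j ^ 2) volume 0 t :=
    Continuous.intervalIntegrable (by fun_prop) _ _
  have hang : IntervalIntegrable (fun s => angularVelocity ω b s y η) volume 0 t :=
    ContinuousOn.intervalIntegrable fun r hr =>
      (continuousAt_angularVelocity (h r hr)).continuousWithinAt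
  rw [action_eq_integral_lagrangian]
  simp only [lagrangian_eq]
  rw [intervalIntegral.integral_add (hang.const_mul b) hint,
    intervalIntegral.integral_const_mul,
    intervalIntegral.integral_eq_sub_of_hasDerivAt
      (fun s _ => hasDerivAt_position_dot_velocity hω b s y η) hint]
  simp [position_zero, velocity_apply]

/-- The action at the critical point: a Mehler term and `b` times the increment of the polar
angle. -/
theorem exists_angleLift_action (hω : 0 < ω) {t : ℝ} (ht : Real.sin (ω * t) ≠ 0) {x y : Plane}
    (h : Avoids ω b t y (etaStar ω b t x y)) :
    ∃ (ϑ : ℝ → ℝ) (l : ℤ), IsAngleLift ω b t y (etaStar ω b t x y) ϑ ∧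
      ϑ t - ϑ 0 = argPlane x - argPlane y + 2 * l * Real.pi ∧
      action ω b t y (etaStar ω b t x y) =
        ω / (2 * Real.sin (ω * t)) *
            (Real.cos (ω * t) * (‖x‖ ^ 2 + ‖y‖ ^ 2) - 2 * inner ℝ x y)
          + b * (argPlane x - argPlane y + 2 * l * Real.pi) := by
  obtain ⟨l, hl⟩ := exists_int_arg_sub_arg hω.ne' h
  have hp := position_etaStar hω.ne' ht b x y
  have hact := action_eq_angular hω.ne' h
  rw [hl, hp] at hact
  rw [hp] at hl
  refine ⟨fun s => argPlane y + ∫ r in (0 : ℝ)..s,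
    angularVelocity ω b r y (etaStar ω b t x y), l, ⟨fun s hs => ?_, fun s hs => ?_⟩, ?_, ?_⟩
  · exact ((hasDerivAt_integral_of_avoids h (fun _ h => continuousAt_angularVelocity h)
      hs).continuousAt.const_add _).continuousWithinAt
  · exact position_eq_polar hω.ne' h hs
  · rw [← hl]
    simp
  · rw [hact, add_comm]
    congr 1
    have hs2 := Real.sin_sq_add_cos_sq (ω * t)
    have hη : ∀ j, etaStar ω b t x y j - vecPot b y j =
        ω / Real.sin (ω * t) * (x j - Real.cos (ω * t) * y j) := fun j => by simp [etaStar]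
    rw [plane_norm_sq, plane_norm_sq]
    simp only [PiLp.inner_apply, Fin.sum_univ_two, RCLike.inner_apply, conj_trivial,
      velocity_apply, hη]
    field_simp
    linear_combination (-(x 0 * y 0) - x 1 * y 1) * hs2

end Phase

/-! ### Taylor polynomials -/

/-- The homogeneous part of degree `d` of the Taylor polynomial of `g` at `a`, as a function of the
increment `ζ`. It is defined through Euler's identity
`(d + 1) P_{d+1}[g](ζ) = ∑_j ζ_j P_d[∂_j g](ζ)`. -/
noncomputable def taylorHom : ℕ → (Plane → ℂ) → Plane → Plane → ℂ
  | 0, g, a, _ => g a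
  | d + 1, g, a, ζ => ((d : ℂ) + 1)⁻¹ * ∑ j, ((ζ j : ℝ) : ℂ) * taylorHom d (pd j g) a ζ

/-- The derivatives of order at most `n` are bounded by `C` on the set `S`. -/
def DerivBound (S : Set Plane) (C : ℝ) : ℕ → (Plane → ℂ) → Prop
  | 0, g => ∀ z ∈ S, ‖g z‖ ≤ C
  | n + 1, g => (∀ z ∈ S, ‖g z‖ ≤ C) ∧ ∀ j, DerivBound S C n (pd j g)

/-- `g` vanishes at `a` with its derivatives of order less than `n`. -/
def VanishTo (a : Plane) : ℕ → (Plane → ℂ) → Prop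
  | 0, _ => True
  | n + 1, g => g a = 0 ∧ ∀ j, VanishTo a n (pd j g)

/-- Smooth complex valued functions on a subset of the plane. -/
abbrev SmoothOn (U : Set Plane) (g : Plane → ℂ) : Prop :=
  ContDiffOn ℝ ((⊤ : ℕ∞) : WithTop ℕ∞) g U

section Taylor

variable {U : Set Plane} {a : Plane}

theorem SmoothOn.differentiableAt (hU : IsOpen U) {g : Plane → ℂ} (hg : SmoothOn U g) {z : Plane}
    (hz : z ∈ U) : DifferentiableAt ℝ g z :=
  (ContDiffOn.contDiffAt hg (hU.mem_nhds hz)).differentiableAt (by simp)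

theorem SmoothOn.pd (hU : IsOpen U) {g : Plane → ℂ} (hg : SmoothOn U g) (j : Fin 2) :
    SmoothOn U (pd j g) :=
  (ContDiffOn.fderiv_of_isOpen hg hU (by simp)).clm_apply contDiffOn_const

theorem SmoothOn.quadD (hU : IsOpen U) (M : Matrix (Fin 2) (Fin 2) ℂ) {g : Plane → ℂ}
    (hg : SmoothOn U g) : SmoothOn U (quadD M g) :=
  ContDiffOn.sum fun j _ => ContDiffOn.sum fun k _ => contDiffOn_const.mul
    (contDiffOn_const.mul
      (SmoothOn.pd hU (contDiffOn_const.mul (SmoothOn.pd hU hg k)) j))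

theorem quadD_eq (hU : IsOpen U) (M : Matrix (Fin 2) (Fin 2) ℂ) {g : Plane → ℂ}
    (hg : SmoothOn U g) {z : Plane} (hz : z ∈ U) :
    quadD M g z = ∑ j, ∑ k, -M j k * pd j (pd k g) z := by
  rw [quadD]
  refine Finset.sum_congr rfl fun j _ => Finset.sum_congr rfl fun k _ => ?_
  rw [pd_const_mul ((SmoothOn.pd hU hg k).differentiableAt hU hz)]
  linear_combination (M j k * AharonovBohm.pd j (AharonovBohm.pd k g) z) * Complex.I_sq

theorem taylorHom_congr (hU : IsOpen U) (ha : a ∈ U) (d : ℕ) :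
    ∀ {f g : Plane → ℂ}, EqOn f g U → taylorHom d f a = taylorHom d g a := by
  induction d with
  | zero =>
    intro f g h
    funext ζ
    exact h ha
  | succ d ih =>
    intro f g h
    funext ζ
    rw [taylorHom, taylorHom]
    simp only [ih (pd_congr_on hU h _)]

theorem taylorHom_add (hU : IsOpen U) (ha : a ∈ U) (d : ℕ) :
    ∀ {f g : Plane → ℂ}, SmoothOn U f → SmoothOn U g → ∀ ζ,
      taylorHom d (fun z => f z + g z) a ζ = taylorHom d f a ζ + taylorHom d g a ζ := by
  induction d with
  | zero => exact fun _ _ ζ => rfl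
  | succ d ih =>
    intro f g hf hg ζ
    have h : ∀ j, taylorHom d (pd j fun z => f z + g z) a ζ =
        taylorHom d (pd j f) a ζ + taylorHom d (pd j g) a ζ := fun j => by
      rw [taylorHom_congr hU ha d (g := fun z => pd j f z + pd j g z) fun z hz =>
        pd_add (hf.differentiableAt hU hz) (hg.differentiableAt hU hz) j]
      exact ih (hf.pd hU j) (hg.pd hU j) ζ
    simp only [taylorHom, h, mul_add, Finset.sum_add_distrib]

theorem taylorHom_const_mul (hU : IsOpen U) (ha : a ∈ U) (c : ℂ) (d : ℕ) :
    ∀ {f : Plane → ℂ}, SmoothOn U f → ∀ ζ,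
      taylorHom d (fun z => c * f z) a ζ = c * taylorHom d f a ζ := by
  induction d with
  | zero => exact fun _ ζ => rfl
  | succ d ih =>
    intro f hf ζ
    have h : ∀ j, taylorHom d (pd j fun z => c * f z) a ζ = c * taylorHom d (pd j f) a ζ :=
      fun j => by
        rw [taylorHom_congr hU ha d (g := fun z => c * pd j f z) fun z hz =>
          pd_const_mul (hf.differentiableAt hU hz) c j]
        exact ih (hf.pd hU j) ζ
    simp only [taylorHom, h, Fin.sum_univ_two]
    ring

theorem taylorHom_sum (hU : IsOpen U) (ha : a ∈ U) (d : ℕ) {ι : Type*} (s : Finset ι)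
    {f : ι → Plane → ℂ} (hf : ∀ i ∈ s, SmoothOn U (f i)) (ζ : Plane) :
    taylorHom d (fun z => ∑ i ∈ s, f i z) a ζ = ∑ i ∈ s, taylorHom d (f i) a ζ := by
  classical
  induction s using Finset.induction_on with
  | empty =>
    have h := taylorHom_const_mul (a := a) isOpen_univ (mem_univ a) 0 d (f := fun _ => 0)
      contDiffOn_const ζ
    simpa using h
  | insert i s hi ih =>
    rw [Finset.sum_insert hi, ← ih fun k hk => hf k (Finset.mem_insert_of_mem hk),
      ← taylorHom_add hU ha d (hf i (Finset.mem_insert_self i s))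
        (ContDiffOn.sum fun k hk => hf k (Finset.mem_insert_of_mem hk))]
    simp only [Finset.sum_insert hi]

theorem contDiff_taylorHom (d : ℕ) (g : Plane → ℂ) (a : Plane) {n : WithTop ℕ∞} :
    ContDiff ℝ n (taylorHom d g a) := by
  induction d generalizing g with
  | zero => exact contDiff_const
  | succ d ih =>
    exact contDiff_const.mul (ContDiff.sum fun j _ => (contDiff_coord_complex j).mul (ih _))

theorem differentiableAt_taylorHom (d : ℕ) (g : Plane → ℂ) (a ζ : Plane) :
    DifferentiableAt ℝ (taylorHom d g a) ζ :=
  (contDiff_taylorHom d g a (n := 1)).differentiable (by simp) ζ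

/-- Differentiation of Taylor polynomials. -/
theorem pd_taylorHom_succ (hU : IsOpen U) (ha : a ∈ U) (k : Fin 2) (d : ℕ) :
    ∀ {g : Plane → ℂ}, SmoothOn U g → ∀ ζ,
      pd k (taylorHom (d + 1) g a) ζ = taylorHom d (pd k g) a ζ := by
  have hc : ∀ (j : Fin 2) (ζ : Plane), DifferentiableAt ℝ (fun x : Plane => ((x j : ℝ) : ℂ)) ζ :=
    fun j ζ => (contDiff_coord_complex j (n := 1)).differentiable (by simp) ζ
  have hstep : ∀ (d : ℕ) (g : Plane → ℂ) (ζ : Plane), pd k (taylorHom (d + 1) g a) ζ =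
      ((d : ℂ) + 1)⁻¹ * ∑ j, ((if j = k then 1 else 0) * taylorHom d (pd j g) a ζ +
        ((ζ j : ℝ) : ℂ) * pd k (taylorHom d (pd j g) a) ζ) := by
    intro d g ζ
    have hp : ∀ j ∈ Finset.univ, DifferentiableAt ℝ
        (fun ζ : Plane => ((ζ j : ℝ) : ℂ) * taylorHom d (pd j g) a ζ) ζ := fun j _ =>
      (hc j ζ).fun_mul (differentiableAt_taylorHom d _ a ζ)
    have h0 : taylorHom (d + 1) g a = fun ζ => ((d : ℂ) + 1)⁻¹ *
      ∑ j, ((ζ j : ℝ) : ℂ) * taylorHom d (pd j g) a ζ := rfl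
    rw [h0, pd_const_mul (DifferentiableAt.fun_sum hp), pd_sum _ hp]
    simp only [pd_mul (hc _ ζ) (differentiableAt_taylorHom d _ a ζ), pd_coord]
  induction d with
  | zero =>
    intro g hg ζ
    have h0 : ∀ j, pd k (taylorHom 0 (pd j g) a) ζ = 0 := fun j => pd_const k (pd j g a) ζ
    rw [hstep]
    simp only [h0, Fin.sum_univ_two]
    fin_cases k <;> simp [taylorHom]
  | succ d ih =>
    intro g hg ζ
    have hcomm : ∀ j, taylorHom d (pd k (pd j g)) a ζ = taylorHom d (pd j (pd k g)) a ζ := fun j =>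
      congrFun (taylorHom_congr hU ha d fun z hz => pd_comm hU hg hz k j) ζ
    have heuler : ∑ j, ((ζ j : ℝ) : ℂ) * taylorHom d (pd j (pd k g)) a ζ =
        ((d : ℂ) + 1) * taylorHom (d + 1) (pd k g) a ζ := by
      rw [taylorHom, mul_inv_cancel_left₀ (by exact_mod_cast Nat.succ_ne_zero d)]
    rw [hstep]
    simp only [ih (hg.pd hU _), hcomm, Finset.sum_add_distrib, heuler]
    have h2 : ∑ j, (if j = k then (1 : ℂ) else 0) * taylorHom (d + 1) (pd j g) a ζ =
        taylorHom (d + 1) (pd k g) a ζ := by simp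
    rw [h2]
    have h3 : (((d + 1 : ℕ) : ℂ) + 1) ≠ 0 := by exact_mod_cast Nat.succ_ne_zero (d + 1)
    field_simp
    push_cast
    ring

theorem DerivBound.zero {S : Set Plane} {C : ℝ} {n : ℕ} {g : Plane → ℂ}
    (h : DerivBound S C n g) : ∀ z ∈ S, ‖g z‖ ≤ C := by
  cases n with
  | zero => exact h
  | succ n => exact h.1

theorem DerivBound.mono {S : Set Plane} {C C' : ℝ} (hC : C ≤ C') {n : ℕ} {g : Plane → ℂ}
    (h : DerivBound S C n g) : DerivBound S C' n g := by
  induction n generalizing g with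
  | zero => exact fun z hz => (h z hz).trans hC
  | succ n ih => exact ⟨fun z hz => (h.1 z hz).trans hC, fun j => ih (h.2 j)⟩

theorem DerivBound.le {S : Set Plane} {C : ℝ} {m n : ℕ} (hmn : m ≤ n) {g : Plane → ℂ}
    (h : DerivBound S C n g) : DerivBound S C m g := by
  induction n generalizing g m with
  | zero =>
    obtain rfl : m = 0 := by omega
    exact h
  | succ n ih =>
    cases m with
    | zero => exact h.1
    | succ m => exact ⟨h.1, fun j => ih (by omega) (h.2 j)⟩

theorem norm_sum_coord_mul_le (ζ : Plane) {f : Fin 2 → ℂ} {M : ℝ} (hf : ∀ j, ‖f j‖ ≤ M) :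
    ‖∑ j, ((ζ j : ℝ) : ℂ) * f j‖ ≤ 2 * ‖ζ‖ * M := by
  have h : ∀ j, ‖((ζ j : ℝ) : ℂ) * f j‖ ≤ ‖ζ‖ * M := fun j => by
    rw [norm_mul, Complex.norm_real]
    exact mul_le_mul (PiLp.norm_apply_le ζ j) (hf j) (norm_nonneg _) (norm_nonneg _)
  rw [Fin.sum_univ_two]
  refine (norm_add_le _ _).trans ?_
  linarith [h 0, h 1]

theorem norm_taylorHom_le {S : Set Plane} (ha : a ∈ S) {C : ℝ} (d : ℕ) :
    ∀ {g : Plane → ℂ}, DerivBound S C d g → ∀ ζ, ‖taylorHom d g a ζ‖ ≤ C * 2 ^ d * ‖ζ‖ ^ d := by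
  induction d with
  | zero =>
    intro g hg ζ
    simpa [taylorHom] using hg a ha
  | succ d ih =>
    intro g hg ζ
    rw [taylorHom, norm_mul]
    have h1 : ‖((d : ℂ) + 1)⁻¹‖ ≤ 1 := by
      rw [norm_inv]
      apply inv_le_one_of_one_le₀
      have : ((d : ℂ) + 1) = ((d + 1 : ℕ) : ℂ) := by push_cast; rfl
      rw [this, Complex.norm_natCast]
      exact_mod_cast Nat.succ_le_succ (Nat.zero_le d)
    have h2 := norm_sum_coord_mul_le ζ (f := fun j => taylorHom d (pd j g) a ζ)
      fun j => ih (hg.2 j) ζ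
    calc _ ≤ 1 * (2 * ‖ζ‖ * (C * 2 ^ d * ‖ζ‖ ^ d)) :=
          mul_le_mul h1 h2 (norm_nonneg _) zero_le_one
      _ = _ := by ring

theorem norm_fderiv_le_of_pd {f : Plane → ℂ} {z : Plane} {M : ℝ} (h : ∀ k, ‖pd k f z‖ ≤ M) :
    ‖fderiv ℝ f z‖ ≤ 2 * M := by
  have hM : 0 ≤ M := (norm_nonneg _).trans (h 0)
  refine ContinuousLinearMap.opNorm_le_bound _ (by positivity) fun v => ?_
  have hv : v = ∑ k, v k • stdVec k := by
    ext i
    fin_cases i <;> simp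
  have h2 : fderiv ℝ f z v = ∑ k, ((v k : ℝ) : ℂ) * pd k f z := by
    conv_lhs => rw [hv]
    simp [pd]
  rw [h2]
  refine (norm_sum_coord_mul_le v h).trans (le_of_eq ?_)
  ring

/-- Taylor's formula with a remainder bounded by the derivatives. -/
theorem norm_taylor_remainder_le (hU : IsOpen U) {δ : ℝ} (hδ : 0 ≤ δ)
    (hS : Metric.closedBall a δ ⊆ U) {C : ℝ} (n : ℕ) :
    ∀ {g : Plane → ℂ}, SmoothOn U g → DerivBound (Metric.closedBall a δ) C n g →
      ∀ ζ, ‖ζ‖ ≤ δ → ‖g (a + ζ) - ∑ d ∈ Finset.range n, taylorHom d g a ζ‖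
        ≤ C * 2 ^ n * ‖ζ‖ ^ n := by
  have ha : a ∈ U := hS (Metric.mem_closedBall_self hδ)
  have hmem : ∀ ζ : Plane, ‖ζ‖ ≤ δ → a + ζ ∈ Metric.closedBall a δ := fun ζ hζ => by simpa using hζ
  induction n with
  | zero =>
    intro g _ hb ζ hζ
    simpa using hb _ (hmem ζ hζ)
  | succ n ih =>
    intro g hg hb ζ hζ
    let R : Plane → ℂ := fun ζ => g (a + ζ) - ∑ d ∈ Finset.range (n + 1), taylorHom d g a ζ
    have hshift : ∀ z : Plane, ‖z‖ ≤ δ → HasFDerivAt (fun ζ => g (a + ζ)) (fderiv ℝ g (a + z)) z :=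
      fun z hz => by
        have h1 := (hg.differentiableAt hU (hS (hmem z hz))).hasFDerivAt
        have h2 := HasFDerivAt.comp (𝕜 := ℝ) z (g := g) h1 ((hasFDerivAt_id z).const_add a)
        exact h2
    have hsum : ∀ z : Plane, DifferentiableAt ℝ
        (fun ζ => ∑ d ∈ Finset.range (n + 1), taylorHom d g a ζ) z := fun z =>
      DifferentiableAt.fun_sum fun d _ => differentiableAt_taylorHom d g a z
    have hdiff : ∀ z : Plane, ‖z‖ ≤ δ → DifferentiableAt ℝ R z := fun z hz =>
      (hshift z hz).differentiableAt.fun_sub (hsum z)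
    have hpd : ∀ z : Plane, ‖z‖ ≤ δ → ∀ k, pd k R z =
        pd k g (a + z) - ∑ d ∈ Finset.range n, taylorHom d (pd k g) a z := fun z hz k => by
      have h1 : pd k (fun ζ => g (a + ζ)) z = pd k g (a + z) := by
        rw [pd, (hshift z hz).fderiv]
        rfl
      have h0 : pd k (taylorHom 0 g a) z = 0 := pd_const k (g a) z
      rw [pd_sub (hshift z hz).differentiableAt (hsum z), h1,
        pd_sum _ fun d _ => differentiableAt_taylorHom d g a z, Finset.sum_range_succ', h0, add_zero]
      simp only [pd_taylorHom_succ hU ha k _ hg]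
    have hR0 : R 0 = 0 := by
      simp only [R]
      rw [Finset.sum_range_succ']
      simp [taylorHom]
    -- The derivatives of the remainder are the remainders of the derivatives.
    have hbound : ∀ z ∈ Metric.closedBall (0 : Plane) ‖ζ‖, ‖fderiv ℝ R z‖ ≤
        2 * (C * 2 ^ n * ‖ζ‖ ^ n) := fun z hz => by
      rw [mem_closedBall_zero_iff] at hz
      refine norm_fderiv_le_of_pd fun k => ?_
      rw [hpd z (hz.trans hζ)]
      have hC : 0 ≤ C := (norm_nonneg _).trans (hb.1 a (Metric.mem_closedBall_self hδ))
      refine (ih (hg.pd hU k) (hb.2 k) z (hz.trans hζ)).trans ?_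
      gcongr
    have := (convex_closedBall (0 : Plane) ‖ζ‖).norm_image_sub_le_of_norm_fderiv_le
      (f := R) (x := 0) (y := ζ) (fun z hz => hdiff z
        ((mem_closedBall_zero_iff.1 hz).trans hζ)) hbound (by simp) (by simp)
    rw [hR0, sub_zero, sub_zero] at this
    refine this.trans (le_of_eq ?_)
    ring

theorem VanishTo.pred {n : ℕ} {g : Plane → ℂ} (h : VanishTo a (n + 1) g) : VanishTo a n g := by
  induction n generalizing g with
  | zero => trivial
  | succ n ih => exact ⟨h.1, fun j => ih (h.2 j)⟩

theorem VanishTo.congr (hU : IsOpen U) (ha : a ∈ U) {n : ℕ} {f g : Plane → ℂ}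
    (h : VanishTo a n f) (hfg : EqOn g f U) : VanishTo a n g := by
  induction n generalizing f g with
  | zero => trivial
  | succ n ih => exact ⟨(hfg ha).trans h.1, fun j => ih (h.2 j) (pd_congr_on hU hfg j)⟩

theorem VanishTo.add (hU : IsOpen U) (ha : a ∈ U) {n : ℕ} {f g : Plane → ℂ}
    (hfs : SmoothOn U f) (hgs : SmoothOn U g) (hf : VanishTo a n f) (hg : VanishTo a n g) :
    VanishTo a n fun z => f z + g z := by
  induction n generalizing f g with
  | zero => trivial
  | succ n ih =>
    refine ⟨by simp [hf.1, hg.1], fun j => ?_⟩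
    exact (ih (hfs.pd hU j) (hgs.pd hU j) (hf.2 j) (hg.2 j)).congr hU ha fun z hz =>
      pd_add (hfs.differentiableAt hU hz) (hgs.differentiableAt hU hz) j

theorem VanishTo.mul (hU : IsOpen U) (ha : a ∈ U) : ∀ {N m n : ℕ}, m + n = N →
    ∀ {f g : Plane → ℂ}, SmoothOn U f → SmoothOn U g → VanishTo a m f → VanishTo a n g →
      VanishTo a (m + n) fun z => f z * g z := by
  intro N
  induction N with
  | zero =>
    intro m n h f g _ _ _ _
    rw [h]
    trivial
  | succ N ih =>
    intro m n h f g hfs hgs hf hg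
    have h0 : f a * g a = 0 := by
      cases m with
      | zero =>
        cases n with
        | zero => omega
        | succ n => rw [hg.1, mul_zero]
      | succ m => rw [hf.1, zero_mul]
    have hL : ∀ j, VanishTo a N fun z => pd j f z * g z := fun j => by
      cases m with
      | zero =>
        obtain rfl : n = N + 1 := by omega
        have := ih (m := 0) (n := N) (by omega) (hfs.pd hU j) hgs trivial hg.pred
        rwa [Nat.zero_add] at this
      | succ m =>
        have := ih (m := m) (n := n) (by omega) (hfs.pd hU j) hgs (hf.2 j) hg
        rwa [show m + n = N by omega] at this
    have hRt : ∀ j, VanishTo a N fun z => f z * pd j g z := fun j => by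
      cases n with
      | zero =>
        obtain rfl : m = N + 1 := by omega
        have := ih (m := N) (n := 0) (by omega) hfs (hgs.pd hU j) hf.pred trivial
        rwa [Nat.add_zero] at this
      | succ n =>
        have := ih (m := m) (n := n) (by omega) hfs (hgs.pd hU j) hf (hg.2 j)
        rwa [show m + n = N by omega] at this
    rw [h]
    refine ⟨h0, fun j => ?_⟩
    exact (VanishTo.add hU ha ((SmoothOn.pd hU hfs j).mul hgs) (hfs.mul (SmoothOn.pd hU hgs j))
      (hL j) (hRt j)).congr hU ha fun z hz =>
        pd_mul (hfs.differentiableAt hU hz) (hgs.differentiableAt hU hz) j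

theorem VanishTo.pow (hU : IsOpen U) (ha : a ∈ U) {n : ℕ} {f : Plane → ℂ} (hfs : SmoothOn U f)
    (hf : VanishTo a n f) (μ : ℕ) : VanishTo a (n * μ) fun z => f z ^ μ := by
  induction μ with
  | zero => trivial
  | succ μ ih =>
    rw [Nat.mul_succ]
    exact (VanishTo.mul hU ha rfl (ContDiffOn.pow hfs μ) hfs ih hf).congr hU ha
      fun z _ => pow_succ _ _

theorem VanishTo.taylorHom_eq_zero {n : ℕ} {g : Plane → ℂ} (h : VanishTo a n g) {d : ℕ}
    (hd : d < n) (ζ : Plane) : taylorHom d g a ζ = 0 := by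
  induction d generalizing n g with
  | zero =>
    cases n with
    | zero => omega
    | succ n => exact h.1
  | succ d ih =>
    cases n with
    | zero => omega
    | succ n =>
      rw [taylorHom, Finset.sum_eq_zero, mul_zero]
      intro j _
      rw [ih (h.2 j) (by omega), mul_zero]

theorem VanishTo.quadD (hU : IsOpen U) (ha : a ∈ U) (M : Matrix (Fin 2) (Fin 2) ℂ) {n : ℕ}
    {g : Plane → ℂ} (hg : SmoothOn U g) (h : VanishTo a (n + 2) g) : VanishTo a n (quadD M g) := by
  have hz : ∀ n, VanishTo a n fun _ => (0 : ℂ) := by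
    intro n
    induction n with
    | zero => trivial
    | succ n ih =>
      exact ⟨rfl, fun j => ih.congr isOpen_univ (mem_univ a) fun z _ => pd_const j 0 z⟩
  have hc : ∀ (c : ℂ) {n : ℕ} {f : Plane → ℂ}, SmoothOn U f → VanishTo a n f →
      VanishTo a n fun z => c * f z := fun c n f hfs hf => by
    have := VanishTo.mul hU ha (m := 0) (n := n) rfl (f := fun _ => c) contDiffOn_const hfs
      trivial hf
    rwa [Nat.zero_add] at this
  have hs : ∀ j k, SmoothOn U fun z => -M j k * AharonovBohm.pd j (AharonovBohm.pd k g) z :=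
    fun j k => contDiffOn_const.mul ((hg.pd hU k).pd hU j)
  have h2 : ∀ j k, VanishTo a n fun z => -M j k * AharonovBohm.pd j (AharonovBohm.pd k g) z :=
    fun j k => hc _ ((hg.pd hU k).pd hU j) ((h.2 k).2 j)
  refine ((((h2 0 0).add hU ha (hs 0 0) (hs 0 1) (h2 0 1)).add hU ha
    ((hs 0 0).add (hs 0 1)) ((hs 1 0).add (hs 1 1))
    ((h2 1 0).add hU ha (hs 1 0) (hs 1 1) (h2 1 1)))).congr hU ha fun z hz => ?_
  rw [quadD_eq hU M hg hz]
  simp only [Fin.sum_univ_two]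

theorem VanishTo.iterate_quadD_eq_zero (hU : IsOpen U) (ha : a ∈ U)
    (M : Matrix (Fin 2) (Fin 2) ℂ) (ν : ℕ) :
    ∀ {n : ℕ} {g : Plane → ℂ}, SmoothOn U g → VanishTo a n g → 2 * ν < n →
      (AharonovBohm.quadD M)^[ν] g a = 0 := by
  induction ν with
  | zero =>
    intro n g _ h hn
    cases n with
    | zero => omega
    | succ n => exact h.1
  | succ ν ih =>
    intro n g hg h hn
    obtain ⟨m, rfl⟩ : ∃ m, n = m + 2 := ⟨n - 2, by omega⟩
    rw [Function.iterate_succ_apply]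
    exact ih (hg.quadD hU M) (h.quadD hU ha M hg) (by omega)

end Taylor

/-! ### Gaussian weights and Wick's formula -/

/-- A polynomial weight costs only half of the Gaussian decay. -/
theorem one_add_pow_le_exp_sq (M : ℕ) {m : ℝ} (hm : 0 < m) {r : ℝ} (hr : 0 ≤ r) :
    (1 + r) ^ M ≤ M.factorial * Real.exp (1 + 1 / m) * Real.exp (m * r ^ 2 / 4) := by
  have h1 := Real.pow_div_factorial_le_exp (1 + r) (by linarith) M
  rw [div_le_iff₀ (by positivity)] at h1
  have h2 : 1 + r ≤ (1 + 1 / m) + m * r ^ 2 / 4 := by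
    have h3 : 0 ≤ (m * r / 2 - 1) ^ 2 / m := by positivity
    have h4 : (m * r / 2 - 1) ^ 2 / m = m * r ^ 2 / 4 - r + 1 / m := by
      field_simp
      ring
    linarith
  calc (1 + r) ^ M ≤ Real.exp (1 + r) * M.factorial := h1
    _ ≤ Real.exp ((1 + 1 / m) + m * r ^ 2 / 4) * M.factorial := by gcongr
    _ = _ := by rw [Real.exp_add]; ring

theorem integrable_gaussian_plane {m : ℝ} (hm : 0 < m) :
    Integrable fun ζ : Plane => Real.exp (-(m * ‖ζ‖ ^ 2)) := by
  have h := GaussianFourier.integrable_cexp_neg_mul_sq_norm_add (V := Plane) (b := (m : ℂ))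
    (by simpa using hm) 0 0
  refine h.norm.congr (Eventually.of_forall fun ζ => ?_)
  simp only [Complex.norm_exp]
  congr 1
  simp [← Complex.ofReal_pow]

/-- Polynomial weights are integrable against Gaussians. -/
theorem integrable_one_add_pow_mul_gaussian (M : ℕ) {m : ℝ} (hm : 0 < m) :
    Integrable fun ζ : Plane => (1 + ‖ζ‖) ^ M * Real.exp (-(m * ‖ζ‖ ^ 2 / 2)) := by
  refine Integrable.mono' ((integrable_gaussian_plane (m := m / 4) (by positivity)).const_mul
    (M.factorial * Real.exp (1 + 1 / m))) (by fun_prop) (Eventually.of_forall fun ζ => ?_)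
  rw [Real.norm_eq_abs, abs_of_nonneg (by positivity)]
  calc _ ≤ (M.factorial * Real.exp (1 + 1 / m) * Real.exp (m * ‖ζ‖ ^ 2 / 4)) *
        Real.exp (-(m * ‖ζ‖ ^ 2 / 2)) := by
        gcongr
        exact one_add_pow_le_exp_sq M hm (norm_nonneg ζ)
    _ = _ := by
        rw [mul_assoc, ← Real.exp_add]
        congr 2
        ring

theorem integrable_pow_mul_gaussian (M : ℕ) {m : ℝ} (hm : 0 < m) :
    Integrable fun ζ : Plane => ‖ζ‖ ^ M * Real.exp (-(m * ‖ζ‖ ^ 2 / 2)) := by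
  refine Integrable.mono' (integrable_one_add_pow_mul_gaussian M hm) (by fun_prop)
    (Eventually.of_forall fun ζ => ?_)
  rw [Real.norm_eq_abs, abs_of_nonneg (by positivity)]
  gcongr
  linarith

/-- Scaling of the Gaussian moments. -/
theorem integral_pow_mul_gaussian_scaled (n : ℕ) (m : ℝ) {α : ℝ} (hα : 0 < α) :
    ∫ ζ : Plane, ‖ζ‖ ^ (2 * n) * Real.exp (-(m / α * ‖ζ‖ ^ 2 / 2)) =
      α ^ (n + 1) * ∫ ζ : Plane, ‖ζ‖ ^ (2 * n) * Real.exp (-(m * ‖ζ‖ ^ 2 / 2)) := by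
  have h := Measure.integral_comp_inv_smul (volume : Measure Plane)
    (fun ζ => ‖ζ‖ ^ (2 * n) * Real.exp (-(m * ‖ζ‖ ^ 2 / 2))) (√α)
  have hs : √α ^ 2 = α := Real.sq_sqrt hα.le
  have h0 : 0 < √α := Real.sqrt_pos.2 hα
  rw [finrank_euclideanSpace_fin, hs, abs_of_pos hα, smul_eq_mul] at h
  have h1 : ∀ ζ : Plane, ‖(√α)⁻¹ • ζ‖ ^ 2 = ‖ζ‖ ^ 2 / α := fun ζ => by
    rw [norm_smul, mul_pow, norm_inv, inv_pow, Real.norm_eq_abs, sq_abs, hs]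
    field_simp
  simp only [pow_mul, h1] at h
  simp only [pow_mul]
  rw [pow_succ, mul_assoc, ← h, ← integral_const_mul]
  congr 1
  funext ζ
  rw [div_pow]
  have : α ^ n ≠ 0 := by positivity
  field_simp

section Wick

/-- The quadratic form of a complex matrix on the plane. -/
noncomputable def quadForm (H : Matrix (Fin 2) (Fin 2) ℂ) (ζ : Plane) : ℂ :=
  ∑ j, ∑ k, ((ζ j : ℝ) : ℂ) * H j k * ((ζ k : ℝ) : ℂ)

/-- The Gaussian weight `e^{i ⟨Hζ, ζ⟩ / (2α)}`. -/
noncomputable def gaussW (H : Matrix (Fin 2) (Fin 2) ℂ) (α : ℝ) (ζ : Plane) : ℂ :=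
  Complex.exp (Complex.I * quadForm H ζ / (2 * (α : ℂ)))

variable {H : Matrix (Fin 2) (Fin 2) ℂ} {α m : ℝ}

theorem contDiff_quadForm (H : Matrix (Fin 2) (Fin 2) ℂ) {n : WithTop ℕ∞} :
    ContDiff ℝ n (quadForm H) :=
  ContDiff.sum fun j _ => ContDiff.sum fun k _ =>
    ((contDiff_coord_complex j).mul contDiff_const).mul (contDiff_coord_complex k)

theorem contDiff_gaussW (H : Matrix (Fin 2) (Fin 2) ℂ) (α : ℝ) {n : WithTop ℕ∞} :
    ContDiff ℝ n (gaussW H α) :=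
  ((contDiff_const.mul (contDiff_quadForm H)).div_const _).cexp

theorem norm_gaussW (him : ∀ ζ, (quadForm H ζ).im = m * ‖ζ‖ ^ 2) (ζ : Plane) :
    ‖gaussW H α ζ‖ = Real.exp (-(m / α * ‖ζ‖ ^ 2 / 2)) := by
  rw [gaussW, Complex.norm_exp]
  congr 1
  have h : Complex.I * quadForm H ζ / (2 * (α : ℂ)) =
      Complex.I * quadForm H ζ / ((2 * α : ℝ) : ℂ) := by push_cast; rfl
  rw [h, Complex.div_ofReal_re, Complex.I_mul_re, him]
  by_cases hα : α = 0
  · simp [hα]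
  · field_simp

theorem pd_quadForm (hsymm : H 1 0 = H 0 1) (k : Fin 2) (ζ : Plane) :
    pd k (quadForm H) ζ = 2 * ∑ l, H k l * ((ζ l : ℝ) : ℂ) := by
  have hc : ∀ j : Fin 2, DifferentiableAt ℝ (fun x : Plane => ((x j : ℝ) : ℂ)) ζ :=
    fun j => (contDiff_coord_complex j (n := 1)).differentiable (by simp) ζ
  have h1 : ∀ i j : Fin 2, DifferentiableAt ℝ
      (fun x : Plane => ((x i : ℝ) : ℂ) * H i j * ((x j : ℝ) : ℂ)) ζ := fun i j =>
    ((hc i).fun_mul (differentiableAt_const _)).fun_mul (hc j)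
  have h2 : ∀ i j : Fin 2, pd k (fun x : Plane => ((x i : ℝ) : ℂ) * H i j * ((x j : ℝ) : ℂ)) ζ =
      (if i = k then 1 else 0) * H i j * ((ζ j : ℝ) : ℂ) +
        ((ζ i : ℝ) : ℂ) * H i j * (if j = k then 1 else 0) := fun i j => by
    rw [pd_mul ((hc i).fun_mul (differentiableAt_const _)) (hc j),
      pd_mul (hc i) (differentiableAt_const _), pd_const, pd_coord, pd_coord]
    ring
  unfold quadForm
  rw [pd_sum _ fun i _ => DifferentiableAt.fun_sum fun j _ => h1 i j]
  have h3 : ∀ i, pd k (fun x : Plane => ∑ j, ((x i : ℝ) : ℂ) * H i j * ((x j : ℝ) : ℂ)) ζ =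
      ∑ j, ((if i = k then 1 else 0) * H i j * ((ζ j : ℝ) : ℂ) +
        ((ζ i : ℝ) : ℂ) * H i j * (if j = k then 1 else 0)) := fun i => by
    rw [pd_sum _ fun j _ => h1 i j]
    exact Finset.sum_congr rfl fun j _ => h2 i j
  rw [Finset.sum_congr rfl fun i _ => h3 i]
  simp only [Fin.sum_univ_two]
  fin_cases k
  · simp [hsymm]
    ring
  · simp [hsymm]
    ring

theorem pd_gaussW (hsymm : H 1 0 = H 0 1) (k : Fin 2) (ζ : Plane) :
    pd k (gaussW H α) ζ =
      Complex.I / (α : ℂ) * (∑ l, H k l * ((ζ l : ℝ) : ℂ)) * gaussW H α ζ := by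
  have hq : HasFDerivAt (quadForm H) (fderiv ℝ (quadForm H) ζ) ζ :=
    ((contDiff_quadForm H (n := 1)).differentiable (by simp) ζ).hasFDerivAt
  have h : HasFDerivAt (gaussW H α) _ ζ :=
    ((hq.const_mul Complex.I).mul_const (2 * (α : ℂ))⁻¹).cexp.congr_of_eventuallyEq
      (Eventually.of_forall fun z => by rw [gaussW, div_eq_mul_inv])
  have hp := pd_quadForm hsymm k ζ
  rw [pd] at hp
  rw [pd, h.fderiv]
  simp only [smul_apply, smul_eq_mul, gaussW, hp, div_eq_mul_inv]
  by_cases hα : α = 0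
  · simp [hα]
  · have : (α : ℂ) ≠ 0 := by exact_mod_cast hα
    field_simp

/-- `ζ_j e^{i⟨Hζ,ζ⟩/(2α)} = -iα ∑_k (H⁻¹)_{jk} ∂_k e^{i⟨Hζ,ζ⟩/(2α)}`. -/
theorem coord_mul_gaussW (hα : 0 < α) (hsymm : H 1 0 = H 0 1) (hdet : H.det ≠ 0) (j : Fin 2)
    (ζ : Plane) : ((ζ j : ℝ) : ℂ) * gaussW H α ζ =
      ∑ k, -Complex.I * (α : ℂ) * H⁻¹ j k * pd k (gaussW H α) ζ := by
  have hα' : (α : ℂ) ≠ 0 := by exact_mod_cast hα.ne'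
  have hinv : H⁻¹ * H = 1 := Matrix.nonsing_inv_mul H (isUnit_iff_ne_zero.2 hdet)
  have he : ∀ l, H⁻¹ j 0 * H 0 l + H⁻¹ j 1 * H 1 l = (1 : Matrix (Fin 2) (Fin 2) ℂ) j l := fun l => by
    rw [← hinv, Matrix.mul_apply, Fin.sum_univ_two]
  simp only [pd_gaussW hsymm, Fin.sum_univ_two]
  have h : ((ζ j : ℝ) : ℂ) = (1 : Matrix (Fin 2) (Fin 2) ℂ) j 0 * ((ζ 0 : ℝ) : ℂ) +
      (1 : Matrix (Fin 2) (Fin 2) ℂ) j 1 * ((ζ 1 : ℝ) : ℂ) := by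
    fin_cases j <;> simp [Matrix.one_apply]
  rw [h, ← he 0, ← he 1]
  field_simp
  linear_combination ((((ζ 0 : ℝ) : ℂ) * (H⁻¹ j 0 * H 0 0 + H⁻¹ j 1 * H 1 0) +
    ((ζ 1 : ℝ) : ℂ) * (H⁻¹ j 0 * H 0 1 + H⁻¹ j 1 * H 1 1)) * gaussW H α ζ) * Complex.I_sq

/-- Continuous functions of polynomial growth are integrable against the Gaussian weight. -/
theorem integrable_mul_gaussW (hα : 0 < α) (hm : 0 < m)
    (him : ∀ ζ, (quadForm H ζ).im = m * ‖ζ‖ ^ 2) {F : Plane → ℂ} (hF : AEStronglyMeasurable F)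
    {C : ℝ} {M : ℕ} (hb : ∀ᵐ ζ, ‖F ζ‖ ≤ C * (1 + ‖ζ‖) ^ M) :
    Integrable fun ζ => F ζ * gaussW H α ζ := by
  refine Integrable.mono' ((integrable_one_add_pow_mul_gaussian M
    (m := m / α) (by positivity)).const_mul C)
    (hF.mul (contDiff_gaussW H α (n := 0)).continuous.aestronglyMeasurable) ?_
  filter_upwards [hb] with ζ hζ
  rw [norm_mul, norm_gaussW him, ← mul_assoc]
  gcongr

theorem norm_taylorHom_poly (d : ℕ) (g : Plane → ℂ) (a : Plane) :
    ∃ C : ℝ, 0 ≤ C ∧ ∀ ζ, ‖taylorHom d g a ζ‖ ≤ C * (1 + ‖ζ‖) ^ d := by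
  have hex : ∀ (d : ℕ) (g : Plane → ℂ), ∃ C : ℝ, 0 ≤ C ∧ DerivBound {a} C d g := by
    intro d
    induction d with
    | zero => exact fun g => ⟨‖g a‖, norm_nonneg _, fun z hz => by rw [mem_singleton_iff.1 hz]⟩
    | succ d ih =>
      intro g
      choose C hC hb using fun j => ih (pd j g)
      refine ⟨‖g a‖ + C 0 + C 1, by linarith [norm_nonneg (g a), hC 0, hC 1],
        fun z hz => ?_, fun j => (hb j).mono ?_⟩
      · rw [mem_singleton_iff.1 hz]
        linarith [hC 0, hC 1]
      · fin_cases j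
        · simp only [Fin.zero_eta]
          linarith [norm_nonneg (g a), hC 1]
        · simp only [Fin.mk_one]
          linarith [norm_nonneg (g a), hC 0]
  obtain ⟨C, hC, hb⟩ := hex d g
  refine ⟨C * 2 ^ d, by positivity, fun ζ => (norm_taylorHom_le (mem_singleton a) d hb ζ).trans ?_⟩
  gcongr
  linarith

theorem integrable_taylorHom_mul_gaussW (hα : 0 < α) (hm : 0 < m)
    (him : ∀ ζ, (quadForm H ζ).im = m * ‖ζ‖ ^ 2) (d : ℕ) (g : Plane → ℂ) (a : Plane) :
    Integrable fun ζ => taylorHom d g a ζ * gaussW H α ζ := by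
  obtain ⟨C, -, hb⟩ := norm_taylorHom_poly d g a
  exact integrable_mul_gaussW hα hm him
    (contDiff_taylorHom d g a (n := 0)).continuous.aestronglyMeasurable (Eventually.of_forall hb)

theorem integrable_coord_mul_taylorHom_mul_gaussW (hα : 0 < α) (hm : 0 < m)
    (him : ∀ ζ, (quadForm H ζ).im = m * ‖ζ‖ ^ 2) (j : Fin 2) (d : ℕ) (g : Plane → ℂ) (a : Plane) :
    Integrable fun ζ => ((ζ j : ℝ) : ℂ) * taylorHom d g a ζ * gaussW H α ζ := by
  obtain ⟨C, hC, hb⟩ := norm_taylorHom_poly d g a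
  refine integrable_mul_gaussW hα hm him (C := C) (M := d + 1)
    ((contDiff_coord_complex j (n := 0)).mul (contDiff_taylorHom d g a)).continuous.aestronglyMeasurable
    (Eventually.of_forall fun ζ => ?_)
  rw [norm_mul, Complex.norm_real, pow_succ]
  have h1 : ‖ζ j‖ ≤ 1 + ‖ζ‖ := (PiLp.norm_apply_le ζ j).trans (by linarith)
  calc ‖ζ j‖ * ‖taylorHom d g a ζ‖ ≤ (1 + ‖ζ‖) * (C * (1 + ‖ζ‖) ^ d) :=
        mul_le_mul h1 (hb ζ) (norm_nonneg _) (by positivity)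
    _ = _ := by ring

/-- Gaussian integration by parts. -/
theorem integral_coord_mul_gaussW (hα : 0 < α) (hsymm : H 1 0 = H 0 1) (hdet : H.det ≠ 0)
    (j : Fin 2) {F : Plane → ℂ} (hF : ContDiff ℝ 1 F)
    (h0 : Integrable fun ζ => F ζ * gaussW H α ζ)
    (h1 : ∀ k, Integrable fun ζ => pd k F ζ * gaussW H α ζ)
    (h2 : ∀ k, Integrable fun ζ : Plane => ((ζ k : ℝ) : ℂ) * F ζ * gaussW H α ζ) :
    ∫ ζ : Plane, ((ζ j : ℝ) : ℂ) * F ζ * gaussW H α ζ =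
      ∑ k, Complex.I * (α : ℂ) * H⁻¹ j k * ∫ ζ, pd k F ζ * gaussW H α ζ := by
  have h3 : ∀ k, Integrable fun ζ => F ζ * pd k (gaussW H α) ζ := fun k => by
    have : (fun ζ => F ζ * pd k (gaussW H α) ζ) = fun ζ : Plane =>
        ∑ l, Complex.I / (α : ℂ) * H k l * (((ζ l : ℝ) : ℂ) * F ζ * gaussW H α ζ) := by
      funext ζ
      rw [pd_gaussW hsymm, Fin.sum_univ_two, Fin.sum_univ_two]
      ring
    rw [this]
    exact integrable_finsetSum _ fun l _ => (h2 l).const_mul _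
  have h4 : ∀ k, ∫ ζ, F ζ * pd k (gaussW H α) ζ = -∫ ζ, pd k F ζ * gaussW H α ζ := fun k =>
    integral_mul_fderiv_eq_neg_fderiv_mul_of_integrable (h1 k) (h3 k) h0
      (fun x _ => hF.differentiable (by simp) x)
      (fun x _ => (contDiff_gaussW H α (n := 1)).differentiable (by simp) x)
  have h5 : ∀ ζ : Plane, ((ζ j : ℝ) : ℂ) * F ζ * gaussW H α ζ =
      ∑ k, -Complex.I * (α : ℂ) * H⁻¹ j k * (F ζ * pd k (gaussW H α) ζ) := fun ζ => by
    rw [mul_right_comm, coord_mul_gaussW hα hsymm hdet, Finset.sum_mul]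
    refine Finset.sum_congr rfl fun k _ => ?_
    ring
  simp only [h5]
  rw [integral_finsetSum _ fun k _ => (h3 k).const_mul _]
  refine Finset.sum_congr rfl fun k _ => ?_
  rw [integral_const_mul, h4]
  ring

variable {U : Set Plane} {a : Plane}

theorem integral_taylorHom_one (hα : 0 < α) (hm : 0 < m)
    (him : ∀ ζ, (quadForm H ζ).im = m * ‖ζ‖ ^ 2) (hsymm : H 1 0 = H 0 1) (hdet : H.det ≠ 0)
    (g : Plane → ℂ) : ∫ ζ, taylorHom 1 g a ζ * gaussW H α ζ = 0 := by
  have hi := fun j => integrable_coord_mul_taylorHom_mul_gaussW hα hm him j 0 (pd j g) a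
  have h1 : ∀ j, ∫ ζ : Plane, ((ζ j : ℝ) : ℂ) * taylorHom 0 (pd j g) a ζ * gaussW H α ζ = 0 := by
    intro j
    have hz : ∀ k, pd k (taylorHom 0 (pd j g) a) = fun _ => 0 := fun k =>
      funext fun ζ => pd_const k _ ζ
    rw [integral_coord_mul_gaussW hα hsymm hdet j (contDiff_taylorHom 0 _ a)
      (integrable_taylorHom_mul_gaussW hα hm him 0 _ a) (fun k => by simp [hz])
      fun k => integrable_coord_mul_taylorHom_mul_gaussW hα hm him k 0 (pd j g) a]
    simp [hz]
  have h2 : ∀ ζ, taylorHom 1 g a ζ * gaussW H α ζ =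
      ∑ j, ((ζ j : ℝ) : ℂ) * taylorHom 0 (pd j g) a ζ * gaussW H α ζ := fun ζ => by
    rw [taylorHom, Nat.cast_zero, zero_add, inv_one, one_mul, Finset.sum_mul]
  simp only [h2]
  rw [integral_finsetSum _ fun j _ => hi j]
  simp [h1]

/-- Gaussian integration by parts lowers the degree of a Taylor polynomial by two, at the price of
one application of the second order operator `quadD H⁻¹`. -/
theorem integral_taylorHom_add_two (hα : 0 < α) (hm : 0 < m)
    (him : ∀ ζ, (quadForm H ζ).im = m * ‖ζ‖ ^ 2) (hsymm : H 1 0 = H 0 1) (hdet : H.det ≠ 0)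
    (hU : IsOpen U) (ha : a ∈ U) (d : ℕ) {g : Plane → ℂ} (hg : SmoothOn U g) :
    ∫ ζ, taylorHom (d + 2) g a ζ * gaussW H α ζ =
      -Complex.I * (α : ℂ) / ((d : ℂ) + 2) *
        ∫ ζ, taylorHom d (quadD H⁻¹ g) a ζ * gaussW H α ζ := by
  have hi := fun j => integrable_coord_mul_taylorHom_mul_gaussW hα hm him j (d + 1) (pd j g) a
  have hT := fun f => integrable_taylorHom_mul_gaussW hα hm him d f a
  have h1 : ∀ j, ∫ ζ : Plane, ((ζ j : ℝ) : ℂ) * taylorHom (d + 1) (pd j g) a ζ * gaussW H α ζ =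
      ∑ k, Complex.I * (α : ℂ) * H⁻¹ j k * ∫ ζ, taylorHom d (pd j (pd k g)) a ζ * gaussW H α ζ := by
    intro j
    have hz : ∀ k, pd k (taylorHom (d + 1) (pd j g) a) = taylorHom d (pd j (pd k g)) a := fun k => by
      rw [taylorHom_congr hU ha d fun z hz => pd_comm hU hg hz j k]
      exact funext fun ζ => pd_taylorHom_succ hU ha k d (hg.pd hU j) ζ
    rw [integral_coord_mul_gaussW hα hsymm hdet j (contDiff_taylorHom (d + 1) _ a)
      (integrable_taylorHom_mul_gaussW hα hm him (d + 1) _ a) (fun k => by rw [hz]; exact hT _)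
      fun k => integrable_coord_mul_taylorHom_mul_gaussW hα hm him k (d + 1) (pd j g) a]
    simp only [hz]
  have h2 : ∀ ζ, taylorHom (d + 2) g a ζ * gaussW H α ζ = ∑ j, (((d + 1 : ℕ) : ℂ) + 1)⁻¹ *
      (((ζ j : ℝ) : ℂ) * taylorHom (d + 1) (pd j g) a ζ * gaussW H α ζ) := fun ζ => by
    rw [taylorHom, mul_assoc, Finset.sum_mul, Finset.mul_sum]
  have hq : ∀ ζ, taylorHom d (quadD H⁻¹ g) a ζ =
      ∑ j, ∑ k, -H⁻¹ j k * taylorHom d (pd j (pd k g)) a ζ := fun ζ => by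
    have hs : ∀ j k, SmoothOn U fun z => -H⁻¹ j k * pd j (pd k g) z := fun j k =>
      contDiffOn_const.mul ((hg.pd hU k).pd hU j)
    rw [taylorHom_congr hU ha d fun z hz => quadD_eq hU H⁻¹ hg hz,
      taylorHom_sum hU ha d _ fun j _ => ContDiffOn.sum fun k _ => hs j k]
    refine Finset.sum_congr rfl fun j _ => ?_
    rw [taylorHom_sum hU ha d _ fun k _ => hs j k]
    exact Finset.sum_congr rfl fun k _ => taylorHom_const_mul hU ha _ d ((hg.pd hU k).pd hU j) ζ
  have h3 : ∫ ζ, taylorHom d (quadD H⁻¹ g) a ζ * gaussW H α ζ =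
      ∑ j, ∑ k, -H⁻¹ j k * ∫ ζ, taylorHom d (pd j (pd k g)) a ζ * gaussW H α ζ := by
    simp only [hq, Finset.sum_mul, mul_assoc]
    rw [integral_finsetSum _ fun j _ => integrable_finsetSum _ fun k _ => (hT _).const_mul _]
    refine Finset.sum_congr rfl fun j _ => ?_
    rw [integral_finsetSum _ fun k _ => (hT _).const_mul _]
    exact Finset.sum_congr rfl fun k _ => integral_const_mul _ _
  simp only [h2]
  rw [integral_finsetSum _ fun j _ => (hi j).const_mul _, h3, Finset.mul_sum]
  refine Finset.sum_congr rfl fun j _ => ?_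
  rw [integral_const_mul, h1, Finset.mul_sum, Finset.mul_sum]
  refine Finset.sum_congr rfl fun k _ => ?_
  push_cast
  rw [show ((d : ℂ) + 1 + 1) = (d : ℂ) + 2 by ring]
  ring

theorem integral_taylorHom_odd (hα : 0 < α) (hm : 0 < m)
    (him : ∀ ζ, (quadForm H ζ).im = m * ‖ζ‖ ^ 2) (hsymm : H 1 0 = H 0 1) (hdet : H.det ≠ 0)
    (hU : IsOpen U) (ha : a ∈ U) (ν : ℕ) {g : Plane → ℂ} (hg : SmoothOn U g) :
    ∫ ζ, taylorHom (2 * ν + 1) g a ζ * gaussW H α ζ = 0 := by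
  induction ν generalizing g with
  | zero => exact integral_taylorHom_one hα hm him hsymm hdet g
  | succ ν ih =>
    rw [show 2 * (ν + 1) + 1 = 2 * ν + 1 + 2 by ring,
      integral_taylorHom_add_two hα hm him hsymm hdet hU ha _ hg, ih (hg.quadD hU _), mul_zero]

/-- Wick's formula for the Taylor polynomials of a smooth function. -/
theorem integral_taylorHom_even (hα : 0 < α) (hm : 0 < m)
    (him : ∀ ζ, (quadForm H ζ).im = m * ‖ζ‖ ^ 2) (hsymm : H 1 0 = H 0 1) (hdet : H.det ≠ 0)
    (hU : IsOpen U) (ha : a ∈ U) (ν : ℕ) {g : Plane → ℂ} (hg : SmoothOn U g) :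
    ∫ ζ, taylorHom (2 * ν) g a ζ * gaussW H α ζ =
      (-Complex.I * (α : ℂ) / 2) ^ ν / (ν.factorial : ℂ) * (quadD H⁻¹)^[ν] g a *
        ∫ ζ, gaussW H α ζ := by
  induction ν generalizing g with
  | zero => simp [taylorHom, integral_const_mul]
  | succ ν ih =>
    rw [show 2 * (ν + 1) = 2 * ν + 2 by ring,
      integral_taylorHom_add_two hα hm him hsymm hdet hU ha _ hg, ih (hg.quadD hU _),
      Function.iterate_succ_apply, Nat.factorial_succ]
    have h1 : ((ν : ℂ) + 1) ≠ 0 := by exact_mod_cast Nat.succ_ne_zero ν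
    have h2 : (ν.factorial : ℂ) ≠ 0 := by exact_mod_cast ν.factorial_ne_zero
    have h3 : (2 * (ν : ℂ) + 2) ≠ 0 := by
      rw [show 2 * (ν : ℂ) + 2 = 2 * ((ν : ℂ) + 1) by ring]
      exact mul_ne_zero two_ne_zero h1
    push_cast
    field_simp
    rw [pow_succ]
    ring

end Wick

/-! ### The Gaussian integral at the critical point -/

/-- The rotation of the plane with cosine `C` and sine `S`. -/
noncomputable def rotationIsometry (C S : ℝ) (h : C ^ 2 + S ^ 2 = 1) : Plane ≃ₗᵢ[ℝ] Plane :=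
  LinearIsometry.toLinearIsometryEquiv
    { toFun := fun ζ => !₂[C * ζ 0 - S * ζ 1, S * ζ 0 + C * ζ 1]
      map_add' := fun x y => by
        ext i
        fin_cases i <;> simp <;> ring
      map_smul' := fun c x => by
        ext i
        fin_cases i <;> simp <;> ring
      norm_map' := fun x => by
        rw [← sq_eq_sq₀ (norm_nonneg _) (norm_nonneg _), plane_norm_sq, plane_norm_sq]
        simp
        linear_combination (x 0 ^ 2 + x 1 ^ 2) * h } rfl

theorem rotationIsometry_zero (C S : ℝ) (h : C ^ 2 + S ^ 2 = 1) (ζ : Plane) :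
    rotationIsometry C S h ζ 0 = C * ζ 0 - S * ζ 1 := rfl

theorem rotationIsometry_one (C S : ℝ) (h : C ^ 2 + S ^ 2 = 1) (ζ : Plane) :
    rotationIsometry C S h ζ 1 = S * ζ 0 + C * ζ 1 := rfl

/-- The eigenframe of the Jacobian matrix of the vector potential, as a rotation by half the angle
of its first column. -/
theorem exists_half_angle (b : ℝ) {x : Plane} (hx : x ≠ 0) : ∃ C S : ℝ, C ^ 2 + S ^ 2 = 1 ∧
    jacA b x 0 0 = b / ‖x‖ ^ 2 * (C ^ 2 - S ^ 2) ∧ jacA b x 0 1 = b / ‖x‖ ^ 2 * (2 * C * S) := by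
  have hn := plane_sq_add_sq_ne_zero hx
  have h2 : √2 ^ 2 = (2 : ℝ) := Real.sq_sqrt (by norm_num)
  have hr : ‖x‖ ≠ 0 := norm_ne_zero_iff.2 hx
  have hr2 := plane_norm_sq x
  have h20 : √2 ≠ 0 := by positivity
  have hS : ((x 1 - x 0) / (√2 * ‖x‖)) ^ 2 = (x 1 - x 0) ^ 2 / (2 * (x 0 ^ 2 + x 1 ^ 2)) := by
    rw [div_pow, mul_pow, h2, hr2]
  have hC : ((x 0 + x 1) / (√2 * ‖x‖)) ^ 2 = (x 0 + x 1) ^ 2 / (2 * (x 0 ^ 2 + x 1 ^ 2)) := by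
    rw [div_pow, mul_pow, h2, hr2]
  have hCS : 2 * ((x 0 + x 1) / (√2 * ‖x‖)) * ((x 1 - x 0) / (√2 * ‖x‖)) =
      2 * (x 0 + x 1) * (x 1 - x 0) / (2 * (x 0 ^ 2 + x 1 ^ 2)) := by
    rw [show 2 * (x 0 ^ 2 + x 1 ^ 2) = (√2 * ‖x‖) ^ 2 by rw [mul_pow, h2, hr2]]
    field_simp
  refine ⟨(x 0 + x 1) / (√2 * ‖x‖), (x 1 - x 0) / (√2 * ‖x‖), ?_, ?_, ?_⟩
  · rw [hS, hC]
    field_simp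
    ring
  · rw [hS, hC, hr2]
    simp [jacA]
    field_simp
    ring
  · rw [hCS, hr2]
    simp [jacA]
    field_simp
    ring

theorem integral_diagonal_gaussian {b₀ b₁ : ℂ} (h₀ : 0 < b₀.re) (h₁ : 0 < b₁.re) :
    ∫ ζ : Plane, Complex.exp (-(b₀ * ((ζ 0 : ℝ) : ℂ) ^ 2 + b₁ * ((ζ 1 : ℝ) : ℂ) ^ 2)) =
      (Real.pi / b₀) ^ (1 / 2 : ℂ) * (Real.pi / b₁) ^ (1 / 2 : ℂ) := by
  have h := GaussianFourier.integral_cexp_neg_sum_mul_add (b := ![b₀, b₁]) (fun i => by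
    fin_cases i
    · exact h₀
    · exact h₁) 0
  rw [← (PiLp.volume_preserving_toLp (Fin 2)).integral_comp
    (MeasurableEquiv.toLp 2 _).measurableEmbedding]
  simpa [Fin.sum_univ_two, Fin.prod_univ_two, neg_add_rev, add_comm] using h

/-- The principal logarithm is additive on `(κ, w)` when `κ` and `κ w` lie in the right
half-plane and `w` off the negative half-line. -/
theorem log_mul_of_re_pos {κ w : ℂ} (hκ : 0 < κ.re) (hw : w ∈ Complex.slitPlane)
    (hκw : 0 < (κ * w).re) : Complex.log (κ * w) = Complex.log κ + Complex.log w := by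
  have hκ0 : κ ≠ 0 := fun h => by simp [h] at hκ
  have hw0 := Complex.slitPlane_ne_zero hw
  have he : Complex.exp (Complex.log κ + Complex.log w) = κ * w := by
    rw [Complex.exp_add, Complex.exp_log hκ0, Complex.exp_log hw0]
  have h1 : |κ.arg| < Real.pi / 2 := Complex.abs_arg_lt_pi_div_two_iff.2 (Or.inl hκ)
  have h2 : |w.arg| < Real.pi := by
    rw [abs_lt]
    exact ⟨Complex.neg_pi_lt_arg w, lt_of_le_of_ne (Complex.arg_le_pi w)
      (Complex.mem_slitPlane_iff_arg.1 hw).1⟩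
  have hcos : 0 < Real.cos (κ.arg + w.arg) := by
    rw [← he, Complex.exp_re] at hκw
    simpa [Complex.log_im] using pos_of_mul_pos_right hκw (Real.exp_pos _).le
  have h3 : |κ.arg + w.arg| < Real.pi / 2 := by
    by_contra hlt
    have h4 : |κ.arg + w.arg| ≤ Real.pi + Real.pi / 2 :=
      (abs_add_le _ _).trans (by linarith)
    have := Real.cos_nonpos_of_pi_div_two_le_of_le (not_lt.1 hlt) h4
    rw [Real.cos_abs] at this
    linarith
  rw [abs_lt] at h3
  rw [← he, Complex.log_exp] <;> simp only [Complex.add_im, Complex.log_im] <;>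
    linarith [Real.pi_pos]

theorem cpow_half_div {c : ℝ} (hc : 0 < c) {z : ℂ} (hz : 0 < z.re) :
    ((c : ℂ) / z) ^ (1 / 2 : ℂ) =
      Complex.exp (Complex.log c / 2) * Complex.exp (-(Complex.log z / 2)) := by
  have hz0 : z ≠ 0 := fun h => by simp [h] at hz
  have hz' : z.arg ≠ Real.pi := fun h => by
    have := Complex.abs_arg_lt_pi_div_two_iff.2 (Or.inl hz)
    rw [h, abs_of_pos Real.pi_pos] at this
    linarith [Real.pi_pos]
  have hc0 : (c : ℂ) ≠ 0 := by exact_mod_cast hc.ne'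
  rw [Complex.cpow_def_of_ne_zero (div_ne_zero hc0 hz0), div_eq_mul_inv,
    Complex.log_ofReal_mul hc (inv_ne_zero hz0), Complex.log_inv _ hz', ← Complex.exp_add,
    ← Complex.ofReal_log hc.le]
  congr 1
  ring

section Value

variable {ω b B : ℝ}

theorem quadForm_phaseHess (hω : ω ≠ 0) {t : ℝ} (ht : Real.sin (ω * t) ≠ 0) {x y : Plane}
    (h : Avoids ω b t y (etaStar ω b t x y)) (ζ : Plane) :
    quadForm (phaseHess ω b B t x y) ζ = -((Real.sin (ω * t) / ω : ℝ) : ℂ) *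
      (scalZ ω B t * (((ζ 0 : ℝ) : ℂ) ^ 2 + ((ζ 1 : ℝ) : ℂ) ^ 2) +
        ((Real.sin (ω * t) / ω : ℝ) : ℂ) * (((jacA b x 0 0 : ℝ) : ℂ) *
          (((ζ 0 : ℝ) : ℂ) ^ 2 - ((ζ 1 : ℝ) : ℂ) ^ 2) +
          2 * ((jacA b x 0 1 : ℝ) : ℂ) * ((ζ 0 : ℝ) : ℂ) * ((ζ 1 : ℝ) : ℂ))) := by
  have hp : position ω b t y (etaStar ω b t x y) = x := position_etaStar hω ht b x y
  simp only [quadForm, Fin.sum_univ_two, phaseHess_apply hω ht h,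
    matZ_apply _ _ _ _ _ _ h.position_ne_zero, hp, jacA_one_one, jacA_one_zero]
  simp
  ring

theorem quadForm_phaseHess_im (hω : ω ≠ 0) {t : ℝ} (ht : Real.sin (ω * t) ≠ 0) {x y : Plane}
    (h : Avoids ω b t y (etaStar ω b t x y)) (ζ : Plane) :
    (quadForm (phaseHess ω b B t x y) ζ).im = B * (Real.sin (ω * t) / ω) ^ 2 * ‖ζ‖ ^ 2 := by
  have hZ := fun j k => matZ_im (B := B) h.position_ne_zero j k
  rw [quadForm, plane_norm_sq]
  simp only [Fin.sum_univ_two, phaseHess_apply hω ht h, Complex.add_im, Complex.mul_im,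
    Complex.mul_re, Complex.ofReal_im, Complex.ofReal_re, Complex.neg_im, Complex.neg_re, hZ]
  simp
  ring

theorem phaseHess_symm (hω : ω ≠ 0) {t : ℝ} (ht : Real.sin (ω * t) ≠ 0) {x y : Plane}
    (h : Avoids ω b t y (etaStar ω b t x y)) :
    phaseHess ω b B t x y 1 0 = phaseHess ω b B t x y 0 1 := by
  rw [phaseHess_apply hω ht h, phaseHess_apply hω ht h, matZ_apply _ _ _ _ _ _ h.position_ne_zero,
    matZ_apply _ _ _ _ _ _ h.position_ne_zero, jacA_one_zero]
  simp

theorem det_phaseHess (hω : ω ≠ 0) {t : ℝ} (ht : Real.sin (ω * t) ≠ 0) {x y : Plane}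
    (h : Avoids ω b t y (etaStar ω b t x y)) :
    (phaseHess ω b B t x y).det = ((Real.sin (ω * t) / ω : ℝ) : ℂ) ^ 2 *
      (matZ ω b B t y (etaStar ω b t x y)).det := by
  rw [Matrix.det_fin_two, Matrix.det_fin_two]
  simp only [phaseHess_apply hω ht h]
  ring

theorem det_phaseHess_ne_zero (hω : 0 < ω) (hB : 0 < B) {t : ℝ} (ht : Real.sin (ω * t) ≠ 0)
    {x y : Plane} (h : Avoids ω b t y (etaStar ω b t x y)) :
    (phaseHess ω b B t x y).det ≠ 0 := by
  rw [det_phaseHess hω.ne' ht h]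
  refine mul_ne_zero (pow_ne_zero _ ?_) (det_matZ_ne_zero hω hB b t y _ h.position_ne_zero)
  exact_mod_cast div_ne_zero ht hω.ne'

/-- The Gaussian integral attached to the Hessian of the phase. The branch of the square root is
found from `i (sin(ω t) / ω) λ_± = κ w_±`, where `κ = i (sin(ω t) / ω) e^{-iωt}` lies in the right
half-plane and `w_± = e^{iωt} λ_±` off the negative half-line. -/
theorem integral_gaussW_phaseHess (hω : 0 < ω) (hB : 0 < B) {t : ℝ} (ht : Real.sin (ω * t) ≠ 0)
    {x y : Plane} (h : Avoids ω b t y (etaStar ω b t x y)) {α : ℝ} (hα : 0 < α) :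
    ∫ ζ, gaussW (phaseHess ω b B t x y) α ζ =
      2 * (Real.pi : ℂ) * (α : ℂ) /
        (Complex.I * ((Real.sin (ω * t) / ω : ℝ) : ℂ) * sqrtDetZ ω b B t y (etaStar ω b t x y)) := by
  have hp : position ω b t y (etaStar ω b t x y) = x := position_etaStar hω.ne' ht b x y
  have hx : x ≠ 0 := hp ▸ h.position_ne_zero
  obtain ⟨C, S, hCS, hP, hQ⟩ := exists_half_angle b hx
  set σ : ℝ := Real.sin (ω * t) / ω with hσ
  have hσ0 : σ ≠ 0 := div_ne_zero ht hω.ne'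
  have hα' : (α : ℂ) ≠ 0 := by exact_mod_cast hα.ne'
  let z : ℝ → ℂ := fun s => Complex.I * (σ : ℂ) * eigZ ω b B s t x
  have hzre : ∀ s, (z s).re = B * σ ^ 2 := fun s => by
    simp only [z, Complex.mul_re, Complex.mul_im, Complex.I_re, Complex.I_im, Complex.ofReal_re,
      Complex.ofReal_im, eigZ_im]
    rw [← hσ]
    ring
  have hzpos : ∀ s, 0 < (z s).re := fun s => by
    rw [hzre]
    positivity
  have hc : 0 < 2 * Real.pi * α := by positivity
  -- The Hessian is diagonal in the eigenframe of `DA(x)`, with entries `i z(±1)`.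
  have hdiag : ∀ ζ : Plane, gaussW (phaseHess ω b B t x y) α (rotationIsometry C S hCS ζ) =
      Complex.exp (-(z 1 / (2 * α) * ((ζ 0 : ℝ) : ℂ) ^ 2 + z (-1) / (2 * α) * ((ζ 1 : ℝ) : ℂ) ^ 2)) :=
    fun ζ => by
      rw [gaussW, quadForm_phaseHess hω.ne' ht h, rotationIsometry_zero, rotationIsometry_one, hP,
        hQ, ← hσ]
      congr 1
      simp only [z, eigZ, ← hσ]
      have hCS' : (C : ℂ) ^ 2 = 1 - (S : ℂ) ^ 2 := by
        have : C ^ 2 = 1 - S ^ 2 := by linarith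
        exact_mod_cast congrArg (fun r : ℝ => (r : ℂ)) this
      push_cast
      field_simp
      have h4 : (C : ℂ) ^ 4 = (1 - (S : ℂ) ^ 2) ^ 2 := by rw [← hCS']; ring
      ring_nf
      simp only [hCS', h4]
      ring
  have hκ : 0 < (Complex.I * (σ : ℂ) * Complex.exp (-(((ω * t : ℝ) : ℂ) * Complex.I))).re := by
    rw [show -(((ω * t : ℝ) : ℂ) * Complex.I) = ((-(ω * t) : ℝ) : ℂ) * Complex.I by push_cast; ring]
    simp only [Complex.mul_re, Complex.mul_im, Complex.I_re, Complex.I_im, Complex.ofReal_re,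
      Complex.ofReal_im, Complex.exp_ofReal_mul_I_re, Complex.exp_ofReal_mul_I_im, Real.sin_neg]
    have : 0 < Real.sin (ω * t) ^ 2 / ω := by positivity
    rw [hσ]
    calc (0 : ℝ) < Real.sin (ω * t) ^ 2 / ω := this
      _ = _ := by ring
  set κ : ℂ := Complex.I * (σ : ℂ) * Complex.exp (-(((ω * t : ℝ) : ℂ) * Complex.I)) with hκdef
  have hκ0 : κ ≠ 0 := fun h => by simp [h] at hκ
  have hzw : ∀ s, z s = κ * (Complex.exp (((ω * t : ℝ) : ℂ) * Complex.I) * eigZ ω b B s t x) :=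
    fun s => by
      simp only [z, hκdef, Complex.exp_neg]
      have := Complex.exp_ne_zero (((ω * t : ℝ) : ℂ) * Complex.I)
      field_simp
  have hlog : ∀ s, Complex.log (z s) = Complex.log κ +
      Complex.log (Complex.exp (((ω * t : ℝ) : ℂ) * Complex.I) * eigZ ω b B s t x) := fun s => by
    rw [hzw]
    refine log_mul_of_re_pos hκ (rotated_eigZ_mem_slitPlane hω hB b s t x) ?_
    rw [← hzw]
    exact hzpos s
  have hhalf : ∀ s, ((Real.pi : ℂ) / (z s / (2 * α))) ^ (1 / 2 : ℂ) =
      Complex.exp (Complex.log ((2 * Real.pi * α : ℝ) : ℂ) / 2) *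
        Complex.exp (-(Complex.log (z s) / 2)) := fun s => by
    rw [← cpow_half_div hc (hzpos s)]
    congr 1
    have : z s ≠ 0 := fun h => by simpa [h] using hzpos s
    push_cast
    field_simp
  have hb : ∀ s, 0 < (z s / (2 * (α : ℂ))).re := fun s => by
    rw [show (2 * (α : ℂ)) = ((2 * α : ℝ) : ℂ) by push_cast; rfl, Complex.div_ofReal_re]
    exact div_pos (hzpos s) (by positivity)
  rw [← (rotationIsometry C S hCS).measurePreserving.integral_comp
    (rotationIsometry C S hCS).toHomeomorph.measurableEmbedding]
  simp only [hdiag]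
  rw [integral_diagonal_gaussian (hb 1) (hb (-1)), hhalf, hhalf, sqrtDetZ_eq hω hB b t _ _ h, hp, rootZ,
    hlog, hlog]
  have hsq : Complex.exp (Complex.log ((2 * Real.pi * α : ℝ) : ℂ) / 2) *
      Complex.exp (Complex.log ((2 * Real.pi * α : ℝ) : ℂ) / 2) = 2 * Real.pi * α := by
    rw [← sq, exp_half_log_sq (by exact_mod_cast hc.ne')]
    push_cast
    ring
  have hκsq : Complex.exp (Complex.log κ / 2) * Complex.exp (Complex.log κ / 2) =
      Complex.I * (σ : ℂ) * Complex.exp (-(((ω * t : ℝ) : ℂ) * Complex.I)) := by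
    rw [← sq, exp_half_log_sq hκ0]
  simp only [add_div, neg_add, Complex.exp_add, Complex.exp_neg] at hκsq ⊢
  set L := Complex.log ((2 * Real.pi * α : ℝ) : ℂ) / 2
  rw [← hsq]
  have e1 := Complex.exp_ne_zero (Complex.log κ / 2)
  have e2 := Complex.exp_ne_zero (((ω * t : ℝ) : ℂ) * Complex.I)
  have e3 := Complex.exp_ne_zero
    (Complex.log (Complex.exp (((ω * t : ℝ) : ℂ) * Complex.I) * eigZ ω b B 1 t x) / 2)
  have e4 := Complex.exp_ne_zero
    (Complex.log (Complex.exp (((ω * t : ℝ) : ℂ) * Complex.I) * eigZ ω b B (-1) t x) / 2)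
  generalize Complex.exp (Complex.log κ / 2) = k at *
  generalize Complex.exp
    (Complex.log (Complex.exp (((ω * t : ℝ) : ℂ) * Complex.I) * eigZ ω b B 1 t x) / 2) = w₁ at *
  generalize Complex.exp
    (Complex.log (Complex.exp (((ω * t : ℝ) : ℂ) * Complex.I) * eigZ ω b B (-1) t x) / 2) = w₂ at *
  generalize Complex.exp (((ω * t : ℝ) : ℂ) * Complex.I) = E at *
  rw [show Complex.I * (σ : ℂ) * (E⁻¹ * (w₁ * w₂)) = (Complex.I * (σ : ℂ) * E⁻¹) * (w₁ * w₂) by ring,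
    ← hκsq]
  field_simp

end Value

/-! ### Uniform stationary phase -/

/-- Taylor's formula for `e^{ir}` with a remainder uniform on the real line. -/
theorem norm_exp_I_mul_sub_sum_le (n : ℕ) (r : ℝ) :
    ‖Complex.exp (Complex.I * (r : ℂ)) -
      ∑ μ ∈ Finset.range n, (Complex.I * (r : ℂ)) ^ μ / (μ.factorial : ℂ)‖ ≤ |r| ^ n := by
  induction n generalizing r with
  | zero =>
    rw [mul_comm]
    simp [Complex.norm_exp_ofReal_mul_I]
  | succ n ih =>
    let F : ℕ → ℝ → ℂ := fun n r => Complex.exp (Complex.I * (r : ℂ)) -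
      ∑ μ ∈ Finset.range n, (Complex.I * (r : ℂ)) ^ μ / (μ.factorial : ℂ)
    have hlin : ∀ r : ℝ, HasDerivAt (fun r : ℝ => Complex.I * (r : ℂ)) Complex.I r := fun r => by
      simpa using (hasDerivAt_id r).ofReal_comp.const_mul Complex.I
    have hpow : ∀ (μ : ℕ) (r : ℝ), HasDerivAt
        (fun r : ℝ => (Complex.I * (r : ℂ)) ^ (μ + 1) / ((μ + 1).factorial : ℂ))
        (Complex.I * ((Complex.I * (r : ℂ)) ^ μ / (μ.factorial : ℂ))) r := fun μ r => by
      refine (((hlin r).pow (μ + 1)).div_const _).congr_deriv ?_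
      rw [Nat.factorial_succ]
      have h1 : ((μ : ℂ) + 1) ≠ 0 := by exact_mod_cast Nat.succ_ne_zero μ
      have h2 : (μ.factorial : ℂ) ≠ 0 := by exact_mod_cast μ.factorial_ne_zero
      push_cast
      field_simp
    have hd : ∀ r, HasDerivAt (F (n + 1)) (Complex.I * F n r) r := fun r => by
      have h0 : F (n + 1) = fun r : ℝ => Complex.exp (Complex.I * (r : ℂ)) -
          ((∑ μ ∈ Finset.range n, (Complex.I * (r : ℂ)) ^ (μ + 1) / ((μ + 1).factorial : ℂ)) + 1) := by
        funext r
        simp only [F]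
        rw [Finset.sum_range_succ']
        simp
      rw [h0]
      refine ((hlin r).cexp.sub ((HasDerivAt.fun_sum fun μ _ => hpow μ r).add_const 1)).congr_deriv ?_
      simp only [F]
      rw [mul_sub, Finset.mul_sum, mul_comm]
    have hb : ∀ s ∈ Metric.closedBall (0 : ℝ) |r|, ‖Complex.I * F n s‖ ≤ |r| ^ n := fun s hs => by
      rw [norm_mul, Complex.norm_I, one_mul]
      have hs' : |s| ≤ |r| := by simpa using hs
      exact (ih s).trans (pow_le_pow_left₀ (abs_nonneg s) hs' n)
    have h := (convex_closedBall (0 : ℝ) |r|).norm_image_sub_le_of_norm_hasDerivWithin_le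
      (fun s _ => (hd s).hasDerivWithinAt) hb (x := 0) (y := r) (by simp) (by simp)
    have h0 : F (n + 1) 0 = 0 := by
      simp only [F]
      rw [Finset.sum_range_succ']
      simp
    rw [h0, sub_zero, sub_zero, Real.norm_eq_abs] at h
    rw [pow_succ]
    exact h

/-- The coefficient of `α^j` in the stationary phase expansion at the point `a`, for the
Hessian `H` and the higher order part `ψ` of the phase. -/
noncomputable def statCoeff (H : Matrix (Fin 2) (Fin 2) ℂ) (ψ : Plane → ℂ) (a : Plane) (j : ℕ)
    (f : Plane → ℂ) : ℂ :=
  ∑ μ ∈ Finset.range (2 * j + 1),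
    ((Complex.I ^ j)⁻¹ * ((2 : ℂ) ^ (j + μ))⁻¹
        / (((j + μ).factorial : ℕ) * ((μ.factorial : ℕ) : ℂ)))
      * ((quadD H⁻¹)^[j + μ] (fun η => ψ η ^ μ * f η)) a

/-- The hypotheses of the stationary phase expansion of order `J` at the point `a`, for the phase
`⟨H ζ, ζ⟩ / 2 + ψ(a + ζ)` and the amplitude `f`, with quantitative bounds `C`, `M`, `m`, `δ`. -/
structure StatPhaseBounds (C δ m : ℝ) (M J : ℕ) (U : Set Plane) (a : Plane)
    (H : Matrix (Fin 2) (Fin 2) ℂ) (ψ f : Plane → ℂ) : Prop where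
  isOpen : IsOpen U
  ball : Metric.closedBall a δ ⊆ U
  symm : H 1 0 = H 0 1
  det : H.det ≠ 0
  im : ∃ m', m ≤ m' ∧ ∀ ζ, (quadForm H ζ).im = m' * ‖ζ‖ ^ 2
  real : ∀ η, (ψ η).im = 0
  smooth_phase : SmoothOn U ψ
  vanish : VanishTo a 3 ψ
  smooth : SmoothOn U f
  bound_phase : DerivBound (Metric.closedBall a δ) C 3 ψ
  bound : ∀ μ < 2 * J + 2, DerivBound (Metric.closedBall a δ) C (2 * (J + 1 + μ))
    fun η => ψ η ^ μ * f η
  growth : ∀ᵐ ζ, ‖f (a + ζ)‖ ≤ C * (1 + ‖ζ‖) ^ M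
  meas_phase : AEStronglyMeasurable fun ζ => ψ (a + ζ)
  meas : AEStronglyMeasurable fun ζ => f (a + ζ)

/-- The Taylor expansion of `e^{iψ/α} f` at `a` in which `ψ^μ f` is expanded up to the order
`2 (J + μ) + 1`. -/
noncomputable def phaseTaylor (α : ℝ) (J : ℕ) (a : Plane) (ψ f : Plane → ℂ) (ζ : Plane) : ℂ :=
  ∑ μ ∈ Finset.range (2 * J + 2), (Complex.I / (α : ℂ)) ^ μ / (μ.factorial : ℂ) *
    ∑ d ∈ Finset.range (2 * (J + 1 + μ)), taylorHom d (fun η => ψ η ^ μ * f η) a ζ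

namespace StatPhaseBounds

variable {C δ m : ℝ} {M J : ℕ} {U : Set Plane} {a : Plane} {H : Matrix (Fin 2) (Fin 2) ℂ}
  {ψ f : Plane → ℂ} {α : ℝ}

theorem mem (h : StatPhaseBounds C δ m M J U a H ψ f) (hδ : 0 < δ) : a ∈ U :=
  h.ball (Metric.mem_closedBall_self hδ.le)

theorem smooth_pow_mul (h : StatPhaseBounds C δ m M J U a H ψ f) (μ : ℕ) :
    SmoothOn U fun η => ψ η ^ μ * f η :=
  (ContDiffOn.pow h.smooth_phase μ).mul h.smooth

theorem norm_phase_le (h : StatPhaseBounds C δ m M J U a H ψ f) (hδ : 0 < δ) {ζ : Plane}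
    (hζ : ‖ζ‖ ≤ δ) : ‖ψ (a + ζ)‖ ≤ 8 * C * ‖ζ‖ ^ 3 := by
  have h1 := norm_taylor_remainder_le h.isOpen hδ.le h.ball 3 h.smooth_phase h.bound_phase ζ hζ
  rw [Finset.sum_eq_zero fun d hd => h.vanish.taylorHom_eq_zero (Finset.mem_range.1 hd) ζ,
    sub_zero] at h1
  linarith

theorem phase_eq_re (h : StatPhaseBounds C δ m M J U a H ψ f) (η : Plane) :
    ψ η = (((ψ η).re : ℝ) : ℂ) :=
  Complex.ext (by simp) (by simp [h.real η])

theorem exp_phase_eq (h : StatPhaseBounds C δ m M J U a H ψ f) (α : ℝ) (η : Plane) :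
    Complex.exp (Complex.I * ψ η / (α : ℂ)) =
      Complex.exp (Complex.I * (((ψ η).re / α : ℝ) : ℂ)) := by
  conv_lhs => rw [h.phase_eq_re η]
  push_cast
  rw [mul_div_assoc]

theorem norm_exp_phase (h : StatPhaseBounds C δ m M J U a H ψ f) (α : ℝ) (η : Plane) :
    ‖Complex.exp (Complex.I * ψ η / (α : ℂ))‖ = 1 := by
  rw [h.exp_phase_eq, mul_comm, Complex.norm_exp_ofReal_mul_I]

theorem norm_coeff_le (hα : 0 < α) (μ : ℕ) :
    ‖(Complex.I / (α : ℂ)) ^ μ / (μ.factorial : ℂ)‖ ≤ (α⁻¹) ^ μ := by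
  rw [norm_div, norm_pow, norm_div, Complex.norm_I, Complex.norm_real, Real.norm_of_nonneg hα.le,
    Complex.norm_natCast, one_div]
  exact div_le_self (by positivity) (by exact_mod_cast μ.factorial_pos)

/-- The error of the Taylor expansion of `e^{iψ/α} f` near the critical point. -/
theorem norm_sub_phaseTaylor_le_inner (h : StatPhaseBounds C δ m M J U a H ψ f) (hδ : 0 < δ)
    (hC : 0 ≤ C) (hα : 0 < α) {ζ : Plane} (hζ : ‖ζ‖ ≤ δ) :
    ‖Complex.exp (Complex.I * ψ (a + ζ) / (α : ℂ)) * f (a + ζ) - phaseTaylor α J a ψ f ζ‖ ≤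
      (8 * C) ^ (2 * J + 2) * C * (α⁻¹ ^ (2 * J + 2) * ‖ζ‖ ^ (2 * (3 * J + 3))) +
        ∑ μ ∈ Finset.range (2 * J + 2), C * 2 ^ (2 * (J + 1 + μ)) *
          (α⁻¹ ^ μ * ‖ζ‖ ^ (2 * (J + 1 + μ))) := by
  have hmem : a + ζ ∈ Metric.closedBall a δ := by simpa using hζ
  have hf : ‖f (a + ζ)‖ ≤ C := by
    simpa using (h.bound 0 (by omega)).zero _ hmem
  have hα' : (α : ℂ) ≠ 0 := by exact_mod_cast hα.ne'
  -- The error of the exponential series plus the Taylor errors of its terms.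
  have hsplit : Complex.exp (Complex.I * ψ (a + ζ) / (α : ℂ)) * f (a + ζ) -
      phaseTaylor α J a ψ f ζ =
      (Complex.exp (Complex.I * (((ψ (a + ζ)).re / α : ℝ) : ℂ)) -
        ∑ μ ∈ Finset.range (2 * J + 2),
          (Complex.I * (((ψ (a + ζ)).re / α : ℝ) : ℂ)) ^ μ / (μ.factorial : ℂ)) * f (a + ζ) +
      ∑ μ ∈ Finset.range (2 * J + 2), (Complex.I / (α : ℂ)) ^ μ / (μ.factorial : ℂ) *
        (ψ (a + ζ) ^ μ * f (a + ζ) - ∑ d ∈ Finset.range (2 * (J + 1 + μ)),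
          taylorHom d (fun η => ψ η ^ μ * f η) a ζ) := by
    have h1 : ∀ μ : ℕ, (Complex.I * (((ψ (a + ζ)).re / α : ℝ) : ℂ)) ^ μ / (μ.factorial : ℂ) *
        f (a + ζ) = (Complex.I / (α : ℂ)) ^ μ / (μ.factorial : ℂ) *
          (ψ (a + ζ) ^ μ * f (a + ζ)) := fun μ => by
      conv_rhs => rw [h.phase_eq_re (a + ζ)]
      push_cast
      rw [mul_pow, div_pow, div_pow]
      ring
    rw [phaseTaylor, h.exp_phase_eq, sub_mul, Finset.sum_mul]
    simp only [mul_sub, Finset.sum_sub_distrib, h1]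
    ring
  rw [hsplit]
  refine (norm_add_le _ _).trans (add_le_add ?_ ?_)
  · rw [norm_mul]
    have h2 := norm_exp_I_mul_sub_sum_le (2 * J + 2) ((ψ (a + ζ)).re / α)
    have h3 : |(ψ (a + ζ)).re / α| ≤ 8 * C * ‖ζ‖ ^ 3 * α⁻¹ := by
      rw [abs_div, abs_of_pos hα, div_eq_mul_inv]
      gcongr
      exact (Complex.abs_re_le_norm _).trans (h.norm_phase_le hδ hζ)
    calc _ ≤ |(ψ (a + ζ)).re / α| ^ (2 * J + 2) * C := by gcongr
      _ ≤ (8 * C * ‖ζ‖ ^ 3 * α⁻¹) ^ (2 * J + 2) * C := by gcongr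
      _ = _ := by
        rw [mul_pow, mul_pow, ← pow_mul, show 3 * (2 * J + 2) = 2 * (3 * J + 3) by ring]
        ring
  · refine (norm_sum_le _ _).trans (Finset.sum_le_sum fun μ hμ => ?_)
    rw [norm_mul]
    have h4 := norm_taylor_remainder_le h.isOpen hδ.le h.ball (2 * (J + 1 + μ))
      (h.smooth_pow_mul μ) (h.bound μ (Finset.mem_range.1 hμ)) ζ hζ
    calc _ ≤ (α⁻¹) ^ μ * (C * 2 ^ (2 * (J + 1 + μ)) * ‖ζ‖ ^ (2 * (J + 1 + μ))) :=
          mul_le_mul (norm_coeff_le hα μ) h4 (norm_nonneg _) (by positivity)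
      _ = _ := by ring

/-- Away from the critical point the Taylor expansion is controlled by its own size. -/
theorem norm_sub_phaseTaylor_le_outer (h : StatPhaseBounds C δ m M J U a H ψ f) (hδ : 0 < δ)
    (hC : 0 ≤ C) (hα : 0 < α) {ζ : Plane} (hζ : δ < ‖ζ‖)
    (hg : ‖f (a + ζ)‖ ≤ C * (1 + ‖ζ‖) ^ M) :
    ‖Complex.exp (Complex.I * ψ (a + ζ) / (α : ℂ)) * f (a + ζ) - phaseTaylor α J a ψ f ζ‖ ≤
      C * (1 / δ + 1) ^ (2 * (M + J + 1)) * ‖ζ‖ ^ (2 * (M + J + 1)) +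
        ∑ μ ∈ Finset.range (2 * J + 2),
          (2 * (J + 1 + μ) : ℕ) * (C * (2 * (1 / δ + 1)) ^ (2 * (J + 1 + μ))) *
          (α⁻¹ ^ μ * ‖ζ‖ ^ (2 * (J + 1 + μ))) := by
  -- Since `‖ζ‖ > δ`, powers of `1 + ‖ζ‖` can be traded for arbitrarily high powers of `‖ζ‖`.
  have h1 : 1 + ‖ζ‖ ≤ (1 / δ + 1) * ‖ζ‖ := by
    have : 1 ≤ 1 / δ * ‖ζ‖ := by
      rw [one_div, ← div_eq_inv_mul, one_le_div hδ]
      exact hζ.le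
    linarith
  have h10 : 1 ≤ 1 + ‖ζ‖ := by linarith [norm_nonneg ζ]
  refine (norm_sub_le _ _).trans (add_le_add ?_ ?_)
  · rw [norm_mul, h.norm_exp_phase, one_mul]
    calc _ ≤ C * (1 + ‖ζ‖) ^ M := hg
      _ ≤ C * (1 + ‖ζ‖) ^ (2 * (M + J + 1)) := by
        gcongr
        omega
      _ ≤ C * ((1 / δ + 1) * ‖ζ‖) ^ (2 * (M + J + 1)) := by gcongr
      _ = _ := by rw [mul_pow]; ring
  · refine (norm_sum_le _ _).trans (Finset.sum_le_sum fun μ hμ => ?_)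
    rw [norm_mul]
    have hT : ∀ d ∈ Finset.range (2 * (J + 1 + μ)),
        ‖taylorHom d (fun η => ψ η ^ μ * f η) a ζ‖ ≤
          C * (2 * (1 / δ + 1)) ^ (2 * (J + 1 + μ)) * ‖ζ‖ ^ (2 * (J + 1 + μ)) := fun d hd => by
      have hd' := (Finset.mem_range.1 hd).le
      have h5 := norm_taylorHom_le (Metric.mem_closedBall_self hδ.le) d
        ((h.bound μ (Finset.mem_range.1 hμ)).le hd') ζ
      calc _ ≤ C * 2 ^ d * ‖ζ‖ ^ d := h5
        _ ≤ C * 2 ^ (2 * (J + 1 + μ)) * (1 + ‖ζ‖) ^ (2 * (J + 1 + μ)) := by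
          gcongr
          · norm_num
          · exact (pow_le_pow_left₀ (norm_nonneg _) (by linarith) d).trans
              (pow_le_pow_right₀ h10 hd')
        _ ≤ C * 2 ^ (2 * (J + 1 + μ)) * ((1 / δ + 1) * ‖ζ‖) ^ (2 * (J + 1 + μ)) := by gcongr
        _ = _ := by rw [mul_pow, mul_pow]; ring
    have h6 : ‖∑ d ∈ Finset.range (2 * (J + 1 + μ)), taylorHom d (fun η => ψ η ^ μ * f η) a ζ‖ ≤
        (2 * (J + 1 + μ) : ℕ) *
          (C * (2 * (1 / δ + 1)) ^ (2 * (J + 1 + μ)) * ‖ζ‖ ^ (2 * (J + 1 + μ))) := by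
      refine (norm_sum_le_of_le _ hT).trans (le_of_eq ?_)
      rw [Finset.sum_const, Finset.card_range, nsmul_eq_mul]
    calc _ ≤ (α⁻¹) ^ μ * ((2 * (J + 1 + μ) : ℕ) *
          (C * (2 * (1 / δ + 1)) ^ (2 * (J + 1 + μ)) * ‖ζ‖ ^ (2 * (J + 1 + μ)))) :=
          mul_le_mul (norm_coeff_le hα μ) h6 (norm_nonneg _) (by positivity)
      _ = _ := by ring

/-- A bound valid for all `ζ`: the sum of the bounds for `‖ζ‖ ≤ δ` and for `δ < ‖ζ‖`. -/
theorem norm_sub_phaseTaylor_le (h : StatPhaseBounds C δ m M J U a H ψ f) (hδ : 0 < δ)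
    (hC : 0 ≤ C) (hα : 0 < α) {ζ : Plane} (hg : ‖f (a + ζ)‖ ≤ C * (1 + ‖ζ‖) ^ M) :
    ‖Complex.exp (Complex.I * ψ (a + ζ) / (α : ℂ)) * f (a + ζ) - phaseTaylor α J a ψ f ζ‖ ≤
      (8 * C) ^ (2 * J + 2) * C * (α⁻¹ ^ (2 * J + 2) * ‖ζ‖ ^ (2 * (3 * J + 3))) +
      C * (1 / δ + 1) ^ (2 * (M + J + 1)) * ‖ζ‖ ^ (2 * (M + J + 1)) +
        ∑ μ ∈ Finset.range (2 * J + 2),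
          (2 * (J + 1 + μ) : ℕ) * (C * (2 * (1 / δ + 1)) ^ (2 * (J + 1 + μ))) *
          (α⁻¹ ^ μ * ‖ζ‖ ^ (2 * (J + 1 + μ))) := by
  rcases le_or_gt ‖ζ‖ δ with hζ | hζ
  · refine (h.norm_sub_phaseTaylor_le_inner hδ hC hα hζ).trans ?_
    have h1 : 0 ≤ C * (1 / δ + 1) ^ (2 * (M + J + 1)) * ‖ζ‖ ^ (2 * (M + J + 1)) := by positivity
    refine add_le_add (le_add_of_nonneg_right h1) (Finset.sum_le_sum fun μ _ => ?_)
    have h2 : (1 : ℝ) ≤ (2 * (J + 1 + μ) : ℕ) := by exact_mod_cast (by omega)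
    have h3 : (2 : ℝ) ≤ 2 * (1 / δ + 1) := by
      have : 0 < 1 / δ := by positivity
      linarith
    refine mul_le_mul_of_nonneg_right ?_ (by positivity)
    calc C * 2 ^ (2 * (J + 1 + μ)) ≤ C * (2 * (1 / δ + 1)) ^ (2 * (J + 1 + μ)) := by gcongr
      _ ≤ _ := le_mul_of_one_le_left (by positivity) h2
  · refine (h.norm_sub_phaseTaylor_le_outer hδ hC hα hζ hg).trans ?_
    have h1 : 0 ≤ (8 * C) ^ (2 * J + 2) * C *
      (α⁻¹ ^ (2 * J + 2) * ‖ζ‖ ^ (2 * (3 * J + 3))) := by positivity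
    exact add_le_add (le_add_of_nonneg_left h1) le_rfl

theorem integrable_phaseTaylor (h : StatPhaseBounds C δ m M J U a H ψ f) (hm : 0 < m)
    (hα : 0 < α) : Integrable fun ζ => phaseTaylor α J a ψ f ζ * gaussW H α ζ := by
  obtain ⟨m', hmm, him⟩ := h.im
  simp only [phaseTaylor, Finset.sum_mul, mul_assoc]
  exact integrable_finsetSum _ fun μ _ => Integrable.const_mul (integrable_finsetSum _ fun d _ =>
    integrable_taylorHom_mul_gaussW hα (hm.trans_le hmm) him d _ a) _

theorem integrable (h : StatPhaseBounds C δ m M J U a H ψ f) (hm : 0 < m) (hα : 0 < α) :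
    Integrable fun ζ =>
      Complex.exp (Complex.I * ψ (a + ζ) / (α : ℂ)) * f (a + ζ) * gaussW H α ζ := by
  obtain ⟨m', hmm, him⟩ := h.im
  refine integrable_mul_gaussW hα (hm.trans_le hmm) him (C := C) (M := M) ?_ ?_
  · exact (Complex.continuous_exp.comp_aestronglyMeasurable
      ((h.meas_phase.const_mul Complex.I).mul_const _)).mul h.meas
  · filter_upwards [h.growth] with ζ hζ
    rwa [norm_mul, h.norm_exp_phase, one_mul]

theorem sum_range_two_mul {β : Type*} [AddCommMonoid β] (n : ℕ) (g : ℕ → β) :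
    ∑ d ∈ Finset.range (2 * n), g d = ∑ ν ∈ Finset.range n, (g (2 * ν) + g (2 * ν + 1)) := by
  induction n with
  | zero => simp
  | succ n ih =>
    rw [Finset.sum_range_succ, ← ih, show 2 * (n + 1) = 2 * n + 1 + 1 by ring,
      Finset.sum_range_succ, Finset.sum_range_succ, add_assoc]

/-- The Gaussian integral of the Taylor expansion: the terms with `2ν < 3μ` vanish because `ψ`
vanishes to third order. -/
theorem integral_phaseTaylor (h : StatPhaseBounds C δ m M J U a H ψ f) (hδ : 0 < δ) (hm : 0 < m)
    (hα : 0 < α) : ∫ ζ, phaseTaylor α J a ψ f ζ * gaussW H α ζ =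
      (∫ ζ, gaussW H α ζ) *
        ∑ j ∈ Finset.range (J + 1), (α : ℂ) ^ j * statCoeff H ψ a j f := by
  obtain ⟨m', hmm, him⟩ := h.im
  have hm' := hm.trans_le hmm
  have ha := h.mem hδ
  have hα' : (α : ℂ) ≠ 0 := by exact_mod_cast hα.ne'
  have hint := fun d g => integrable_taylorHom_mul_gaussW (H := H) hα hm' him d g a
  have hvan : ∀ μ ν : ℕ, 2 * ν < 3 * μ →
      (quadD H⁻¹)^[ν] (fun η => ψ η ^ μ * f η) a = 0 := fun μ ν hlt => by
    have hv := VanishTo.mul h.isOpen ha rfl (ContDiffOn.pow h.smooth_phase μ) h.smooth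
      (VanishTo.pow h.isOpen ha h.smooth_phase h.vanish μ) (n := 0) trivial
    exact VanishTo.iterate_quadD_eq_zero h.isOpen ha H⁻¹ ν (h.smooth_pow_mul μ) hv hlt
  have h1 : ∀ μ, ∫ ζ, (∑ d ∈ Finset.range (2 * (J + 1 + μ)),
      taylorHom d (fun η => ψ η ^ μ * f η) a ζ) * gaussW H α ζ =
      ∑ j ∈ Finset.range (J + 1), (-Complex.I * (α : ℂ) / 2) ^ (j + μ) /
        ((j + μ).factorial : ℂ) * (quadD H⁻¹)^[j + μ] (fun η => ψ η ^ μ * f η) a *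
          ∫ ζ, gaussW H α ζ := fun μ => by
    simp only [Finset.sum_mul]
    rw [integral_finsetSum _ fun d _ => hint d _, sum_range_two_mul]
    simp only [integral_taylorHom_even hα hm' him h.symm h.det h.isOpen ha _ (h.smooth_pow_mul μ),
      integral_taylorHom_odd hα hm' him h.symm h.det h.isOpen ha _ (h.smooth_pow_mul μ), add_zero]
    rw [add_comm (J + 1) μ, Finset.sum_range_add]
    rw [Finset.sum_eq_zero fun ν hν => ?_, zero_add]
    · simp only [add_comm μ]
    · rw [hvan μ ν (by have := Finset.mem_range.1 hν; omega), mul_zero, zero_mul]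
  have h2 : ∫ ζ, phaseTaylor α J a ψ f ζ * gaussW H α ζ =
      ∑ μ ∈ Finset.range (2 * J + 2), (Complex.I / (α : ℂ)) ^ μ / (μ.factorial : ℂ) *
        ∫ ζ, (∑ d ∈ Finset.range (2 * (J + 1 + μ)),
          taylorHom d (fun η => ψ η ^ μ * f η) a ζ) * gaussW H α ζ := by
    simp only [phaseTaylor]
    simp_rw [Finset.sum_mul (Finset.range (2 * J + 2)), mul_assoc]
    rw [integral_finsetSum _ fun μ _ => ?_]
    · exact Finset.sum_congr rfl fun μ _ => integral_const_mul _ _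
    · refine Integrable.const_mul ?_ _
      simp only [Finset.sum_mul]
      exact integrable_finsetSum _ fun d _ => hint d _
  rw [h2]
  simp only [h1, Finset.mul_sum]
  rw [Finset.sum_comm]
  refine Finset.sum_congr rfl fun j hj => ?_
  have hsub : Finset.range (2 * j + 1) ⊆ Finset.range (2 * J + 2) := by
    have := Finset.mem_range.1 hj
    exact Finset.range_subset_range.2 (by omega)
  -- For `ν = j + μ` the condition `2ν < 3μ` reads `2j < μ`, so only `μ ≤ 2j` contribute.
  rw [← Finset.sum_subset hsub fun μ _ hμ => ?_]
  · rw [statCoeff, Finset.mul_sum, Finset.mul_sum]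
    refine Finset.sum_congr rfl fun μ _ => ?_
    have hI : (Complex.I / (α : ℂ)) ^ μ * (-Complex.I * (α : ℂ) / 2) ^ (j + μ) =
        (α : ℂ) ^ j * ((Complex.I ^ j)⁻¹ * ((2 : ℂ) ^ (j + μ))⁻¹) := by
      rw [← inv_pow Complex.I, Complex.inv_I, pow_add _ j μ, mul_left_comm, ← mul_pow,
        show Complex.I / (α : ℂ) * (-Complex.I * (α : ℂ) / 2) = 1 / 2 by
          field_simp
          rw [Complex.I_sq]
          norm_num, pow_add, div_pow, mul_pow, div_pow, one_pow]
      field_simp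
    rw [← mul_assoc, ← mul_assoc, div_mul_div_comm, hI]
    ring
  · rw [hvan μ (j + μ) (by
      have hlt : ¬μ < 2 * j + 1 := fun hlt => hμ (Finset.mem_range.2 hlt)
      omega)]
    ring

/-- The constant in the uniform stationary phase estimate. -/
noncomputable def errorConst (C δ m : ℝ) (M J : ℕ) : ℝ :=
  (8 * C) ^ (2 * J + 2) * C *
      (∫ ζ : Plane, ‖ζ‖ ^ (2 * (3 * J + 3)) * Real.exp (-(m * ‖ζ‖ ^ 2 / 2))) +
    C * (1 / δ + 1) ^ (2 * (M + J + 1)) *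
      (∫ ζ : Plane, ‖ζ‖ ^ (2 * (M + J + 1)) * Real.exp (-(m * ‖ζ‖ ^ 2 / 2))) +
    ∑ μ ∈ Finset.range (2 * J + 2),
      (2 * (J + 1 + μ) : ℕ) * (C * (2 * (1 / δ + 1)) ^ (2 * (J + 1 + μ))) *
        (∫ ζ : Plane, ‖ζ‖ ^ (2 * (J + 1 + μ)) * Real.exp (-(m * ‖ζ‖ ^ 2 / 2)))

/-- The stationary phase expansion with an error depending only on the quantitative bounds. -/
theorem norm_integral_sub_le (h : StatPhaseBounds C δ m M J U a H ψ f) (hδ : 0 < δ) (hC : 0 ≤ C)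
    (hm : 0 < m) (hα : 0 < α) (hα1 : α ≤ 1) :
    ‖(∫ ζ, Complex.exp (Complex.I * ψ (a + ζ) / (α : ℂ)) * f (a + ζ) * gaussW H α ζ) -
      (∫ ζ, gaussW H α ζ) *
        ∑ j ∈ Finset.range (J + 1), (α : ℂ) ^ j * statCoeff H ψ a j f‖ ≤
      errorConst C δ m M J * α ^ (J + 2) := by
  obtain ⟨m', hmm, him⟩ := h.im
  have hm' := hm.trans_le hmm
  rw [← h.integral_phaseTaylor hδ hm hα, ← integral_sub (h.integrable hm hα)
    (h.integrable_phaseTaylor hm hα)]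
  have hG : ∀ ζ, ‖gaussW H α ζ‖ ≤ Real.exp (-(m / α * ‖ζ‖ ^ 2 / 2)) := fun ζ => by
    rw [norm_gaussW him]
    gcongr
  have hint : ∀ (c : ℝ) (n : ℕ), Integrable fun ζ : Plane =>
      c * (‖ζ‖ ^ (2 * n) * Real.exp (-(m / α * ‖ζ‖ ^ 2 / 2))) := fun c n =>
    (integrable_pow_mul_gaussian (2 * n) (div_pos hm hα)).const_mul c
  have hint₂ : ∀ (c c' : ℝ) (n n' : ℕ), Integrable fun ζ : Plane =>
      c * (‖ζ‖ ^ (2 * n) * Real.exp (-(m / α * ‖ζ‖ ^ 2 / 2))) +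
        c' * (‖ζ‖ ^ (2 * n') * Real.exp (-(m / α * ‖ζ‖ ^ 2 / 2))) := fun c c' n n' =>
    (hint c n).add (hint c' n')
  have hbound : ∀ᵐ ζ, ‖Complex.exp (Complex.I * ψ (a + ζ) / (α : ℂ)) * f (a + ζ) * gaussW H α ζ -
      phaseTaylor α J a ψ f ζ * gaussW H α ζ‖ ≤
      (8 * C) ^ (2 * J + 2) * C * α⁻¹ ^ (2 * J + 2) *
        (‖ζ‖ ^ (2 * (3 * J + 3)) * Real.exp (-(m / α * ‖ζ‖ ^ 2 / 2))) +
      C * (1 / δ + 1) ^ (2 * (M + J + 1)) *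
        (‖ζ‖ ^ (2 * (M + J + 1)) * Real.exp (-(m / α * ‖ζ‖ ^ 2 / 2))) +
      ∑ μ ∈ Finset.range (2 * J + 2),
        (2 * (J + 1 + μ) : ℕ) * (C * (2 * (1 / δ + 1)) ^ (2 * (J + 1 + μ))) * α⁻¹ ^ μ *
          (‖ζ‖ ^ (2 * (J + 1 + μ)) * Real.exp (-(m / α * ‖ζ‖ ^ 2 / 2))) := by
    filter_upwards [h.growth] with ζ hζ
    rw [← sub_mul, norm_mul]
    refine (mul_le_mul (h.norm_sub_phaseTaylor_le hδ hC hα hζ) (hG ζ) (norm_nonneg _)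
      (by positivity)).trans (le_of_eq ?_)
    rw [add_mul, add_mul, Finset.sum_mul]
    simp only [mul_assoc]
  refine (norm_integral_le_of_norm_le
    ((hint₂ _ _ _ _).add (integrable_finsetSum _ fun μ _ => hint _ _)) hbound).trans ?_
  rw [integral_add' (hint₂ _ _ _ _) (integrable_finsetSum _ fun μ _ => hint _ _),
    integral_add (hint _ _) (hint _ _), integral_finsetSum _ fun μ _ => hint _ _]
  simp only [integral_const_mul, integral_pow_mul_gaussian_scaled _ m hα]
  rw [errorConst, add_mul, add_mul, Finset.sum_mul]
  have hI : ∀ n, 0 ≤ ∫ ζ : Plane, ‖ζ‖ ^ (2 * n) * Real.exp (-(m * ‖ζ‖ ^ 2 / 2)) := fun n =>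
    integral_nonneg fun ζ => by positivity
  have hα0 := hα.ne'
  -- By scaling, `α^{-μ} ‖ζ‖^{2(J+1+μ)}` contributes `α^{J+2}` for every `μ`.
  refine add_le_add (add_le_add (le_of_eq ?_) ?_) (Finset.sum_le_sum fun μ _ => le_of_eq ?_)
  · rw [show 3 * J + 3 + 1 = (2 * J + 2) + (J + 2) by ring, pow_add α, inv_pow]
    field_simp
  · have : α ^ (M + J + 1 + 1) ≤ α ^ (J + 2) := pow_le_pow_of_le_one hα.le hα1 (by omega)
    have h0 := hI (M + J + 1)
    calc _ = C * (1 / δ + 1) ^ (2 * (M + J + 1)) *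
        (∫ ζ : Plane, ‖ζ‖ ^ (2 * (M + J + 1)) * Real.exp (-(m * ‖ζ‖ ^ 2 / 2))) *
          α ^ (M + J + 1 + 1) := by ring
      _ ≤ _ := by gcongr
  · rw [show J + 1 + μ + 1 = μ + (J + 2) by ring, pow_add α, inv_pow]
    field_simp

end StatPhaseBounds

/-! ### Uniform bounds near the critical points -/

section Uniform

variable {ω b B : ℝ}

theorem contDiffAt_etaStar {n : WithTop ℕ∞} {e : ℝ × Plane × Plane}
    (hs : Real.sin (ω * e.1) ≠ 0) (hy : e.2.2 ≠ 0) :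
    ContDiffAt ℝ n (fun e : ℝ × Plane × Plane => etaStar ω b e.1 e.2.1 e.2.2) e := by
  have hl : ContDiffAt ℝ n (fun q : ℝ × Plane × Plane => ω * q.1) e :=
    contDiffAt_const.mul contDiffAt_fst
  have hA : ContDiffAt ℝ n (fun q : ℝ × Plane × Plane => vecPot b q.2.2) e :=
    ContDiffAt.comp (g := vecPot b) (f := fun q : ℝ × Plane × Plane => q.2.2) e
      (contDiffAt_vecPot b hy) (contDiff_snd.comp contDiff_snd).contDiffAt
  exact hA.add ((contDiffAt_const.div (Real.contDiff_sin.contDiffAt.comp e hl) hs).smul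
    ((contDiff_fst.comp contDiff_snd).contDiffAt.sub
      ((Real.contDiff_cos.contDiffAt.comp e hl).smul (contDiff_snd.comp contDiff_snd).contDiffAt)))

theorem contDiffAt_etaStar_of_mem {n : WithTop ℕ∞} {e : ℝ × Plane × Plane}
    (he : e ∈ region ω b) :
    ContDiffAt ℝ n (fun e : ℝ × Plane × Plane => etaStar ω b e.1 e.2.1 e.2.2) e :=
  contDiffAt_etaStar he.1 he.2.left_ne_zero

theorem isOpen_region (ω b : ℝ) : IsOpen (region ω b) := by
  let V : Set (ℝ × Plane × Plane) := {e | Real.sin (ω * e.1) ≠ 0 ∧ e.2.2 ≠ 0}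
  have hV : IsOpen V :=
    (isOpen_compl_singleton.preimage (by fun_prop :
      Continuous fun e : ℝ × Plane × Plane => Real.sin (ω * e.1))).inter
    (isOpen_compl_singleton.preimage (by fun_prop : Continuous fun e : ℝ × Plane × Plane => e.2.2))
  have hc : ContinuousOn (fun e : ℝ × Plane × Plane => (e, etaStar ω b e.1 e.2.1 e.2.2)) V :=
    continuousOn_id.prodMk fun e he =>
      (contDiffAt_etaStar (n := 0) he.1 he.2).continuousAt.continuousWithinAt
  have h : region ω b = V ∩ (fun e : ℝ × Plane × Plane => (e, etaStar ω b e.1 e.2.1 e.2.2)) ⁻¹'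
      goodSet₃ ω b := by
    ext e
    exact ⟨fun he => ⟨⟨he.1, he.2.left_ne_zero⟩, he.2⟩, fun he => ⟨he.1.1, he.2⟩⟩
  rw [h]
  exact hc.isOpen_inter_preimage hV (isOpen_goodSet₃ ω b)

/-- The points `((t, x, y), η)` such that `(t, y, η)` and `(t, y, η_*)` are good and
`sin(ω t) ≠ 0`. -/
def critSet (ω b : ℝ) : Set ((ℝ × Plane × Plane) × Plane) :=
  {p | p.1 ∈ region ω b ∧ p ∈ goodSet₃ ω b}

theorem isOpen_critSet (ω b : ℝ) : IsOpen (critSet ω b) :=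
  ((isOpen_region ω b).preimage continuous_fst).inter (isOpen_goodSet₃ ω b)

theorem critSet_subset (ω b : ℝ) : critSet ω b ⊆ goodSet₃ ω b := fun _ h => h.2

theorem etaStar_mem_critSet {e : ℝ × Plane × Plane} (he : e ∈ region ω b) :
    (e, etaStar ω b e.1 e.2.1 e.2.2) ∈ critSet ω b := ⟨he, he.2⟩

theorem mem_sliceAt_critSet {e : ℝ × Plane × Plane} (he : e ∈ region ω b) {η : Plane} :
    η ∈ sliceAt (critSet ω b) e ↔ Avoids ω b e.1 e.2.2 η :=
  ⟨fun h => h.2, fun h => ⟨he, h⟩⟩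

/-- The value at the critical point of a smooth family is a smooth function of the parameters. -/
theorem SmoothFam.at_etaStar {f : ℝ × Plane × Plane → Plane → ℂ}
    (hf : SmoothFam (goodSet₃ ω b) f) :
    ContDiffOn ℝ ((⊤ : ℕ∞) : WithTop ℕ∞)
      (fun e => f e (etaStar ω b e.1 e.2.1 e.2.2)) (region ω b) :=
  ContDiffOn.comp (g := fun p : (ℝ × Plane × Plane) × Plane => f p.1 p.2)
    (f := fun e : ℝ × Plane × Plane => (e, etaStar ω b e.1 e.2.1 e.2.2)) hf
    (contDiffOn_id.prodMk fun _ he => (contDiffAt_etaStar_of_mem he).contDiffWithinAt)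
    fun _ he => he.2

theorem smoothFam_of_param {g : ℝ × Plane × Plane → ℂ}
    (hg : ContDiffOn ℝ ((⊤ : ℕ∞) : WithTop ℕ∞) g (region ω b)) :
    SmoothFam (critSet ω b) fun e _ => g e :=
  ContDiffOn.comp (g := g) (f := fun p : (ℝ × Plane × Plane) × Plane => p.1) hg
    contDiffOn_fst fun _ hp => hp.1

theorem phaseGeThree_eq (ω b B t : ℝ) (x y η : Plane) :
    phaseGeThree ω b B t x y η = phase ω b B t x y η - phase ω b B t x y (etaStar ω b t x y) -
      quadForm (phaseHess ω b B t x y) (η - etaStar ω b t x y) / 2 := rfl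

theorem smoothFam_phaseGeThree (ω b B : ℝ) :
    SmoothFam (critSet ω b) fun e η => phaseGeThree ω b B e.1 e.2.1 e.2.2 η := by
  have hφ := smoothFam_phase ω b B
  have hH : ∀ j k, SmoothFam (critSet ω b) fun e _ => phaseHess ω b B e.1 e.2.1 e.2.2 j k :=
    fun j k => smoothFam_of_param
      (((hφ.pd (isOpen_goodSet₃ ω b) k).pd (isOpen_goodSet₃ ω b) j).at_etaStar)
  have hc : ∀ j : Fin 2, SmoothFam (critSet ω b) fun e η =>
      (((η - etaStar ω b e.1 e.2.1 e.2.2) j : ℝ) : ℂ) := fun j p hp => by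
    have h1 : ContDiffAt ℝ ((⊤ : ℕ∞) : WithTop ℕ∞) (fun p : (ℝ × Plane × Plane) × Plane =>
        p.2 - etaStar ω b p.1.1 p.1.2.1 p.1.2.2) p :=
      contDiffAt_snd.sub (ContDiffAt.comp (g := fun e : ℝ × Plane × Plane =>
        etaStar ω b e.1 e.2.1 e.2.2) p (contDiffAt_etaStar_of_mem hp.1) contDiffAt_fst)
    exact (Complex.ofRealCLM.contDiff.contDiffAt.comp p
      (contDiffAt_euclidean.1 h1 j)).contDiffWithinAt
  exact ((ContDiffOn.mono hφ (critSet_subset ω b)).sub (smoothFam_of_param hφ.at_etaStar)).sub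
    ((ContDiffOn.sum fun j _ => ContDiffOn.sum fun k _ =>
      ((hc j).mul (hH j k)).mul (hc k)).div_const 2)

/-- The remainder `φ_{≥3}` vanishes to third order at the critical point. -/
theorem vanishTo_phaseGeThree (hω : 0 < ω) (hB : 0 < B) {t : ℝ} {x y : Plane}
    (he : (t, x, y) ∈ region ω b) :
    VanishTo (etaStar ω b t x y) 3 (phaseGeThree ω b B t x y) := by
  obtain ⟨ht, hgood⟩ : Real.sin (ω * t) ≠ 0 ∧ Avoids ω b t y (etaStar ω b t x y) := he
  have hD := isOpen_goodSet₃ ω b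
  have hU := isOpen_sliceAt hD (t, x, y)
  have hφ := smoothFam_phase ω b B
  have hφk : ∀ k, DifferentiableAt ℝ (pd k (phase ω b B t x y)) (etaStar ω b t x y) := fun k =>
    (hφ.pd hD k).differentiableAt hD (e := (t, x, y)) hgood
  have hsymm := phaseHess_symm (B := B) hω.ne' ht hgood
  have hpd0 : ∀ k, pd k (phase ω b B t x y) (etaStar ω b t x y) = 0 :=
    fderiv_eq_zero_iff_pd.1 ((fderiv_phase_eq_zero_iff hω hB ht x hgood).2 rfl)
  set a := etaStar ω b t x y with ha
  set H := phaseHess ω b B t x y with hH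
  have hq : ∀ η : Plane, DifferentiableAt ℝ (fun η => quadForm H (η - a)) η := fun η =>
    DifferentiableAt.comp (g := quadForm H) (f := fun η => η - a) η
      ((contDiff_quadForm H (n := 1)).differentiable (by simp) _)
      (differentiableAt_id.sub_const a)
  have h1 : ∀ k, EqOn (pd k (phaseGeThree ω b B t x y)) (fun η =>
      pd k (phase ω b B t x y) η - ∑ l, H k l * (((η l : ℝ) : ℂ) - ((a l : ℝ) : ℂ)))
      (sliceAt (goodSet₃ ω b) (t, x, y)) := fun k η hη => by
    have hφd : DifferentiableAt ℝ (phase ω b B t x y) η :=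
      hφ.differentiableAt hD (e := (t, x, y)) hη
    have hqk : pd k (fun η => quadForm H (η - a)) η =
        2 * ∑ l, H k l * (((η l : ℝ) : ℂ) - ((a l : ℝ) : ℂ)) := by
      have h2 := pd_quadForm hsymm k (η - a)
      rw [pd] at h2
      rw [pd, fderiv_comp_sub (f := quadForm H) a, h2]
      simp
    have hf : phaseGeThree ω b B t x y = fun η => (phase ω b B t x y η -
        phase ω b B t x y a) - (1 / 2 : ℂ) * quadForm H (η - a) := by
      funext η
      rw [phaseGeThree_eq]
      ring
    rw [hf, pd_sub (hφd.sub_const _) ((hq η).const_mul _), pd_sub hφd (differentiableAt_const _),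
      pd_const, pd_const_mul (hq η), hqk]
    ring
  have hamem : a ∈ sliceAt (goodSet₃ ω b) (t, x, y) := hgood
  refine ⟨by simp [phaseGeThree, ← ha], fun k => ⟨?_, fun j => ⟨?_, fun _ => trivial⟩⟩⟩
  · rw [h1 k hamem]
    simp [hpd0]
  · have hlin : ∀ l : Fin 2, DifferentiableAt ℝ
        (fun η : Plane => ((η l : ℝ) : ℂ) - ((a l : ℝ) : ℂ)) a := fun l =>
      ((contDiff_coord_complex l (n := 1)).differentiable (by simp) a).sub_const _
    have hco : ∀ l : Fin 2, DifferentiableAt ℝ (fun η : Plane => ((η l : ℝ) : ℂ)) a := fun l =>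
      (contDiff_coord_complex l (n := 1)).differentiable (by simp) a
    rw [pd_congr_on hU (h1 k) j hamem, pd_sub (hφk k)
      (DifferentiableAt.fun_sum fun l _ => (hlin l).const_mul _),
      pd_sum _ fun l _ => (hlin l).const_mul _]
    have h3 : ∀ l, pd j (fun η : Plane => H k l * (((η l : ℝ) : ℂ) - ((a l : ℝ) : ℂ))) a =
        H k l * (if l = j then 1 else 0) := fun l => by
      rw [pd_const_mul (hlin l), pd_sub (hco l) (differentiableAt_const _), pd_const, pd_coord,
        sub_zero]
    rw [Finset.sum_congr rfl fun l _ => h3 l]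
    have h4 : pd j (pd k (phase ω b B t x y)) a = H j k := by
      rw [hH, phaseHess, Matrix.of_apply]
    rw [h4]
    fin_cases j <;> fin_cases k <;> simp [hsymm]

/-- The closed balls of a small radius about the critical points stay in the good set. -/
theorem exists_ball_subset_critSet {K : Set (ℝ × Plane × Plane)} (hK : IsCompact K)
    (hKreg : K ⊆ region ω b) : ∃ δ : ℝ, 0 < δ ∧ IsCompact {p : (ℝ × Plane × Plane) × Plane |
      p.1 ∈ K ∧ p.2 ∈ Metric.closedBall (etaStar ω b p.1.1 p.1.2.1 p.1.2.2) δ} ∧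
      {p : (ℝ × Plane × Plane) × Plane |
        p.1 ∈ K ∧ p.2 ∈ Metric.closedBall (etaStar ω b p.1.1 p.1.2.1 p.1.2.2) δ} ⊆
          critSet ω b := by
  have hcs : ContinuousOn (fun e : ℝ × Plane × Plane => etaStar ω b e.1 e.2.1 e.2.2) K :=
    fun e he => (contDiffAt_etaStar_of_mem (n := 0) (hKreg he)).continuousAt.continuousWithinAt
  obtain ⟨δ, hδ, hsub⟩ := (hK.image_of_continuousOn
    (continuousOn_id.prodMk hcs)).exists_cthickening_subset_open (isOpen_critSet ω b)
    (by
      rintro _ ⟨e, he, rfl⟩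
      exact etaStar_mem_critSet (hKreg he))
  refine ⟨δ, hδ, ?_, ?_⟩
  · have himg := (hK.prod (isCompact_closedBall (0 : Plane) δ)).image_of_continuousOn
      (f := fun q : (ℝ × Plane × Plane) × Plane =>
        (q.1, etaStar ω b q.1.1 q.1.2.1 q.1.2.2 + q.2))
      (continuousOn_fst.prodMk ((hcs.comp continuousOn_fst fun q hq => hq.1).add continuousOn_snd))
    convert himg using 1
    ext p
    constructor
    · rintro ⟨h1, h2⟩
      refine ⟨(p.1, p.2 - etaStar ω b p.1.1 p.1.2.1 p.1.2.2), ⟨h1, ?_⟩, ?_⟩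
      · simpa [dist_eq_norm] using h2
      · simp
    · rintro ⟨q, ⟨h1, h2⟩, rfl⟩
      exact ⟨h1, by simpa using h2⟩
  · rintro p ⟨h1, h2⟩
    refine hsub (Metric.mem_cthickening_of_dist_le p (p.1, etaStar ω b p.1.1 p.1.2.1 p.1.2.2) δ _
      ⟨p.1, h1, rfl⟩ ?_)
    rw [Prod.dist_eq]
    simpa [hδ.le] using h2

/-- The derivatives of a smooth family are bounded uniformly over a compact set of points. -/
theorem SmoothFam.exists_derivBound {E : Type*} [NormedAddCommGroup E] [NormedSpace ℝ E]
    {D S : Set (E × Plane)} (hD : IsOpen D) (hS : IsCompact S) (hSD : S ⊆ D) (n : ℕ) :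
    ∀ {f : E → Plane → ℂ}, SmoothFam D f →
      ∃ C : ℝ, 0 ≤ C ∧ ∀ e, DerivBound {η | (e, η) ∈ S} C n (f e) := by
  induction n with
  | zero =>
    intro f hf
    obtain ⟨C, hC⟩ := hS.exists_bound_of_continuousOn (hf.continuousOn.mono hSD)
    exact ⟨|C|, abs_nonneg C, fun e η hη => (hC (e, η) hη).trans (le_abs_self C)⟩
  | succ n ih =>
    intro f hf
    obtain ⟨C, hC⟩ := hS.exists_bound_of_continuousOn (hf.continuousOn.mono hSD)
    choose C' hC' hb using fun j => ih (hf.pd hD j)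
    refine ⟨|C| + ∑ j, C' j, add_nonneg (abs_nonneg C) (Finset.sum_nonneg fun j _ => hC' j),
      fun e => ⟨fun η hη => ?_, fun j => (hb j e).mono ?_⟩⟩
    · exact (hC (e, η) hη).trans ((le_abs_self C).trans
        (le_add_of_nonneg_right (Finset.sum_nonneg fun j _ => hC' j)))
    · exact (Finset.single_le_sum (f := C') (fun j _ => hC' j) (Finset.mem_univ j)).trans
        (le_add_of_nonneg_left (abs_nonneg C))

/-- For `y ≠ 0`, a trajectory through the origin has `η - A(y)` parallel to `y`. -/
theorem ae_avoids (hω : ω ≠ 0) (b t : ℝ) {y : Plane} (hy : y ≠ 0) :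
    ∀ᵐ η : Plane, Avoids ω b t y η := by
  let L : Plane →ₗ[ℝ] ℝ := ((y 0) • coordL 1 - (y 1) • coordL 0 : Plane →L[ℝ] ℝ).toLinearMap
  have hL : ∀ p : Plane, L p = y 0 * p 1 - y 1 * p 0 := fun p => rfl
  have hne : LinearMap.ker L ≠ ⊤ := by
    intro htop
    have h1 : L !₂[-(y 1), y 0] = 0 := by
      rw [← LinearMap.mem_ker, htop]
      trivial
    rw [hL] at h1
    apply plane_sq_add_sq_ne_zero hy
    simp at h1
    linarith
  have hnull : volume ((fun η => η + -vecPot b y) ⁻¹' (LinearMap.ker L : Set Plane)) = 0 := by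
    rw [measure_preimage_add_right]
    exact Measure.addHaar_submodule _ _ hne
  refine measure_mono_null (fun η hη => ?_) hnull
  simp only [mem_compl_iff, mem_ofPred_eq, Avoids, not_forall, not_not] at hη
  obtain ⟨s, -, hs⟩ := hη
  have h0 := position_apply ω b s y η 0
  have h1 := position_apply ω b s y η 1
  rw [hs] at h0 h1
  simp only [PiLp.zero_apply] at h0 h1
  rw [mem_preimage, SetLike.mem_coe, LinearMap.mem_ker, hL]
  simp only [← sub_eq_add_neg]
  have hsin : Real.sin (ω * s) ≠ 0 := fun hz => by
    have hc : Real.cos (ω * s) ≠ 0 := fun hc => by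
      have := Real.sin_sq_add_cos_sq (ω * s)
      rw [hz, hc] at this
      norm_num at this
    rw [hz] at h0 h1
    simp only [zero_div, zero_mul, add_zero] at h0 h1
    apply hy
    ext j
    fin_cases j
    · exact (mul_eq_zero.1 h0.symm).resolve_left hc
    · exact (mul_eq_zero.1 h1.symm).resolve_left hc
  -- Eliminating `cos(ω s)` from the two equations `x^s = 0`.
  have h2 : Real.sin (ω * s) / ω *
      (y 0 * (η 1 - vecPot b y 1) - y 1 * (η 0 - vecPot b y 0)) = 0 := by
    linear_combination y 1 * h0 - y 0 * h1
  exact (mul_eq_zero.1 h2).resolve_left (div_ne_zero hsin hω)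

/-- A function which is smooth at the good points is measurable. -/
theorem aestronglyMeasurable_of_smoothOn (hω : ω ≠ 0) {e : ℝ × Plane × Plane}
    (he : e ∈ region ω b) {f : Plane → ℂ} (hf : SmoothOn (sliceAt (critSet ω b) e) f) (a : Plane) :
    AEStronglyMeasurable fun ζ => f (a + ζ) := by
  have hU := isOpen_sliceAt (isOpen_critSet ω b) e
  have h1 := hf.continuousOn.aestronglyMeasurable (μ := volume) hU.measurableSet
  rw [Measure.restrict_eq_self_of_ae_mem] at h1
  · exact h1.comp_measurePreserving (measurePreserving_add_left volume a)
  · filter_upwards [ae_avoids hω b e.1 he.2.left_ne_zero] with η hη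
    exact (mem_sliceAt_critSet he).2 hη

end Uniform

/-! ### Expansion of the kernel -/

section Kernel

variable {ω b B ε : ℝ} {θ : Plane → ℝ} {K : Set (ℝ × Plane × Plane)}
  {u : ℕ → ℝ → Plane → Plane → ℂ}

theorem IsAmplitude.smoothFam (hu : IsAmplitude θ ε ω b B u) (k : ℕ) :
    SmoothFam (goodSet₃ ω b) fun e η => u k e.1 e.2.2 η :=
  ContDiffOn.comp (g := fun p : ℝ × Plane × Plane => u k p.1 p.2.1 p.2.2)
    (f := fun p : (ℝ × Plane × Plane) × Plane => (p.1.1, p.1.2.2, p.2)) (hu.smooth k)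
    (by fun_prop) fun _ hp => hp

theorem IsAmplitude.exists_growth (hu : IsAmplitude θ ε ω b B u) (k : ℕ) (hK : IsCompact K)
    (hKreg : K ⊆ region ω b) : ∃ (C : ℝ) (M : ℕ), 0 ≤ C ∧ ∀ t x y, (t, x, y) ∈ K → ∀ ζ : Plane,
      Avoids ω b t y (etaStar ω b t x y + ζ) →
        ‖u k t y (etaStar ω b t x y + ζ)‖ ≤ C * (1 + ‖ζ‖) ^ M := by
  have hcs : ContinuousOn (fun e : ℝ × Plane × Plane => etaStar ω b e.1 e.2.1 e.2.2) K :=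
    fun e he => (contDiffAt_etaStar_of_mem (n := 0) (hKreg he)).continuousAt.continuousWithinAt
  obtain ⟨R, hR⟩ := hK.exists_bound_of_continuousOn hcs
  obtain ⟨C, M, hC⟩ := hu.growth k ((fun e : ℝ × Plane × Plane => (e.1, e.2.2)) '' K)
    (hK.image (by fun_prop))
  refine ⟨|C| * (1 + |R|) ^ M, M, by positivity, fun t x y he ζ hζ => ?_⟩
  have h1 : 1 + ‖etaStar ω b t x y + ζ‖ ≤ (1 + |R|) * (1 + ‖ζ‖) := by
    have h2 : ‖etaStar ω b t x y‖ ≤ |R| := (hR _ he).trans (le_abs_self R)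
    have h3 : 0 ≤ |R| * ‖ζ‖ := by positivity
    linarith [norm_add_le (etaStar ω b t x y) ζ]
  calc _ ≤ C * (1 + ‖etaStar ω b t x y + ζ‖) ^ M := hC t y ⟨_, he, rfl⟩ _ hζ
    _ ≤ |C| * ((1 + |R|) * (1 + ‖ζ‖)) ^ M := by
      gcongr
      exact le_abs_self C
    _ = _ := by rw [mul_pow]; ring

theorem exists_pos_le_abs_sin (hK : IsCompact K) (hKreg : K ⊆ region ω b) :
    ∃ s : ℝ, 0 < s ∧ ∀ e ∈ K, s ≤ |Real.sin (ω * e.1)| :=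
  hK.exists_forall_le' (by fun_prop) fun e he => abs_pos.2 (hKreg he).1

/-- The hypotheses of the uniform stationary phase expansion hold on `K`. -/
theorem exists_statPhaseBounds (hω : 0 < ω) (hB : 0 < B) (hK : IsCompact K)
    (hKreg : K ⊆ region ω b) (hu : IsAmplitude θ ε ω b B u) (k J : ℕ) :
    ∃ (C δ m : ℝ) (M : ℕ), 0 ≤ C ∧ 0 < δ ∧ 0 < m ∧ ∀ t x y, (t, x, y) ∈ K →
      StatPhaseBounds C δ m M J (sliceAt (critSet ω b) (t, x, y)) (etaStar ω b t x y)
        (phaseHess ω b B t x y) (phaseGeThree ω b B t x y) (u k t y) := by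
  have hD := isOpen_critSet ω b
  obtain ⟨δ, hδ, hS, hSD⟩ := exists_ball_subset_critSet hK hKreg
  obtain ⟨s, hs, hsin⟩ := exists_pos_le_abs_sin hK hKreg
  obtain ⟨C₀, M, hC₀, hgrowth⟩ := hu.exists_growth k hK hKreg
  have hψ := smoothFam_phaseGeThree ω b B
  have huk : SmoothFam (critSet ω b) fun e η => u k e.1 e.2.2 η :=
    ContDiffOn.mono (hu.smoothFam k) (critSet_subset ω b)
  have hprod : ∀ μ : ℕ, SmoothFam (critSet ω b) fun e η =>
      phaseGeThree ω b B e.1 e.2.1 e.2.2 η ^ μ * u k e.1 e.2.2 η := fun μ =>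
    (ContDiffOn.pow hψ μ).mul huk
  obtain ⟨C₁, hC₁, hb₁⟩ := SmoothFam.exists_derivBound hD hS hSD 3 hψ
  choose C₂ hC₂ hb₂ using fun μ =>
    SmoothFam.exists_derivBound hD hS hSD (2 * (J + 1 + μ)) (hprod μ)
  have hsum : 0 ≤ ∑ μ ∈ Finset.range (2 * J + 2), C₂ μ := Finset.sum_nonneg fun μ _ => hC₂ μ
  refine ⟨C₀ + C₁ + ∑ μ ∈ Finset.range (2 * J + 2), C₂ μ, δ, B * (s / ω) ^ 2, M,
    by positivity, hδ, by positivity, fun t x y he => ?_⟩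
  have hreg : (t, x, y) ∈ region ω b := hKreg he
  obtain ⟨ht, hgood⟩ : Real.sin (ω * t) ≠ 0 ∧ Avoids ω b t y (etaStar ω b t x y) := hreg
  have hball : {η | ((t, x, y), η) ∈ {p : (ℝ × Plane × Plane) × Plane |
      p.1 ∈ K ∧ p.2 ∈ Metric.closedBall (etaStar ω b p.1.1 p.1.2.1 p.1.2.2) δ}} =
      Metric.closedBall (etaStar ω b t x y) δ := by
    ext η
    exact ⟨fun h => h.2, fun h => ⟨he, h⟩⟩
  have hψe : SmoothOn (sliceAt (critSet ω b) (t, x, y)) (phaseGeThree ω b B t x y) :=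
    hψ.slice (t, x, y)
  have hue : SmoothOn (sliceAt (critSet ω b) (t, x, y)) (u k t y) := huk.slice (t, x, y)
  refine
    { isOpen := isOpen_sliceAt hD _
      ball := fun η hη => hSD ⟨he, hη⟩
      symm := phaseHess_symm hω.ne' ht hgood
      det := det_phaseHess_ne_zero hω hB ht hgood
      im := ⟨_, ?_, quadForm_phaseHess_im hω.ne' ht hgood⟩
      real := phaseGeThree_im hω.ne' ht hgood
      smooth_phase := hψe
      vanish := vanishTo_phaseGeThree hω hB (hKreg he)
      smooth := hue
      bound_phase := ?_
      bound := fun μ hμ => ?_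
      growth := ?_
      meas_phase := aestronglyMeasurable_of_smoothOn hω.ne' (hKreg he) hψe _
      meas := aestronglyMeasurable_of_smoothOn hω.ne' (hKreg he) hue _ }
  -- `|sin(ω t)|` is bounded below on `K`, which makes the Gaussian decay uniform.
  · have h1 := hsin _ he
    rw [← sq_abs (Real.sin (ω * t) / ω), abs_div, abs_of_pos hω]
    gcongr
  · have h2 := hb₁ (t, x, y)
    rw [hball] at h2
    exact h2.mono (by linarith)
  · have h2 := hb₂ μ (t, x, y)
    rw [hball] at h2
    have h3 := Finset.single_le_sum (f := C₂) (fun μ _ => hC₂ μ) (Finset.mem_range.2 hμ)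
    exact h2.mono (by linarith)
  · have h4 := (measurePreserving_add_left volume
      (etaStar ω b t x y)).quasiMeasurePreserving.ae (ae_avoids hω.ne' b t hgood.left_ne_zero)
    filter_upwards [h4] with ζ hζ
    refine (hgrowth t x y he ζ hζ).trans ?_
    gcongr
    linarith

/-- The integrand splits into the value at the critical point, a factor of modulus one and a
Gaussian. -/
theorem exp_phase_etaStar_add (hω : ω ≠ 0) {t : ℝ} (ht : Real.sin (ω * t) ≠ 0) (b B α : ℝ)
    (x y ζ : Plane) :
    Complex.exp (Complex.I * phase ω b B t x y (etaStar ω b t x y + ζ) / (α : ℂ)) =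
      Complex.exp (Complex.I * (action ω b t y (etaStar ω b t x y) : ℂ) / (α : ℂ)) *
        (Complex.exp (Complex.I * phaseGeThree ω b B t x y (etaStar ω b t x y + ζ) / (α : ℂ)) *
          gaussW (phaseHess ω b B t x y) α ζ) := by
  rw [gaussW, ← Complex.exp_add, ← Complex.exp_add, phaseGeThree_eq, phase_etaStar hω ht,
    add_sub_cancel_left]
  congr 1
  rw [mul_comm 2 (α : ℂ), ← div_div]
  ring

theorem integrable_exp_phase_mul (hω : 0 < ω) (hB : 0 < B) (hK : IsCompact K)
    (hKreg : K ⊆ region ω b) (hu : IsAmplitude θ ε ω b B u) (k : ℕ) {α t : ℝ} {x y : Plane}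
    (hα : 0 < α) (he : (t, x, y) ∈ K) :
    Integrable fun η => Complex.exp (Complex.I * phase ω b B t x y η / (α : ℂ)) * u k t y η := by
  obtain ⟨C, δ, m, M, -, -, hm, h⟩ := exists_statPhaseBounds hω hB hK hKreg hu k 0
  have h1 := (((h t x y he).integrable hm hα).const_mul (Complex.exp
    (Complex.I * (action ω b t y (etaStar ω b t x y) : ℂ) / (α : ℂ)))).comp_add_left
      (-etaStar ω b t x y)
  refine h1.congr (Eventually.of_forall fun η => ?_)
  have h2 := exp_phase_etaStar_add hω.ne' (hKreg he).1 b B α x y (-etaStar ω b t x y + η)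
  rw [add_neg_cancel_left] at h2
  simp only [add_neg_cancel_left]
  rw [h2]
  ring

theorem integral_exp_phase_mul (hω : ω ≠ 0) {t : ℝ} (ht : Real.sin (ω * t) ≠ 0) (b B α : ℝ)
    (x y : Plane) (f : Plane → ℂ) :
    ∫ η, Complex.exp (Complex.I * phase ω b B t x y η / (α : ℂ)) * f η =
      Complex.exp (Complex.I * (action ω b t y (etaStar ω b t x y) : ℂ) / (α : ℂ)) *
        ∫ ζ, Complex.exp (Complex.I * phaseGeThree ω b B t x y (etaStar ω b t x y + ζ) / (α : ℂ)) *
          f (etaStar ω b t x y + ζ) * gaussW (phaseHess ω b B t x y) α ζ := by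
  rw [← integral_add_left_eq_self _ (etaStar ω b t x y), ← integral_const_mul]
  congr 1
  funext ζ
  rw [exp_phase_etaStar_add hω ht]
  ring

theorem norm_exp_action (ω b α t : ℝ) (x y : Plane) :
    ‖Complex.exp (Complex.I * (action ω b t y (etaStar ω b t x y) : ℂ) / (α : ℂ))‖ = 1 := by
  rw [mul_div_assoc, ← Complex.ofReal_div, mul_comm, Complex.norm_exp_ofReal_mul_I]

/-- The prefactor of the expansion and `(det Z)^{-1/2}` multiply to `(2πα)⁻²` times the
exponential at the critical point times the Gaussian integral. -/
theorem mehlerFactor_eq (hω : 0 < ω) (hB : 0 < B) {t : ℝ} {x y : Plane}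
    (he : (t, x, y) ∈ region ω b) {α : ℝ} (hα : 0 < α) :
    mehlerFactor ω b α t x y * (sqrtDetZ ω b B t y (etaStar ω b t x y))⁻¹ =
      (((2 * Real.pi * α) ^ 2 : ℝ) : ℂ)⁻¹ *
        (Complex.exp (Complex.I * (action ω b t y (etaStar ω b t x y) : ℂ) / (α : ℂ)) *
          ∫ ζ, gaussW (phaseHess ω b B t x y) α ζ) := by
  obtain ⟨ht, hgood⟩ : Real.sin (ω * t) ≠ 0 ∧ Avoids ω b t y (etaStar ω b t x y) := he
  rw [integral_gaussW_phaseHess hω hB ht hgood hα, mehlerFactor]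
  have h1 : (ω : ℂ) ≠ 0 := by exact_mod_cast hω.ne'
  have h2 : (α : ℂ) ≠ 0 := by exact_mod_cast hα.ne'
  have h3 : ((Real.sin (ω * t) : ℝ) : ℂ) ≠ 0 := by exact_mod_cast ht
  have h4 : (Real.pi : ℂ) ≠ 0 := by exact_mod_cast Real.pi_ne_zero
  have h5 := sqrtDetZ_ne_zero hω hB hgood
  rw [Complex.ofReal_div]
  generalize ((Real.sin (ω * t) : ℝ) : ℂ) = s at *
  generalize sqrtDetZ ω b B t y (etaStar ω b t x y) = r at *
  push_cast
  field_simp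

/-- The expansion of the contribution of one amplitude, up to an arbitrary order. -/
theorem exists_expansion (hω : 0 < ω) (hB : 0 < B) (hK : IsCompact K)
    (hKreg : K ⊆ region ω b) (hu : IsAmplitude θ ε ω b B u) (k J : ℕ) :
    ∃ A : ℝ, 0 ≤ A ∧ ∀ (α t : ℝ) (x y : Plane), 0 < α → α ≤ 1 → (t, x, y) ∈ K →
      ‖(((2 * Real.pi * α) ^ 2 : ℝ) : ℂ)⁻¹ *
          (∫ η, Complex.exp (Complex.I * phase ω b B t x y η / (α : ℂ)) * u k t y η) -
        mehlerFactor ω b α t x y * ((sqrtDetZ ω b B t y (etaStar ω b t x y))⁻¹ *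
          ∑ j ∈ Finset.range (J + 1), (α : ℂ) ^ j * statPhaseL ω b B t x y j (u k t y))‖ ≤
        A * α ^ J := by
  obtain ⟨C, δ, m, M, hC, hδ, hm, h⟩ := exists_statPhaseBounds hω hB hK hKreg hu k J
  refine ⟨((2 * Real.pi) ^ 2)⁻¹ * |StatPhaseBounds.errorConst C δ m M J|, by positivity,
    fun α t x y hα hα1 he => ?_⟩
  have h1 := (h t x y he).norm_integral_sub_le hδ hC hm hα hα1
  have ht : Real.sin (ω * t) ≠ 0 := (hKreg he).1
  have hfac : ∀ X E I G S : ℂ, X * (E * I) - X * (E * G) * S = X * (E * (I - G * S)) := by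
    intros
    ring
  have hL : ∀ j, statPhaseL ω b B t x y j (u k t y) = statCoeff (phaseHess ω b B t x y)
      (phaseGeThree ω b B t x y) (etaStar ω b t x y) j (u k t y) := fun j => rfl
  rw [← mul_assoc (mehlerFactor ω b α t x y), mehlerFactor_eq hω hB (hKreg he) hα,
    integral_exp_phase_mul hω.ne' ht, hfac]
  simp only [hL]
  rw [norm_mul, norm_mul, norm_exp_action, one_mul, norm_inv, Complex.norm_real,
    Real.norm_of_nonneg (by positivity)]
  calc _ ≤ ((2 * Real.pi * α) ^ 2)⁻¹ *
        (|StatPhaseBounds.errorConst C δ m M J| * α ^ (J + 2)) := by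
        gcongr
        exact h1.trans (mul_le_mul_of_nonneg_right (le_abs_self _) (by positivity))
    -- The factor `(2πα)⁻²` cancels the two extra powers of `α` in the error.
    _ = _ := by
      rw [pow_add α J 2]
      field_simp

theorem kernelU_eq_sum (hω : 0 < ω) (hB : 0 < B) (hK : IsCompact K)
    (hKreg : K ⊆ region ω b) (hu : IsAmplitude θ ε ω b B u) (N : ℕ) {α t : ℝ} {x y : Plane}
    (hα : 0 < α) (he : (t, x, y) ∈ K) :
    kernelU ω b B u N α t x y = ∑ k ∈ Finset.range (N + 1), (α : ℂ) ^ k *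
      ((((2 * Real.pi * α) ^ 2 : ℝ) : ℂ)⁻¹ *
        ∫ η, Complex.exp (Complex.I * phase ω b B t x y η / (α : ℂ)) * u k t y η) := by
  have h1 : ∀ η, kernelIntegrand ω b B u N α t x y η = ∑ k ∈ Finset.range (N + 1),
      (α : ℂ) ^ k * (Complex.exp (Complex.I * phase ω b B t x y η / (α : ℂ)) * u k t y η) :=
    fun η => by
      rw [kernelIntegrand, Finset.mul_sum]
      exact Finset.sum_congr rfl fun k _ => by ring
  rw [kernelU]
  simp only [h1]
  rw [integral_finsetSum _ fun k _ =>
    (integrable_exp_phase_mul hω hB hK hKreg hu k hα he).const_mul _, Finset.mul_sum]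
  refine Finset.sum_congr rfl fun k _ => ?_
  rw [integral_const_mul]
  ring

theorem integrable_kernelIntegrand (hω : 0 < ω) (hB : 0 < B) (hK : IsCompact K)
    (hKreg : K ⊆ region ω b) (hu : IsAmplitude θ ε ω b B u) (N : ℕ) {α t : ℝ} {x y : Plane}
    (hα : 0 < α) (he : (t, x, y) ∈ K) : Integrable (kernelIntegrand ω b B u N α t x y) := by
  refine (integrable_finsetSum (Finset.range (N + 1)) fun k _ =>
    (integrable_exp_phase_mul hω hB hK hKreg hu k hα he).const_mul ((α : ℂ) ^ k)).congr
      (Eventually.of_forall fun η => ?_)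
  simp only [kernelIntegrand]
  rw [Finset.mul_sum]
  exact Finset.sum_congr rfl fun k _ => by ring

/-- The expansion of the kernel: the `k`-th amplitude is expanded up to the order `N - k`. -/
theorem exists_kernel_expansion (hω : 0 < ω) (hB : 0 < B) (hK : IsCompact K)
    (hKreg : K ⊆ region ω b) (hu : IsAmplitude θ ε ω b B u) (N : ℕ) :
    ∃ (α₀ C : ℝ), 0 < α₀ ∧ ∀ (α t : ℝ) (x y : Plane), 0 < α → α < α₀ → (t, x, y) ∈ K →
      ‖kernelU ω b B u N α t x y - mehlerFactor ω b α t x y *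
        ∑ k ∈ Finset.range (N + 1), (α : ℂ) ^ k * coeffC ω b B u k t x y‖ ≤ C * α ^ N := by
  choose A hA hexp using fun k => exists_expansion hω hB hK hKreg hu k (N - k)
  refine ⟨1, ∑ k ∈ Finset.range (N + 1), A k, one_pos, fun α t x y hα hα1 he => ?_⟩
  have hsum : ∑ k ∈ Finset.range (N + 1), (α : ℂ) ^ k * coeffC ω b B u k t x y =
      ∑ k ∈ Finset.range (N + 1), (α : ℂ) ^ k * ((sqrtDetZ ω b B t y (etaStar ω b t x y))⁻¹ *
        ∑ j ∈ Finset.range (N - k + 1), (α : ℂ) ^ j * statPhaseL ω b B t x y j (u k t y)) := by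
    have h1 := Finset.sum_range_diag_flip (N + 1) fun k j => (α : ℂ) ^ (k + j) *
      ((sqrtDetZ ω b B t y (etaStar ω b t x y))⁻¹ * statPhaseL ω b B t x y j (u k t y))
    calc _ = ∑ m ∈ Finset.range (N + 1), ∑ k ∈ Finset.range (m + 1), (α : ℂ) ^ (k + (m - k)) *
          ((sqrtDetZ ω b B t y (etaStar ω b t x y))⁻¹ *
            statPhaseL ω b B t x y (m - k) (u k t y)) := by
          refine Finset.sum_congr rfl fun m _ => ?_
          rw [coeffC, Finset.mul_sum, Finset.mul_sum]
          refine Finset.sum_congr rfl fun k hk => ?_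
          rw [Nat.add_sub_cancel' (Nat.lt_succ_iff.1 (Finset.mem_range.1 hk))]
      _ = _ := by
          rw [h1]
          refine Finset.sum_congr rfl fun k hk => ?_
          rw [Nat.sub_add_comm (Nat.lt_succ_iff.1 (Finset.mem_range.1 hk)), Finset.mul_sum,
            Finset.mul_sum]
          refine Finset.sum_congr rfl fun j _ => ?_
          rw [pow_add]
          ring
  rw [hsum, kernelU_eq_sum hω hB hK hKreg hu N hα he, Finset.mul_sum, ← Finset.sum_sub_distrib,
    Finset.sum_mul]
  refine norm_sum_le_of_le _ fun k hk => ?_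
  rw [mul_left_comm (mehlerFactor ω b α t x y), ← mul_sub, norm_mul, norm_pow, Complex.norm_real,
    Real.norm_of_nonneg hα.le]
  calc _ ≤ α ^ k * (A k * α ^ (N - k)) := by
        gcongr
        exact hexp k α t x y hα hα1.le he
    _ = A k * (α ^ k * α ^ (N - k)) := by ring
    _ = _ := by rw [← pow_add, Nat.add_sub_cancel' (Nat.lt_succ_iff.1 (Finset.mem_range.1 hk))]

theorem mehlerFactor_ne_zero (hω : 0 < ω) {t : ℝ} (ht : Real.sin (ω * t) ≠ 0) (b : ℝ) {α : ℝ}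
    (hα : 0 < α) (x y : Plane) : mehlerFactor ω b α t x y ≠ 0 := by
  have h1 : (ω : ℂ) ≠ 0 := by exact_mod_cast hω.ne'
  have h2 : (α : ℂ) ≠ 0 := by exact_mod_cast hα.ne'
  have h3 : ((Real.sin (ω * t) : ℝ) : ℂ) ≠ 0 := by exact_mod_cast ht
  have h4 : (Real.pi : ℂ) ≠ 0 := by exact_mod_cast Real.pi_ne_zero
  exact div_ne_zero (mul_ne_zero h1 (Complex.exp_ne_zero _))
    (mul_ne_zero (mul_ne_zero (mul_ne_zero (mul_ne_zero two_ne_zero h4) Complex.I_ne_zero) h2) h3)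

theorem norm_inv_mehlerFactor_le (hω : 0 < ω) (b : ℝ) {α : ℝ} (hα : 0 < α) (t : ℝ)
    (x y : Plane) : ‖(mehlerFactor ω b α t x y)⁻¹‖ ≤ 2 * Real.pi / ω * α := by
  rw [mehlerFactor, norm_inv, norm_div, norm_mul, norm_exp_action, inv_div]
  simp only [norm_mul, Complex.norm_I, Complex.norm_real, Complex.norm_ofNat,
    Real.norm_of_nonneg hω.le, Real.norm_of_nonneg hα.le, Real.norm_of_nonneg Real.pi_pos.le,
    mul_one, Real.norm_eq_abs]
  have h := Real.abs_sin_le_one (ω * t)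
  calc 2 * Real.pi * α * |Real.sin (ω * t)| / ω ≤ 2 * Real.pi * α * 1 / ω := by gcongr
    _ = _ := by ring

theorem statPhaseL_zero (ω b B t : ℝ) (x y : Plane) (f : Plane → ℂ) :
    statPhaseL ω b B t x y 0 f = f (etaStar ω b t x y) := by
  simp [statPhaseL]

/-- The leading behaviour of the kernel where the cut-offs equal `1`. -/
theorem exists_kernel_leading (hω : 0 < ω) (hB : 0 < B) (hK : IsCompact K)
    (hKreg : K ⊆ region ω b) (hu : IsAmplitude θ ε ω b B u) (N : ℕ) :
    ∃ (α₀ C : ℝ), 0 < α₀ ∧ ∀ (α t : ℝ) (x y : Plane), 0 < α → α < α₀ → (t, x, y) ∈ K →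
      θ (ε⁻¹ • x) = 1 → θ (ε⁻¹ • y) = 1 →
      ∃ r : ℂ, ‖r‖ ≤ C * α ∧
        kernelU ω b B u N α t x y = mehlerFactor ω b α t x y * (1 + r) := by
  choose A hA hexp using fun k => exists_expansion hω hB hK hKreg hu k 0
  -- The value of the `k`-th amplitude at the critical point, divided by `(det Z)^{1/2}`.
  have hcont : ∀ k, ContinuousOn (fun e : ℝ × Plane × Plane =>
      (sqrtDetZ ω b B e.1 e.2.2 (etaStar ω b e.1 e.2.1 e.2.2))⁻¹ *
        u k e.1 e.2.2 (etaStar ω b e.1 e.2.1 e.2.2)) K := fun k =>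
    ((((smoothFam_sqrtDetZ hω hB).to_three.at_etaStar.continuousOn.mono hKreg).inv₀ fun e he =>
      sqrtDetZ_ne_zero hω hB (hKreg he).2)).mul
      ((hu.smoothFam k).at_etaStar.continuousOn.mono hKreg)
  choose V hV using fun k => hK.exists_bound_of_continuousOn (hcont k)
  refine ⟨1, 2 * Real.pi / ω * (∑ k ∈ Finset.range (N + 1), A k) +
    ∑ k ∈ Finset.range N, |V (k + 1)|, one_pos, fun α t x y hα hα1 he hθx hθy => ?_⟩
  have hreg : (t, x, y) ∈ region ω b := hKreg he
  obtain ⟨ht, hgood⟩ : Real.sin (ω * t) ≠ 0 ∧ Avoids ω b t y (etaStar ω b t x y) := hreg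
  set m := mehlerFactor ω b α t x y with hm
  have hm0 : m ≠ 0 := mehlerFactor_ne_zero hω ht b hα x y
  have hα' : (α : ℂ) ≠ 0 := by exact_mod_cast hα.ne'
  let v : ℕ → ℂ := fun k =>
    (sqrtDetZ ω b B t y (etaStar ω b t x y))⁻¹ * u k t y (etaStar ω b t x y)
  have hv0 : v 0 = 1 := by
    simp only [v]
    rw [hu.zero t y _ hgood, leadingAmp, cutoff, position_etaStar hω.ne' ht, hθx, hθy, mul_one,
      Complex.ofReal_one, one_mul, inv_mul_cancel₀ (sqrtDetZ_ne_zero hω hB hgood)]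
  let I : ℕ → ℂ := fun k => (((2 * Real.pi * α) ^ 2 : ℝ) : ℂ)⁻¹ *
    ∫ η, Complex.exp (Complex.I * phase ω b B t x y η / (α : ℂ)) * u k t y η
  have hI : ∀ k, ‖I k - m * v k‖ ≤ A k := fun k => by
    have h1 := hexp k α t x y hα hα1.le he
    simp only [zero_add, Finset.sum_range_one, pow_zero, one_mul, mul_one, statPhaseL_zero] at h1
    exact h1
  have hpow : ∀ k, ‖(α : ℂ) ^ k‖ ≤ 1 := fun k => by
    rw [norm_pow, Complex.norm_real, Real.norm_of_nonneg hα.le]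
    exact pow_le_one₀ hα.le hα1.le
  refine ⟨m⁻¹ * (∑ k ∈ Finset.range (N + 1), (α : ℂ) ^ k * (I k - m * v k)) +
    ∑ k ∈ Finset.range N, (α : ℂ) ^ (k + 1) * v (k + 1), ?_, ?_⟩
  · rw [add_mul]
    refine (norm_add_le _ _).trans (add_le_add ?_ ?_)
    · rw [norm_mul]
      have h2 : ‖∑ k ∈ Finset.range (N + 1), (α : ℂ) ^ k * (I k - m * v k)‖ ≤
          ∑ k ∈ Finset.range (N + 1), A k := norm_sum_le_of_le _ fun k _ => by
        rw [norm_mul]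
        exact (mul_le_of_le_one_left (norm_nonneg _) (hpow k)).trans (hI k)
      calc _ ≤ (2 * Real.pi / ω * α) * ∑ k ∈ Finset.range (N + 1), A k :=
            mul_le_mul (norm_inv_mehlerFactor_le hω b hα t x y) h2 (norm_nonneg _) (by positivity)
        _ = _ := by ring
    · rw [Finset.sum_mul]
      refine norm_sum_le_of_le _ fun k _ => ?_
      have h3 : ‖v (k + 1)‖ ≤ |V (k + 1)| := (hV (k + 1) _ he).trans (le_abs_self _)
      rw [pow_succ, mul_assoc, norm_mul, norm_mul, Complex.norm_real, Real.norm_of_nonneg hα.le,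
        mul_comm _ α]
      refine (mul_le_of_le_one_left (by positivity) (hpow k)).trans ?_
      gcongr
  · have h5 : kernelU ω b B u N α t x y = ∑ k ∈ Finset.range (N + 1), (α : ℂ) ^ k * I k :=
      kernelU_eq_sum hω hB hK hKreg hu N hα he
    have h4 : ∑ k ∈ Finset.range (N + 1), (α : ℂ) ^ k * (I k - m * v k) =
        (∑ k ∈ Finset.range (N + 1), (α : ℂ) ^ k * I k) -
          m * ∑ k ∈ Finset.range (N + 1), (α : ℂ) ^ k * v k := by
      rw [Finset.mul_sum, ← Finset.sum_sub_distrib]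
      exact Finset.sum_congr rfl fun k _ => by ring
    rw [h5, h4, Finset.sum_range_succ' fun k => (α : ℂ) ^ k * v k, hv0, pow_zero, mul_one]
    field_simp
    ring

end Kernel

end AharonovBohm

theorem mainTheorem2
    (ω b B ε : ℝ) (hω : 0 < ω) (hB : 0 < B) (hε : 0 < ε)
    (θ : Plane → ℝ) (hθ : ContDiff ℝ ((⊤ : ℕ∞) : WithTop ℕ∞) θ)
    (hθ_one : ∀ x : Plane, 2 < ‖x‖ → θ x = 1) (hθ_zero : ∀ x : Plane, ‖x‖ < 1 → θ x = 0)
    (K : Set (ℝ × Plane × Plane)) (hK : IsCompact K) (hKreg : K ⊆ region ω b) :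
    -- the amplitudes built from the transport equations are admissible
    IsAmplitude θ ε ω b B (transportAmp θ ε ω b B) ∧
    -- the critical point
    (∀ (t : ℝ) (x y : Plane), (t, x, y) ∈ K → ∀ η : Plane, Avoids ω b t y η →
      ContDiffAt ℝ ((⊤ : ℕ∞) : WithTop ℕ∞) (phase ω b B t x y) η ∧
      (fderiv ℝ (phase ω b B t x y) η = 0 ↔ η = etaStar ω b t x y)) ∧
    -- the action at the critical point
    (∀ (t : ℝ) (x y : Plane), (t, x, y) ∈ K →
      ∃ (ϑ : ℝ → ℝ) (l : ℤ), IsAngleLift ω b t y (etaStar ω b t x y) ϑ ∧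
        ϑ t - ϑ 0 = argPlane x - argPlane y + 2 * l * Real.pi ∧
        action ω b t y (etaStar ω b t x y) =
          ω / (2 * Real.sin (ω * t)) *
              (Real.cos (ω * t) * (‖x‖ ^ 2 + ‖y‖ ^ 2) - 2 * inner ℝ x y)
            + b * (argPlane x - argPlane y + 2 * l * Real.pi)) ∧
    -- the expansion of the kernel, for all admissible amplitudes and all orders
    (∀ (u : ℕ → ℝ → Plane → Plane → ℂ), IsAmplitude θ ε ω b B u → ∀ N : ℕ,
      (∀ (α t : ℝ) (x y : Plane), 0 < α → (t, x, y) ∈ K →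
        Integrable (kernelIntegrand ω b B u N α t x y)) ∧
      (∃ (α₀ C : ℝ), 0 < α₀ ∧ ∀ (α t : ℝ) (x y : Plane), 0 < α → α < α₀ → (t, x, y) ∈ K →
        ‖kernelU ω b B u N α t x y
            - mehlerFactor ω b α t x y
              * ∑ k ∈ Finset.range (N + 1), (α : ℂ) ^ k * coeffC ω b B u k t x y‖ ≤ C * α ^ N) ∧
      (∃ (α₀ C : ℝ), 0 < α₀ ∧ ∀ (α t : ℝ) (x y : Plane), 0 < α → α < α₀ → (t, x, y) ∈ K →
        θ (ε⁻¹ • x) = 1 → θ (ε⁻¹ • y) = 1 →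
        ∃ r : ℂ, ‖r‖ ≤ C * α ∧
          kernelU ω b B u N α t x y = mehlerFactor ω b α t x y * (1 + r))) := by
  refine ⟨isAmplitude_transportAmp hω hB hε hθ hθ_one hθ_zero, fun t x y he η hη => ?_,
    fun t x y he => ?_, fun u hu N => ⟨fun α t x y hα he =>
      integrable_kernelIntegrand hω hB hK hKreg hu N hα he,
      exists_kernel_expansion hω hB hK hKreg hu N, exists_kernel_leading hω hB hK hKreg hu N⟩⟩
  · have hreg : (t, x, y) ∈ region ω b := hKreg he
    exact ⟨contDiffAt_phase ω b B t x hη, fderiv_phase_eq_zero_iff hω hB hreg.1 x hη⟩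
  · have hreg : (t, x, y) ∈ region ω b := hKreg he
    exact exists_angleLift_action hω hreg.1 hreg.2
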